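/- Let $0<\alpha<1$, $a>0$, $\varepsilon\ge 0$, and let $g$ be locally integrable on $[0,\infty)$. Let $D^\alpha_t h(t)=\frac{1}{\Gamma(1-\alpha)}\int_0^t (t-\tau)^{-\alpha}h'(\tau)\,d\tau$ be the Caputo derivative. Consider the linear fractional advection problem $$\frac{\partial u}{\partial t}+a\frac{\partial u}{\partial x}+\varepsilon D^\alpha_t u=\delta(x)\,g(t)\quad (x\in\mathbb R,\ t>0),\qquad u(x,0)=0,$$ understood in the sense of distributions: $u$ is locally integrable on $\mathbb R\times[0,\infty)$ and, for every $\varphi\in C_c^\infty(\mathbb R^2)$ (not required to vanish at $t=0$), $$\int_0^\infty\!\!\int_{\mathbb R}u\,\bigl(-\partial_t\varphi-a\,\partial_x\varphi+\varepsilon D^{\alpha}_-\varphi\bigr)\,dx\,dt=\int_0^\infty g(t)\varphi(0,t)\,dt,\qquad D^\alpha_-\varphi(x,t)=\frac{-1}{\Gamma(1-\alpha)}\int_t^\infty(s-t)^{-\alpha}\partial_s\varphi(x,s)\,ds .$$ For $y>0$ let $h_\alpha(y,\cdot)$ be the inverse Laplace transform of $s\mapsto e^{-y s^\alpha}$ (principal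 branch), given by the Bromwich integral $h_\alpha(y,t)=\frac1{2\pi i}\int_{1-i\infty}^{1+i\infty}e^{st-ys^\alpha}ds$; for $y=0$ it is the Dirac mass at $t=0$. Then: 1. The problem has a solution, and it is unique up to a null set of $\mathbb R\times(0,\infty)$. It vanishes for $x\le 0$, and for $x>0$ $$u(x,t)=\frac1a\,\Bigl(h_\alpha\Bigl(\frac{\varepsilon x}{a},\cdot\Bigr)*g\Bigr)\Bigl(t-\frac xa\Bigr),$$ where $(h*g)(t)=\int_0^t h(\tau)g(t-\tau)\,d\tau$ for $t\ge0$ and $(h*g)(t)=0$ for $t<0$ (so $u(x,t)=\frac1a g(t-\frac xa)$ for $t\ge \frac xa$ when $\varepsilon=0$). 2. For every $y>0$ and $\operatorname{Re}s>0$, the function $e^{-st}h_\alpha(y,t)$ is integrable on $(0,\infty)$ and $\int_0^\infty e^{-st}h_\alpha(y,t)\,dt=e^{-ys^\alpha}$. 3. For all $y,t>0$, $$h_{1/3}(y,t)=\frac{y}{3^{1/3}t^{4/3}}\,\mathrm{Ai}\Bigl(\frac{y}{3^{1/3}t^{1/3}}\Bigr),\qquad h_{1/2}(y,t)=\frac{y}{2\sqrt\pi\,t^{3/2}}\,e^{-y^2/(4t)},$$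 where $\mathrm{Ai}(x)=\frac{1}{2\pi i}\int_{1-i\infty}^{1+i\infty}e^{v^3/3-xv}\,dv$ is the Airy function. -/

import Mathlib

open MeasureTheory Set
open scoped ContDiff

noncomputable section

namespace FracAdvection

/-- Caputo derivative of order `α` of a function `h` of time:
`D^α h (t) = 1/Γ(1-α) ∫_0^t (t-τ)^(-α) h'(τ) dτ`. -/
def caputoDeriv (α : ℝ) (h : ℝ → ℝ) (t : ℝ) : ℝ :=
  (1 / Real.Gamma (1 - α)) * ∫ τ in (0 : ℝ)..t, (t - τ) ^ (-α) * deriv h τ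

/-- Formal adjoint of the Caputo derivative, acting on test functions:
`-1/Γ(1-α) ∫_t^∞ (s-t)^(-α) φ'(s) ds`. It is the transpose of the distributional operator
`h ↦ (t_+^(-α)/Γ(1-α)) * dh/dt` on causal `h`; see `integral_caputoDeriv_mul`. -/
def caputoAdjoint (α : ℝ) (φ : ℝ → ℝ) (t : ℝ) : ℝ :=
  -((1 / Real.Gamma (1 - α)) * ∫ s in Ioi t, (s - t) ^ (-α) * deriv φ s)

theorem integrable_dom (α T C : ℝ) (hα : α < 1) (F : ℝ × ℝ → ℝ)
    (hm : AEStronglyMeasurable F ((volume.restrict (Ioi 0)).prod (volume.restrict (Ioi 0))))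
    (hF : ∀ t r, 0 < t → 0 < r →
      |F (t, r)| ≤ (Ioc (0 : ℝ) T).indicator (fun _ => C) t *
        (Ioc (0 : ℝ) T).indicator (fun r => r ^ (-α)) r) :
    Integrable F ((volume.restrict (Ioi 0)).prod (volume.restrict (Ioi 0))) := by
  have h1 : Integrable ((Ioc (0 : ℝ) T).indicator (fun _ => C)) (volume.restrict (Ioi 0)) := by
    refine Integrable.restrict ?_
    rw [integrable_indicator_iff measurableSet_Ioc]
    simp
  have h2 : Integrable ((Ioc (0 : ℝ) T).indicator (fun r => r ^ (-α)))
      (volume.restrict (Ioi 0)) := by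
    refine Integrable.restrict ?_
    rw [integrable_indicator_iff measurableSet_Ioc]
    rcases le_or_gt 0 T with hT | hT
    · rw [← intervalIntegrable_iff_integrableOn_Ioc_of_le hT]
      exact intervalIntegral.intervalIntegrable_rpow' (by linarith)
    · simp [Ioc_eq_empty (not_lt.mpr hT.le)]
  refine (h1.mul_prod h2).mono' hm ?_
  rw [Measure.prod_restrict]
  refine (ae_restrict_iff' (measurableSet_Ioi.prod measurableSet_Ioi)).2 (ae_of_all _ ?_)
  rintro ⟨t, r⟩ ⟨ht, hr⟩
  exact hF t r ht hr

theorem exists_bounds (p q : ℝ → ℝ) (hp : Continuous p) (hq : Continuous q)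
    (hs : HasCompactSupport q) :
    ∃ T C : ℝ, 0 ≤ C ∧ (∀ t, T < t → q t = 0) ∧
      (∀ τ t, 0 ≤ τ → τ ≤ T → |p τ * q t| ≤ C) := by
  obtain ⟨T, hT⟩ := hs.isCompact.isBounded.bddAbove
  obtain ⟨A, hA⟩ := (isCompact_Icc (a := (0 : ℝ)) (b := T)).exists_bound_of_continuousOn
    hp.continuousOn
  obtain ⟨B, hB⟩ := hs.exists_bound_of_continuous hq
  have hB0 : 0 ≤ B := (norm_nonneg _).trans (hB 0)
  refine ⟨T, |A| * B, by positivity, fun t ht => ?_, fun τ t h0 h1 => ?_⟩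
  · by_contra h
    exact absurd (hT (subset_tsupport q h)) (not_le.mpr ht)
  · rw [abs_mul]
    exact mul_le_mul ((hA τ ⟨h0, h1⟩).trans (le_abs_self A)) (hB t) (abs_nonneg _)
      (abs_nonneg _)

theorem integral_Ioi_shift (f : ℝ → ℝ) (b d : ℝ) :
    ∫ x in Ioi b, f (x + d) = ∫ x in Ioi (b + d), f x := by
  have h := (measurePreserving_add_right volume d).setIntegral_preimage_emb
    (measurableEmbedding_addRight d) f (Ioi (b + d))
  rw [← h]
  simp

theorem swap_adjoint (α : ℝ) (hα : α < 1) (p q : ℝ → ℝ) (hp : Continuous p)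
    (hq : Continuous q) (hs : HasCompactSupport q) :
    ∫ τ in Ioi (0 : ℝ), p τ * ∫ s in Ioi τ, (s - τ) ^ (-α) * q s
      = ∫ r in Ioi (0 : ℝ), r ^ (-α) * ∫ τ in Ioi (0 : ℝ), p τ * q (τ + r) := by
  obtain ⟨T, C, hC, hT, hb⟩ := exists_bounds p q hp hq hs
  have e1 : ∀ τ : ℝ, ∫ s in Ioi τ, (s - τ) ^ (-α) * q s
      = ∫ r in Ioi (0 : ℝ), r ^ (-α) * q (τ + r) := by
    intro τ
    have := integral_Ioi_shift (fun s => (s - τ) ^ (-α) * q s) 0 τ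
    simpa [add_comm] using this.symm
  simp_rw [e1, ← integral_const_mul]
  rw [integral_integral_swap]
  · refine integral_congr_ae (ae_of_all _ fun r => ?_)
    refine integral_congr_ae (ae_of_all _ fun τ => ?_)
    simp only
    ring
  · refine integrable_dom α T C hα _ ?_ ?_
    · apply Measurable.aestronglyMeasurable
      have := hp.measurable
      have := hq.measurable
      simp only [Function.uncurry_def]
      fun_prop
    · intro τ r hτ hr
      simp only [Function.uncurry_apply_pair]
      by_cases h : τ + r ≤ T
      · rw [indicator_of_mem (mem_Ioc.2 ⟨hτ, by linarith⟩),
          indicator_of_mem (mem_Ioc.2 ⟨hr, by linarith⟩)]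
        have h1 := hb τ (τ + r) hτ.le (by linarith)
        have h2 : 0 ≤ r ^ (-α) := Real.rpow_nonneg hr.le _
        calc |p τ * (r ^ (-α) * q (τ + r))| = |p τ * q (τ + r)| * r ^ (-α) := by
              rw [show p τ * (r ^ (-α) * q (τ + r)) = (p τ * q (τ + r)) * r ^ (-α) by ring,
                abs_mul, abs_of_nonneg h2]
          _ ≤ _ := mul_le_mul_of_nonneg_right h1 h2
      · rw [hT _ (not_le.mp h)]
        simp only [mul_zero, abs_zero]
        exact mul_nonneg (indicator_nonneg (fun _ _ => hC) _)
          (indicator_nonneg (fun x hx => Real.rpow_nonneg hx.1.le _) _)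

theorem swap_conv (α : ℝ) (hα : α < 1) (p q : ℝ → ℝ) (hp : Continuous p)
    (hq : Continuous q) (hs : HasCompactSupport q) :
    ∫ t in Ioi (0 : ℝ), (∫ τ in (0 : ℝ)..t, (t - τ) ^ (-α) * p τ) * q t
      = ∫ r in Ioi (0 : ℝ), r ^ (-α) * ∫ τ in Ioi (0 : ℝ), p τ * q (τ + r) := by
  obtain ⟨T, C, hC, hT, hb⟩ := exists_bounds p q hp hq hs
  have e1 : ∀ t ∈ Ioi (0 : ℝ), (∫ τ in (0 : ℝ)..t, (t - τ) ^ (-α) * p τ) * q t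
      = ∫ r in Ioi (0 : ℝ), (Iio t).indicator (fun r => r ^ (-α) * (p (t - r) * q t)) r := by
    intro t ht
    have ht' : (0 : ℝ) ≤ t := le_of_lt ht
    have h := intervalIntegral.integral_comp_sub_left (fun r => r ^ (-α) * p (t - r)) t
      (a := 0) (b := t)
    simp only [sub_sub_cancel, sub_self, sub_zero] at h
    rw [h, ← intervalIntegral.integral_mul_const, intervalIntegral.integral_of_le ht',
      integral_Ioc_eq_integral_Ioo, setIntegral_indicator measurableSet_Iio, Ioi_inter_Iio]
    refine integral_congr_ae (ae_of_all _ fun r => ?_)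
    simp only
    ring
  have e2 : ∀ r ∈ Ioi (0 : ℝ), r ^ (-α) * ∫ τ in Ioi (0 : ℝ), p τ * q (τ + r)
      = ∫ t in Ioi (0 : ℝ), (Iio t).indicator (fun r => r ^ (-α) * (p (t - r) * q t)) r := by
    intro r hr
    have h := integral_Ioi_shift (fun t => p (t - r) * q t) 0 r
    simp only [add_sub_cancel_right, zero_add] at h
    have h3 : ∀ t : ℝ, (Iio t).indicator (fun r => r ^ (-α) * (p (t - r) * q t)) r
        = (Ioi r).indicator (fun t => r ^ (-α) * (p (t - r) * q t)) t := fun t => rfl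
    simp_rw [h3]
    rw [h, ← integral_const_mul, setIntegral_indicator measurableSet_Ioi, Ioi_inter_Ioi,
      max_eq_right (le_of_lt hr)]
  rw [setIntegral_congr_fun measurableSet_Ioi e1, setIntegral_congr_fun measurableSet_Ioi e2,
    integral_integral_swap]
  refine integrable_dom α T C hα _ ?_ ?_
  · apply Measurable.aestronglyMeasurable
    have := hp.measurable
    have := hq.measurable
    have h3 : (Function.uncurry fun t r : ℝ =>
        (Iio t).indicator (fun r => r ^ (-α) * (p (t - r) * q t)) r)
        = {z : ℝ × ℝ | z.2 < z.1}.indicator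
          (fun z => z.2 ^ (-α) * (p (z.1 - z.2) * q z.1)) := rfl
    rw [h3]
    refine Measurable.indicator (by fun_prop) (measurableSet_lt measurable_snd measurable_fst)
  · intro t r ht hr
    have hnn : 0 ≤ (Ioc (0 : ℝ) T).indicator (fun _ => C) t *
        (Ioc (0 : ℝ) T).indicator (fun r => r ^ (-α)) r :=
      mul_nonneg (indicator_nonneg (fun _ _ => hC) _)
        (indicator_nonneg (fun x hx => Real.rpow_nonneg hx.1.le _) _)
    simp only [Function.uncurry_apply_pair]
    by_cases hrt : r < t
    · rw [indicator_of_mem (mem_Iio.2 hrt)]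
      by_cases h : t ≤ T
      · rw [indicator_of_mem (mem_Ioc.2 ⟨ht, h⟩),
          indicator_of_mem (mem_Ioc.2 ⟨hr, by linarith⟩)]
        have h1 := hb (t - r) t (by linarith) (by linarith)
        have h2 : 0 ≤ r ^ (-α) := Real.rpow_nonneg hr.le _
        rw [abs_mul, abs_of_nonneg h2, mul_comm]
        exact mul_le_mul_of_nonneg_right h1 h2
      · rw [hT _ (not_le.mp h)]
        simpa using hnn
    · rw [indicator_of_notMem (by simpa using hrt)]
      simpa using hnn

/-- Fractional integration by parts: `caputoAdjoint` is the adjoint of `caputoDeriv` on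
functions vanishing at time `0`. -/
theorem integral_caputoDeriv_mul (α : ℝ) (hα : α < 1) (h φ : ℝ → ℝ) (hh : ContDiff ℝ 1 h)
    (h0 : h 0 = 0) (hφ : ContDiff ℝ 1 φ) (hs : HasCompactSupport φ) :
    ∫ t in Ioi (0 : ℝ), caputoDeriv α h t * φ t
      = ∫ t in Ioi (0 : ℝ), h t * caputoAdjoint α φ t := by
  have ibp : ∀ r : ℝ, ∫ τ in Ioi (0 : ℝ), deriv h τ * φ (τ + r)
      = -∫ τ in Ioi (0 : ℝ), h τ * deriv φ (τ + r) := by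
    intro r
    have hφr : ContDiff ℝ 1 (fun τ => φ (τ + r)) := hφ.comp (contDiff_id.add contDiff_const)
    have hsr : HasCompactSupport (fun τ => φ (τ + r)) :=
      hs.comp_homeomorph (Homeomorph.addRight r)
    have hdr : deriv (fun τ => φ (τ + r)) = fun τ => deriv φ (τ + r) := by
      funext τ; exact deriv_comp_add_const φ r τ
    have hsd : HasCompactSupport (fun τ => deriv φ (τ + r)) := hdr ▸ hsr.deriv
    have key := HasCompactSupport.integral_Ioi_deriv_eq (hh.mul hφr) (hsr.mul_left) 0
    have hd : ∀ τ, deriv (fun τ => h τ * φ (τ + r)) τ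
        = deriv h τ * φ (τ + r) + h τ * deriv φ (τ + r) := by
      intro τ
      rw [deriv_fun_mul (hh.differentiable one_ne_zero τ)
        (hφr.differentiable one_ne_zero τ), congrFun hdr τ]
    have c1 : Continuous (deriv h) := hh.continuous_deriv le_rfl
    have c2 : Continuous (deriv φ) := hφ.continuous_deriv le_rfl
    have i1 : Integrable (fun τ => deriv h τ * φ (τ + r)) :=
      (c1.mul hφr.continuous).integrable_of_hasCompactSupport hsr.mul_left
    have i2 : Integrable (fun τ => h τ * deriv φ (τ + r)) :=
      (hh.continuous.mul (c2.comp (continuous_id.add continuous_const)))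
        |>.integrable_of_hasCompactSupport hsd.mul_left
    have key' : ∫ τ in Ioi (0 : ℝ), (deriv h τ * φ (τ + r) + h τ * deriv φ (τ + r)) = 0 := by
      simp_rw [← hd]
      simpa [h0] using key
    rw [integral_add i1.integrableOn i2.integrableOn] at key'
    linarith
  have A := swap_conv α hα (deriv h) φ (hh.continuous_deriv le_rfl) hφ.continuous hs
  have B := swap_adjoint α hα h (deriv φ) hh.continuous (hφ.continuous_deriv le_rfl) hs.deriv
  simp_rw [ibp, mul_neg, integral_neg] at A
  rw [← B] at A
  simp only [caputoDeriv, caputoAdjoint, mul_neg, integral_neg]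
  rw [show (fun t => (1 / Real.Gamma (1 - α) * ∫ τ in (0 : ℝ)..t, (t - τ) ^ (-α) * deriv h τ)
      * φ t) = fun t => 1 / Real.Gamma (1 - α) *
        ((∫ τ in (0 : ℝ)..t, (t - τ) ^ (-α) * deriv h τ) * φ t) by funext t; ring,
    show (fun t => h t * (1 / Real.Gamma (1 - α) * ∫ s in Ioi t, (s - t) ^ (-α) * deriv φ s))
      = fun t => 1 / Real.Gamma (1 - α) *
        (h t * ∫ s in Ioi t, (s - t) ^ (-α) * deriv φ s) by funext t; ring,
    integral_const_mul, integral_const_mul, A, mul_neg]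

/-- `u (x, t)` is a weak (distributional) solution of
`∂u/∂t + a ∂u/∂x + ε D_t^α u = δ(x) g(t)` for `x ∈ ℝ`, `t > 0`, with `u(x, 0) = 0`.
The test functions need not vanish at `t = 0`: this is how the zero initial value is imposed. -/
def IsWeakSolution (α a ε : ℝ) (g : ℝ → ℝ) (u : ℝ × ℝ → ℝ) : Prop :=
  LocallyIntegrableOn u {p : ℝ × ℝ | 0 ≤ p.2} ∧
  ∀ φ : ℝ × ℝ → ℝ, ContDiff ℝ ∞ φ → HasCompactSupport φ →
    ∫ p in {p : ℝ × ℝ | 0 < p.2},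
        u p * (-(deriv (fun t => φ (p.1, t)) p.2) - a * deriv (fun x => φ (x, p.2)) p.1
          + ε * caputoAdjoint α (fun t => φ (p.1, t)) p.2)
      = ∫ t in Ioi (0 : ℝ), g t * φ (0, t)

/-- Inverse Laplace transform by the Bromwich integral along the vertical line `Re s = σ`:
`(1/(2πi)) ∫_{σ-i∞}^{σ+i∞} exp(s t) F(s) ds`, with `s = σ + iw`. -/
def bromwich (F : ℂ → ℂ) (σ t : ℝ) : ℂ :=
  (1 / (2 * Real.pi) : ℝ) *
    ∫ w : ℝ, Complex.exp (((σ : ℂ) + w * Complex.I) * t) * F ((σ : ℂ) + w * Complex.I)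

/-- `h_α(y, t)`, the inverse Laplace transform in `t` of `s ↦ exp(-y s^α)` (principal branch),
for `y > 0`. The integral converges absolutely and is real. -/
def kernel (α y t : ℝ) : ℝ :=
  (bromwich (fun s => Complex.exp (-(y : ℂ) * s ^ (α : ℂ))) 1 t).re

/-- The Airy function `Ai(x) = (1/(2πi)) ∫ exp(v³/3 - x v) dv`, along the line
`v = 1 + iw` (an absolutely convergent contour integral, equal to
`(1/π) ∫_0^∞ cos(k³/3 + x k) dk`; it is real). -/
def airyAi (x : ℝ) : ℝ :=
  ((1 / (2 * Real.pi) : ℝ) *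
    ∫ w : ℝ, Complex.exp ((1 + (w : ℂ) * Complex.I) ^ 3 / 3
      - (x : ℂ) * (1 + (w : ℂ) * Complex.I))).re

/-- The causal convolution in time `(h_α(y, ·) * f)(t) = ∫_0^t h_α(y, τ) f(t-τ) dτ`, zero for
`t < 0` (only the values of `f` on `[0, ∞)` enter). For `y = 0` the inverse Laplace transform of
`exp(0) = 1` is the Dirac mass at `0`, whose convolution with `f` is `f`. -/
def kernelConv (α y : ℝ) (f : ℝ → ℝ) (t : ℝ) : ℝ :=
  if y = 0 then (if 0 ≤ t then f t else 0)
  else ∫ τ in Ioc 0 t, kernel α y τ * f (t - τ)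

/-- The closed form: `(1/a) (h_α(εx/a, ·) * g)(t - x/a)` for `x > 0`, and `0` for `x ≤ 0`. -/
def closedForm (α a ε : ℝ) (g : ℝ → ℝ) (p : ℝ × ℝ) : ℝ :=
  if 0 < p.1 then (1 / a) * kernelConv α (ε * p.1 / a) g (p.2 - p.1 / a) else 0

end FracAdvection

end

/-!
The function `exp (-y s^α)` is holomorphic on the right half plane and decays there uniformly along
vertical lines, so its Bromwich integral does not depend on the line. Letting the line tend to
infinity shows that `h_α(y, t)` vanishes for `t < 0`, and Fourier inversion on the line gives the
Laplace transform. For `α = 1 / n` the substitution `v = s ^ (1 / n)` turns the Bromwich integral of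
`t h_α(y, t)` into the integral of `exp (t v ^ n - y v)` over a curve with asymptotes of argument
`± π / (2 n)`, which can be deformed to a vertical line.

In the characteristic coordinates `x`, `τ = t - x / a` a Laplace transform in time turns the adjoint
operator `-∂_t - a ∂_x + ε D^α_-` into `-a ∂_x + ε s^α`, whose integrating factor is
`exp (-(ε / a) x s^α)`: this is the statement that `u` with `g` replaced by the Dirac mass is a
fundamental solution. Superposing its time translates gives existence. For uniqueness, correlating
the fundamental solution with a test function `ψ` solves the adjoint equation with source `ψ`, and
the correlation is compactly supported in every half plane `t ≥ τ` because the fundamental solution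
is carried by the cone `0 ≤ x ≤ a t`; hence two weak solutions have the same pairing with every `ψ`
supported in positive times.
-/

noncomputable section

namespace FracAdvection

open Filter Topology Complex

section VerticalLines

theorem hasDerivAt_add_ofReal_mul_I (c : ℂ) (w : ℝ) :
    HasDerivAt (fun w : ℝ => c + w * I) I w := by
  simpa using ((ofRealCLM.hasDerivAt (x := w)).mul_const I).const_add c

theorem intervalIntegral_vertical_sub_eq {E : Type*} [NormedAddCommGroup E] [NormedSpace ℂ E]
    {H : ℂ → E} {σ₁ σ₂ : ℝ} (hd : ∀ s : ℂ, s.re ∈ uIcc σ₁ σ₂ → DifferentiableAt ℂ H s) (R : ℝ) :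
    (∫ w in (-R)..R, H (σ₂ + w * I)) - ∫ w in (-R)..R, H (σ₁ + w * I)
      = I • ((∫ x in σ₁..σ₂, H (x + (-R : ℝ) * I)) - ∫ x in σ₁..σ₂, H (x + R * I)) := by
  have h := integral_boundary_rect_eq_zero_of_differentiableOn H (σ₁ + (-R : ℝ) * I) (σ₂ + R * I)
    fun s hs => (hd s (by simpa using hs.1)).differentiableWithinAt
  simp only [add_re, ofReal_re, mul_re, I_re, mul_zero, ofReal_im, I_im, mul_one, sub_self,
    add_zero, add_im, mul_im, zero_add] at h
  have h' := congrArg (I • ·) h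
  simp only [smul_sub, smul_add, smul_smul, I_mul_I, neg_smul, one_smul, smul_zero] at h'
  rw [smul_sub, ← sub_eq_zero, ← neg_eq_zero, ← h']
  abel

theorem tendsto_integral_horizontal {E : Type*} [NormedAddCommGroup E] [NormedSpace ℂ E]
    {H : ℂ → E} {σ₁ σ₂ : ℝ} {m : ℝ → ℝ} {l : Filter ℝ} (hm : Tendsto m l (𝓝 0))
    (hb : ∀ s : ℂ, s.re ∈ uIcc σ₁ σ₂ → ‖H s‖ ≤ m s.im) :
    Tendsto (fun R : ℝ => ∫ x in σ₁..σ₂, H (x + R * I)) l (𝓝 0) := by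
  refine squeeze_zero_norm (fun R => ?_) (by simpa using hm.mul_const |σ₂ - σ₁|)
  refine intervalIntegral.norm_integral_le_of_norm_le_const fun x hx => ?_
  simpa using hb (x + R * I) (by simpa using uIoc_subset_uIcc hx)

theorem continuous_vertical {E : Type*} [TopologicalSpace E] {H : ℂ → E} {σ : ℝ}
    (hc : ∀ s : ℂ, s.re = σ → ContinuousAt H s) : Continuous fun w : ℝ => H (σ + w * I) :=
  continuous_iff_continuousAt.2 fun w =>
    ContinuousAt.comp (f := fun w : ℝ => (σ + w * I : ℂ)) (hc _ (by simp)) (by fun_prop)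

theorem integrable_vertical {E : Type*} [NormedAddCommGroup E]
    {H : ℂ → E} {σ : ℝ} {m : ℝ → ℝ} (hc : ∀ s : ℂ, s.re = σ → ContinuousAt H s)
    (hm : Integrable m) (hb : ∀ s : ℂ, s.re = σ → ‖H s‖ ≤ m s.im) :
    Integrable fun w : ℝ => H (σ + w * I) :=
  hm.mono' (continuous_vertical hc).aestronglyMeasurable
    (ae_of_all _ fun w => by simpa using hb (σ + w * I) (by simp))

theorem integral_vertical_eq {E : Type*} [NormedAddCommGroup E] [NormedSpace ℂ E]
    {H : ℂ → E} {σ₁ σ₂ : ℝ} {m : ℝ → ℝ}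
    (hd : ∀ s : ℂ, s.re ∈ uIcc σ₁ σ₂ → DifferentiableAt ℂ H s) (hm : Integrable m)
    (hm0 : Tendsto m (cocompact ℝ) (𝓝 0)) (hb : ∀ s : ℂ, s.re ∈ uIcc σ₁ σ₂ → ‖H s‖ ≤ m s.im) :
    ∫ w : ℝ, H (σ₁ + w * I) = ∫ w : ℝ, H (σ₂ + w * I) := by
  rw [cocompact_eq_atBot_atTop, tendsto_sup] at hm0
  have hlim : ∀ σ ∈ uIcc σ₁ σ₂, Tendsto (fun R : ℝ => ∫ w in (-R)..R, H (σ + w * I)) atTop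
      (𝓝 (∫ w : ℝ, H (σ + w * I))) := fun σ hσ =>
    intervalIntegral_tendsto_integral (integrable_vertical
      (fun s hs => (hd s (hs ▸ hσ)).continuousAt) hm fun s hs => hb s (hs ▸ hσ))
      tendsto_neg_atTop_atBot tendsto_id
  have hdiff := (hlim σ₂ right_mem_uIcc).sub (hlim σ₁ left_mem_uIcc)
  simp_rw [intervalIntegral_vertical_sub_eq hd] at hdiff
  have hzero := (((tendsto_integral_horizontal hm0.1 hb).comp tendsto_neg_atTop_atBot).sub
    (tendsto_integral_horizontal hm0.2 hb)).const_smul I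
  simp only [sub_self, smul_zero] at hzero
  exact (sub_eq_zero.1 (tendsto_nhds_unique hdiff hzero)).symm

end VerticalLines

section BromwichInversion

/-- `F` is holomorphic on the right half plane and bounded there by an integrable function `m` of
the imaginary part that vanishes at infinity. For such `F` the Bromwich integral inverts the Laplace
transform. -/
structure IsBromwichMajorant (F : ℂ → ℂ) (m : ℝ → ℝ) : Prop where
  differentiableAt : ∀ s : ℂ, 0 < s.re → DifferentiableAt ℂ F s
  norm_le : ∀ s : ℂ, 0 < s.re → ‖F s‖ ≤ m s.im
  integrable : Integrable m
  tendsto_zero : Tendsto m (cocompact ℝ) (𝓝 0)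

theorem norm_exp_vertical_mul (σ w t : ℝ) :
    ‖exp (((σ : ℂ) + w * I) * t)‖ = Real.exp (σ * t) := by
  rw [norm_exp]; simp

theorem integrable_exp_mul_vertical {F : ℂ → ℂ} {σ : ℝ}
    (hF : Integrable fun w : ℝ => F (σ + w * I)) (t : ℝ) :
    Integrable fun w : ℝ => exp (((σ : ℂ) + w * I) * t) * F (σ + w * I) :=
  hF.bdd_mul (c := Real.exp (σ * t)) (Continuous.aestronglyMeasurable (by fun_prop))
    (ae_of_all _ fun w => (norm_exp_vertical_mul σ w t).le)

theorem norm_bromwich_le_of_norm_le {F : ℂ → ℂ} {σ : ℝ} {m : ℝ → ℝ} (hm : Integrable m)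
    (hF : ∀ᵐ w : ℝ, ‖F (σ + w * I)‖ ≤ m w) (t : ℝ) :
    ‖bromwich F σ t‖ ≤ Real.exp (σ * t) * (1 / (2 * Real.pi) * ∫ w, m w) := by
  rw [bromwich, norm_mul, norm_real, Real.norm_of_nonneg (by positivity), mul_left_comm,
    ← integral_const_mul]
  refine mul_le_mul_of_nonneg_left ?_ (by positivity)
  refine norm_integral_le_of_norm_le (hm.const_mul _) ?_
  filter_upwards [hF] with w hw
  rw [norm_mul, norm_exp_vertical_mul]
  exact mul_le_mul_of_nonneg_left hw (Real.exp_pos _).le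

theorem mul_bromwich_eq_neg_bromwich_deriv {F : ℂ → ℂ} {σ : ℝ}
    (hd : ∀ s : ℂ, s.re = σ → DifferentiableAt ℂ F s)
    (hF : Integrable fun w : ℝ => F (σ + w * I))
    (hF' : Integrable fun w : ℝ => deriv F (σ + w * I)) (t : ℝ) :
    t * bromwich F σ t = -bromwich (deriv F) σ t := by
  have hi := integrable_exp_mul_vertical hF t
  have hi' := integrable_exp_mul_vertical hF' t
  have hderiv : ∀ w : ℝ,
      HasDerivAt (fun w : ℝ => exp (((σ : ℂ) + w * I) * t) * F (σ + w * I))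
        (I * t * (exp (((σ : ℂ) + w * I) * t) * F (σ + w * I))
          + I * (exp (((σ : ℂ) + w * I) * t) * deriv F (σ + w * I))) w := by
    intro w
    have hl := hasDerivAt_add_ofReal_mul_I σ w
    refine ((hl.mul_const (t : ℂ)).cexp.mul ((hd _ (by simp)).hasDerivAt.comp w hl)).congr_deriv ?_
    simp only [Function.comp_def]
    ring
  have h := integral_eq_zero_of_hasDerivAt_of_integrable hderiv
    ((hi.const_mul _).add (hi'.const_mul _)) hi
  rw [integral_add (hi.const_mul _) (hi'.const_mul _), integral_const_mul, integral_const_mul,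
    mul_assoc, ← mul_add] at h
  have h' := (mul_eq_zero.1 h).resolve_left I_ne_zero
  simp only [bromwich]
  linear_combination ((1 / (2 * Real.pi) : ℝ) : ℂ) * h'

theorem eq_integral_exp_mul_of_integrable {f F : ℝ → ℂ} (hc : Continuous f) (hf : Integrable f)
    (hF : Integrable F) (h : ∀ w : ℝ, F w = ∫ τ : ℝ, exp (w * τ * I) * f τ) (x : ℝ) :
    f x = (1 / (2 * Real.pi) : ℝ) * ∫ w : ℝ, exp (-(w * x * I)) * F w := by
  have hinv : ∀ v : ℝ, FourierTransformInv.fourierInv f v = F (2 * Real.pi * v) := by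
    intro v
    rw [Real.fourierInv_eq', h]
    refine integral_congr_ae (ae_of_all _ fun τ => ?_)
    simp only [RCLike.inner_apply, conj_trivial, smul_eq_mul]
    push_cast
    ring_nf
  have hfour : Integrable (FourierTransform.fourier f) := by
    have : FourierTransform.fourier f = fun v => F (-(2 * Real.pi) * v) := by
      funext v
      have := hinv (-v)
      rw [Real.fourierInv_eq_fourier_neg, neg_neg] at this
      rw [this]; ring_nf
    rw [this]
    exact hF.comp_mul_left' (by simp [Real.pi_ne_zero])
  have hscale := Measure.integral_comp_mul_left (fun w : ℝ => exp (-(w * x * I)) * F w)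
    (2 * Real.pi)
  rw [abs_of_nonneg (by positivity)] at hscale
  rw [← congrFun (hc.fourier_fourierInv_eq hf hfour) x, Real.fourier_real_eq_integral_exp_smul,
    one_div, ← Complex.real_smul, ← hscale]
  refine integral_congr_ae (ae_of_all _ fun v => ?_)
  simp only [hinv, smul_eq_mul]
  push_cast
  ring_nf

theorem eq_integral_exp_neg_mul_bromwich {F : ℂ → ℂ} {σ : ℝ}
    (hc : Continuous fun w : ℝ => F (σ + w * I)) (hF : Integrable fun w : ℝ => F (σ + w * I))
    (hB : Integrable fun t : ℝ => exp (-σ * t) * bromwich F σ t) (w : ℝ) :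
    F (σ + w * I) = ∫ t : ℝ, exp (-((σ : ℂ) + w * I) * t) * bromwich F σ t := by
  have hpi : (Real.pi : ℂ) ≠ 0 := by simp [Real.pi_ne_zero]
  have hfourier : ∀ t : ℝ, 2 * Real.pi * (exp (-σ * t) * bromwich F σ t)
      = ∫ u : ℝ, exp (t * u * I) * F (σ + u * I) := by
    intro t
    have hshift : ∫ u : ℝ, exp (((σ : ℂ) + u * I) * t) * F (σ + u * I)
        = exp (σ * t) * ∫ u : ℝ, exp (t * u * I) * F (σ + u * I) := by
      rw [← integral_const_mul]
      refine integral_congr_ae (ae_of_all _ fun u => ?_)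
      simp only
      rw [← mul_assoc, ← exp_add]
      ring_nf
    rw [bromwich, hshift, neg_mul, exp_neg]
    generalize ∫ u : ℝ, exp (t * u * I) * F (σ + u * I) = J
    push_cast
    field_simp
  rw [eq_integral_exp_mul_of_integrable hc hF (hB.const_mul (2 * Real.pi)) hfourier w,
    ← integral_const_mul]
  refine integral_congr_ae (ae_of_all _ fun t => ?_)
  simp only
  rw [show -((σ : ℂ) + w * I) * t = -σ * t + -(t * w * I) by ring, exp_add]
  push_cast
  field_simp

theorem measurable_bromwich {F : ℂ → ℂ} {σ : ℝ} (hF : Continuous fun w : ℝ => F (σ + w * I)) :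
    Measurable (bromwich F σ) := by
  have h : Measurable fun z : ℝ × ℝ => exp (((σ : ℂ) + z.2 * I) * z.1) * F (σ + z.2 * I) :=
    Measurable.mul (by fun_prop) (hF.measurable.comp measurable_snd)
  exact h.stronglyMeasurable.integral_prod_right.measurable.const_mul _

namespace IsBromwichMajorant

variable {F : ℂ → ℂ} {m : ℝ → ℝ} {σ : ℝ}

theorem continuous_vertical (h : IsBromwichMajorant F m) (hσ : 0 < σ) :
    Continuous fun w : ℝ => F (σ + w * I) :=
  FracAdvection.continuous_vertical fun s hs => (h.differentiableAt s (hs ▸ hσ)).continuousAt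

theorem integrable_vertical (h : IsBromwichMajorant F m) (hσ : 0 < σ) :
    Integrable fun w : ℝ => F (σ + w * I) :=
  FracAdvection.integrable_vertical (fun s hs => (h.differentiableAt s (hs ▸ hσ)).continuousAt)
    h.integrable fun s hs => h.norm_le s (hs ▸ hσ)

theorem bromwich_eq (h : IsBromwichMajorant F m) {σ₁ σ₂ : ℝ} (h₁ : 0 < σ₁) (h₂ : 0 < σ₂) (t : ℝ) :
    bromwich F σ₁ t = bromwich F σ₂ t := by
  have hpos : ∀ s : ℂ, s.re ∈ uIcc σ₁ σ₂ → 0 < s.re := fun s hs => (lt_min h₁ h₂).trans_le hs.1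
  refine congrArg _ (integral_vertical_eq (H := fun s => exp (s * t) * F s)
    (m := fun w => Real.exp (max σ₁ σ₂ * |t|) * m w) (fun s hs => ?_) (h.integrable.const_mul _)
    (by simpa using h.tendsto_zero.const_mul (Real.exp (max σ₁ σ₂ * |t|))) fun s hs => ?_)
  · exact (by fun_prop : DifferentiableAt ℂ (fun s : ℂ => exp (s * t)) s).mul
      (h.differentiableAt s (hpos s hs))
  · rw [norm_mul, norm_exp, re_mul_ofReal]
    refine mul_le_mul (Real.exp_le_exp.2 ?_) (h.norm_le s (hpos s hs)) (norm_nonneg _)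
      (Real.exp_pos _).le
    exact (mul_le_mul_of_nonneg_left (le_abs_self t) (hpos s hs).le).trans
      (mul_le_mul_of_nonneg_right hs.2 (abs_nonneg t))

theorem norm_bromwich_le (h : IsBromwichMajorant F m) (hσ : 0 < σ) (t : ℝ) :
    ‖bromwich F σ t‖ ≤ Real.exp (σ * t) * (1 / (2 * Real.pi) * ∫ w, m w) :=
  norm_bromwich_le_of_norm_le h.integrable
    (ae_of_all _ fun w => by simpa using h.norm_le (σ + w * I) (by simpa using hσ)) t

theorem bromwich_eq_zero_of_neg (h : IsBromwichMajorant F m) (hσ : 0 < σ) {t : ℝ} (ht : t < 0) :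
    bromwich F σ t = 0 := by
  have hlim : Tendsto (fun ρ : ℝ => Real.exp (ρ * t) * (1 / (2 * Real.pi) * ∫ w, m w)) atTop
      (𝓝 0) := by
    simpa using (Real.tendsto_exp_atBot.comp
      (tendsto_id.atTop_mul_const_of_neg ht)).mul_const (1 / (2 * Real.pi) * ∫ w, m w)
  refine norm_le_zero_iff.1 (ge_of_tendsto hlim ?_)
  filter_upwards [eventually_gt_atTop 0] with ρ hρ
  exact h.bromwich_eq hσ hρ t ▸ h.norm_bromwich_le hρ t

theorem integrable_exp_neg_mul_bromwich (h : IsBromwichMajorant F m) {s : ℂ} (hσ : 0 < σ)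
    (hs : 0 < s.re) : Integrable fun t : ℝ => exp (-s * t) * bromwich F σ t := by
  set C := 1 / (2 * Real.pi) * ∫ w, m w
  have hdom : Integrable ((Ioi (0 : ℝ)).indicator fun t => Real.exp (-(s.re / 2) * t) * C) :=
    IntegrableOn.integrable_indicator ((exp_neg_integrableOn_Ioi 0 (half_pos hs)).mul_const C)
      measurableSet_Ioi
  refine hdom.mono' (Measurable.mul (by fun_prop)
    (measurable_bromwich (h.continuous_vertical hσ))).aestronglyMeasurable ?_
  filter_upwards [Measure.ae_ne volume 0] with t ht
  rcases lt_or_gt_of_ne ht with ht | ht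
  · simp [h.bromwich_eq_zero_of_neg hσ ht, ht.le]
  · rw [indicator_of_mem (mem_Ioi.2 ht), norm_mul, norm_exp, h.bromwich_eq hσ (half_pos hs)]
    calc Real.exp (-s * t).re * ‖bromwich F (s.re / 2) t‖
        ≤ Real.exp (-s * t).re * (Real.exp (s.re / 2 * t) * C) := by
          gcongr
          exact h.norm_bromwich_le (half_pos hs) t
      _ = Real.exp (-(s.re / 2) * t) * C := by
          rw [← mul_assoc, ← Real.exp_add, re_mul_ofReal, neg_re]
          ring_nf

theorem integral_exp_neg_mul_bromwich (h : IsBromwichMajorant F m) {s : ℂ} (hσ : 0 < σ)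
    (hs : 0 < s.re) : ∫ t : ℝ, exp (-s * t) * bromwich F σ t = F s := by
  have hB := h.integrable_exp_neg_mul_bromwich (s := (s.re : ℂ)) hs (by simpa using hs)
  have hinv := eq_integral_exp_neg_mul_bromwich (h.continuous_vertical hs)
    (h.integrable_vertical hs) hB s.im
  rw [re_add_im] at hinv
  rw [hinv]
  simp_rw [h.bromwich_eq hσ hs]

theorem setIntegral_exp_neg_mul_bromwich (h : IsBromwichMajorant F m) {s : ℂ} (hσ : 0 < σ)
    (hs : 0 < s.re) : ∫ t in Ioi (0 : ℝ), exp (-s * t) * bromwich F σ t = F s := by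
  rw [← h.integral_exp_neg_mul_bromwich hσ hs, ← setIntegral_univ (μ := volume)]
  refine (setIntegral_eq_of_subset_of_ae_sdiff_eq_zero MeasurableSet.univ.nullMeasurableSet
    (subset_univ _) ?_).symm
  filter_upwards [Measure.ae_ne volume 0] with t ht htpos
  have : t < 0 := lt_of_le_of_ne (by simpa using htpos) ht
  simp [h.bromwich_eq_zero_of_neg hσ this]

end IsBromwichMajorant

end BromwichInversion

section StretchedExponential

variable {p q b : ℝ}

theorem integral_abs_rpow_mul_exp (hp : 0 < p) (hq : -1 < q) (hb : 0 < b) :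
    ∫ x : ℝ, |x| ^ q * Real.exp (-b * |x| ^ p)
      = 2 * (b ^ (-(q + 1) / p) * (1 / p) * Real.Gamma ((q + 1) / p)) := by
  rw [integral_comp_abs (f := fun x => x ^ q * Real.exp (-b * x ^ p)),
    integral_rpow_mul_exp_neg_mul_rpow hp hq hb]

theorem integrable_abs_rpow_mul_exp (hp : 0 < p) (hq : -1 < q) (hb : 0 < b) :
    Integrable fun x : ℝ => |x| ^ q * Real.exp (-b * |x| ^ p) := by
  refine Integrable.of_integral_ne_zero ?_
  rw [integral_abs_rpow_mul_exp hp hq hb]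
  have : 0 < Real.Gamma ((q + 1) / p) := Real.Gamma_pos_of_pos (div_pos (by linarith) hp)
  positivity

theorem integrable_exp_neg_mul_abs_rpow (hp : 0 < p) (hb : 0 < b) :
    Integrable fun x : ℝ => Real.exp (-b * |x| ^ p) := by
  simpa using integrable_abs_rpow_mul_exp (q := 0) hp (by norm_num) hb

theorem tendsto_exp_neg_mul_abs_rpow_cocompact (hp : 0 < p) (hb : 0 < b) :
    Tendsto (fun x : ℝ => Real.exp (-b * |x| ^ p)) (cocompact ℝ) (𝓝 0) :=
  Real.tendsto_exp_atBot.comp (((tendsto_rpow_atTop hp).comp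
    (tendsto_norm_cocompact_atTop (E := ℝ))).const_mul_atTop_of_neg (neg_neg_of_pos hb))

end StretchedExponential

section Symbol

variable {α y : ℝ}

/-- The Laplace transform `exp (-y s^α)` of the kernel, as a function of the dual variable `s`. -/
def symbol (α y : ℝ) (s : ℂ) : ℂ := exp (-(y : ℂ) * s ^ (α : ℂ))

/-- The constant `c` of the sector estimate `c |s|^α ≤ Re s^α` for `Re s > 0`: the image of the
right half plane under `s ↦ s^α` is the sector of half-opening `πα/2`. -/
def sectorConst (α : ℝ) : ℝ := Real.cos (Real.pi / 2 * α)

theorem sectorConst_pos (h0 : 0 < α) (h1 : α < 1) : 0 < sectorConst α := by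
  apply Real.cos_pos_of_mem_Ioo
  have := Real.pi_pos
  constructor <;> nlinarith

theorem sectorConst_mul_norm_rpow_le_re_cpow (h0 : 0 ≤ α) (h1 : α ≤ 1) {s : ℂ} (hs : 0 ≤ s.re) :
    sectorConst α * ‖s‖ ^ α ≤ (s ^ (α : ℂ)).re := by
  rw [cpow_ofReal_re, mul_comm]
  refine mul_le_mul_of_nonneg_left ?_ (by positivity)
  have ha : |arg s| ≤ Real.pi / 2 := abs_arg_le_pi_div_two_iff.2 hs
  rw [← Real.cos_abs (arg s * α), abs_mul, abs_of_nonneg h0, sectorConst]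
  apply Real.cos_le_cos_of_nonneg_of_le_pi
  · positivity
  · nlinarith [Real.pi_pos]
  · gcongr

theorem norm_symbol_le (h0 : 0 < α) (h1 : α < 1) (hy : 0 ≤ y) {s : ℂ} (hs : 0 ≤ s.re) :
    ‖symbol α y s‖ ≤ Real.exp (-(y * sectorConst α) * |s.im| ^ α) := by
  have hc := (sectorConst_pos h0 h1).le
  rw [symbol, norm_exp, Real.exp_le_exp, ← ofReal_neg, re_ofReal_mul, neg_mul, neg_mul,
    neg_le_neg_iff, mul_assoc]
  gcongr
  calc sectorConst α * |s.im| ^ α ≤ sectorConst α * ‖s‖ ^ α := by gcongr; exact abs_im_le_norm s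
    _ ≤ (s ^ (α : ℂ)).re := sectorConst_mul_norm_rpow_le_re_cpow h0.le h1.le hs

theorem hasDerivAt_symbol (α y : ℝ) {s : ℂ} (hs : s ∈ slitPlane) :
    HasDerivAt (symbol α y) (symbol α y s * (-(y : ℂ) * (α * s ^ ((α : ℂ) - 1)))) s := by
  have h : HasDerivAt (fun s : ℂ => s ^ (α : ℂ)) ((α : ℂ) * s ^ ((α : ℂ) - 1)) s := by
    simpa using (hasDerivAt_id s).cpow_const (c := (α : ℂ)) hs
  exact (h.const_mul _).cexp

theorem isBromwichMajorant_symbol (h0 : 0 < α) (h1 : α < 1) (hy : 0 < y) :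
    IsBromwichMajorant (symbol α y) fun w => Real.exp (-(y * sectorConst α) * |w| ^ α) where
  differentiableAt _ hs := (hasDerivAt_symbol α y (Or.inl hs)).differentiableAt
  norm_le _ hs := norm_symbol_le h0 h1 hy.le hs.le
  integrable := integrable_exp_neg_mul_abs_rpow h0 (mul_pos hy (sectorConst_pos h0 h1))
  tendsto_zero := tendsto_exp_neg_mul_abs_rpow_cocompact h0 (mul_pos hy (sectorConst_pos h0 h1))

theorem conj_symbol (α y : ℝ) {s : ℂ} (hs : s ∈ slitPlane) :
    (starRingEnd ℂ) (symbol α y s) = symbol α y ((starRingEnd ℂ) s) := by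
  have h := cpow_conj s (α : ℂ) (mem_slitPlane_iff_arg.1 hs).1
  rw [conj_ofReal] at h
  rw [symbol, symbol, ← exp_conj, map_mul, map_neg, conj_ofReal, h, conj_conj]

theorem norm_deriv_symbol_le (h0 : 0 < α) (h1 : α < 1) (hy : 0 ≤ y) {s : ℂ} (hs : 0 ≤ s.re)
    (him : s.im ≠ 0) : ‖deriv (symbol α y) s‖
      ≤ y * α * (|s.im| ^ (α - 1) * Real.exp (-(y * sectorConst α) * |s.im| ^ α)) := by
  have hsymbol := norm_symbol_le h0 h1 hy hs
  have hpow : ‖s ^ ((α : ℂ) - 1)‖ ≤ |s.im| ^ (α - 1) := by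
    rw [show (α : ℂ) - 1 = ((α - 1 : ℝ) : ℂ) by push_cast; ring, norm_cpow_real]
    exact Real.rpow_le_rpow_of_nonpos (abs_pos.2 him) (abs_im_le_norm s) (by linarith)
  rw [(hasDerivAt_symbol α y (Or.inr him)).deriv, norm_mul, norm_mul, norm_mul, norm_neg,
    norm_real, norm_real, Real.norm_of_nonneg hy, Real.norm_of_nonneg h0.le]
  calc _ ≤ Real.exp (-(y * sectorConst α) * |s.im| ^ α) * (y * (α * |s.im| ^ (α - 1))) := by gcongr
    _ = _ := by ring

theorem ae_norm_deriv_symbol_vertical_le (h0 : 0 < α) (h1 : α < 1) (hy : 0 ≤ y) {σ : ℝ}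
    (hσ : 0 ≤ σ) : ∀ᵐ w : ℝ, ‖deriv (symbol α y) (σ + w * I)‖
      ≤ y * α * (|w| ^ (α - 1) * Real.exp (-(y * sectorConst α) * |w| ^ α)) := by
  filter_upwards [Measure.ae_ne volume 0] with w hw
  simpa using norm_deriv_symbol_le h0 h1 hy (s := σ + w * I) (by simpa using hσ) (by simpa using hw)

theorem integrable_deriv_symbol_vertical (h0 : 0 < α) (h1 : α < 1) (hy : 0 < y) {σ : ℝ}
    (hσ : 0 ≤ σ) : Integrable fun w : ℝ => deriv (symbol α y) (σ + w * I) :=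
  ((integrable_abs_rpow_mul_exp (q := α - 1) h0 (by linarith)
    (mul_pos hy (sectorConst_pos h0 h1))).const_mul (y * α)).mono'
    ((measurable_deriv _).comp (by fun_prop)).aestronglyMeasurable
    (ae_norm_deriv_symbol_vertical_le h0 h1 hy.le hσ)

end Symbol

section Kernel

variable {α y : ℝ}

theorem ofReal_kernel (α y t : ℝ) : (kernel α y t : ℂ) = bromwich (symbol α y) 1 t := by
  rw [show kernel α y t = (bromwich (symbol α y) 1 t).re from rfl, ← conj_eq_iff_re, bromwich,
    map_mul, conj_ofReal, ← integral_conj, ← integral_neg_eq_self]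
  congr 1
  refine integral_congr_ae (ae_of_all _ fun w => ?_)
  have h : (starRingEnd ℂ) (((1 : ℝ) : ℂ) + ((-w : ℝ) : ℂ) * I) = ((1 : ℝ) : ℂ) + w * I := by
    simp
  simp only
  rw [map_mul, conj_symbol α y (Or.inl (by simp)), ← exp_conj, map_mul, h, conj_ofReal]

theorem ofReal_kernel_eq_bromwich (h0 : 0 < α) (h1 : α < 1) (hy : 0 < y) {σ : ℝ} (hσ : 0 < σ)
    (t : ℝ) : (kernel α y t : ℂ) = bromwich (symbol α y) σ t := by
  rw [ofReal_kernel, (isBromwichMajorant_symbol h0 h1 hy).bromwich_eq one_pos hσ]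

theorem kernel_eq_zero_of_neg {t : ℝ} (h0 : 0 < α) (h1 : α < 1) (hy : 0 < y) (ht : t < 0) :
    kernel α y t = 0 := by
  have h := (isBromwichMajorant_symbol h0 h1 hy).bromwich_eq_zero_of_neg one_pos ht
  rwa [← ofReal_kernel, ofReal_eq_zero] at h

theorem integrable_exp_neg_mul_kernel (h0 : 0 < α) (h1 : α < 1) (hy : 0 < y) {s : ℂ}
    (hs : 0 < s.re) : Integrable fun t : ℝ => exp (-s * t) * (kernel α y t : ℂ) := by
  simp_rw [ofReal_kernel]
  exact (isBromwichMajorant_symbol h0 h1 hy).integrable_exp_neg_mul_bromwich one_pos hs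

theorem integral_exp_neg_mul_kernel (h0 : 0 < α) (h1 : α < 1) (hy : 0 < y) {s : ℂ}
    (hs : 0 < s.re) :
    ∫ t in Ioi (0 : ℝ), exp (-s * t) * (kernel α y t : ℂ) = symbol α y s := by
  simp_rw [ofReal_kernel]
  exact (isBromwichMajorant_symbol h0 h1 hy).setIntegral_exp_neg_mul_bromwich one_pos hs

theorem measurable_kernel (α : ℝ) : Measurable fun p : ℝ × ℝ => kernel α p.1 p.2 := by
  have h : Measurable fun z : (ℝ × ℝ) × ℝ =>
      exp ((((1 : ℝ) : ℂ) + z.2 * I) * z.1.2) * symbol α z.1.1 ((1 : ℝ) + z.2 * I) := by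
    unfold symbol
    fun_prop
  exact measurable_re.comp (h.stronglyMeasurable.integral_prod_right.measurable.const_mul _)

theorem abs_kernel_le_rpow (h0 : 0 < α) (h1 : α < 1) :
    ∃ C, 0 ≤ C ∧ ∀ y t : ℝ, 0 < y → 0 < t → |kernel α y t| ≤ C * y ^ (-1 / α) := by
  have hc := sectorConst_pos h0 h1
  refine ⟨Real.exp 1 * (1 / (2 * Real.pi) * (2 * (sectorConst α ^ (-1 / α) * (1 / α) *
    Real.Gamma (1 / α)))), ?_, fun y t hy ht => ?_⟩
  · have := Real.Gamma_pos_of_pos (one_div_pos.2 h0)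
    positivity
  · have hσ := one_div_pos.2 ht
    have h := (isBromwichMajorant_symbol h0 h1 hy).norm_bromwich_le hσ t
    have hint := integral_abs_rpow_mul_exp (q := 0) h0 (by norm_num) (mul_pos hy hc)
    simp only [Real.rpow_zero, one_mul, zero_add] at hint
    rw [← ofReal_kernel_eq_bromwich h0 h1 hy hσ, norm_real, Real.norm_eq_abs, hint,
      Real.mul_rpow hy.le hc.le, one_div_mul_cancel ht.ne'] at h
    refine h.trans (le_of_eq ?_)
    ring

theorem mul_kernel_eq_neg_bromwich_deriv (h0 : 0 < α) (h1 : α < 1) (hy : 0 < y) {σ : ℝ}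
    (hσ : 0 < σ) (t : ℝ) :
    ((t * kernel α y t : ℝ) : ℂ) = -bromwich (deriv (symbol α y)) σ t := by
  have hF := isBromwichMajorant_symbol h0 h1 hy
  rw [ofReal_mul, ofReal_kernel_eq_bromwich h0 h1 hy hσ]
  exact mul_bromwich_eq_neg_bromwich_deriv (fun s hs => hF.differentiableAt s (hs ▸ hσ))
    (hF.integrable_vertical hσ) (integrable_deriv_symbol_vertical h0 h1 hy hσ.le) t

theorem abs_mul_kernel_le (h0 : 0 < α) (h1 : α < 1) (hy : 0 < y) {σ : ℝ} (hσ : 0 < σ) (t : ℝ) :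
    |t * kernel α y t| ≤ Real.exp (σ * t) * (1 / (2 * Real.pi) * (2 * (sectorConst α)⁻¹)) := by
  have hc := sectorConst_pos h0 h1
  have hb := mul_pos hy hc
  have h := norm_bromwich_le_of_norm_le
    ((integrable_abs_rpow_mul_exp (q := α - 1) h0 (by linarith) hb).const_mul (y * α))
    (ae_norm_deriv_symbol_vertical_le h0 h1 hy.le hσ.le) t
  rw [← norm_neg, ← mul_kernel_eq_neg_bromwich_deriv h0 h1 hy hσ, norm_real, Real.norm_eq_abs,
    integral_const_mul, integral_abs_rpow_mul_exp h0 (by linarith) hb, sub_add_cancel, neg_div,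
    div_self h0.ne', Real.rpow_neg_one, Real.Gamma_one] at h
  refine h.trans (le_of_eq ?_)
  field_simp

theorem abs_kernel_le_inv (h0 : 0 < α) (h1 : α < 1) :
    ∃ C, 0 ≤ C ∧ ∀ y t : ℝ, 0 < y → 0 < t → |kernel α y t| ≤ C * t⁻¹ := by
  have hc := sectorConst_pos h0 h1
  refine ⟨Real.exp 1 * (1 / (2 * Real.pi) * (2 * (sectorConst α)⁻¹)), by positivity,
    fun y t hy ht => ?_⟩
  have h := abs_mul_kernel_le h0 h1 hy (one_div_pos.2 ht) t
  rwa [one_div_mul_cancel ht.ne', abs_mul, abs_of_pos ht, mul_comm t, ← le_div_iff₀ ht,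
    div_eq_mul_inv] at h

theorem abs_kernel_le_mul_rpow (h0 : 0 < α) (h1 : α < 1) :
    ∃ C, 0 ≤ C ∧ ∀ y t : ℝ, 0 < y → 0 < t →
      |kernel α y t| ≤ C * (y ^ (-1 / 2 : ℝ) * t ^ (α / 2 - 1)) := by
  obtain ⟨C₁, hC₁, hle₁⟩ := abs_kernel_le_rpow h0 h1
  obtain ⟨C₂, hC₂, hle₂⟩ := abs_kernel_le_inv h0 h1
  refine ⟨C₁ ^ (α / 2) * C₂ ^ (1 - α / 2), by positivity, fun y t hy ht => ?_⟩
  calc |kernel α y t| = |kernel α y t| ^ (α / 2) * |kernel α y t| ^ (1 - α / 2) := by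
        rw [← Real.rpow_add' (abs_nonneg _) (by norm_num)]
        simp
    _ ≤ (C₁ * y ^ (-1 / α)) ^ (α / 2) * (C₂ * t⁻¹) ^ (1 - α / 2) := by
        gcongr
        · exact hle₁ y t hy ht
        · linarith
        · exact hle₂ y t hy ht
    _ = C₁ ^ (α / 2) * C₂ ^ (1 - α / 2) * (y ^ (-1 / 2 : ℝ) * t ^ (α / 2 - 1)) := by
        rw [Real.mul_rpow hC₁ (by positivity), Real.mul_rpow hC₂ (by positivity),
          ← Real.rpow_mul hy.le, Real.inv_rpow ht.le, ← Real.rpow_neg ht.le,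
          show -1 / α * (α / 2) = -1 / 2 by field_simp, neg_sub]
        ring

end Kernel

section Primitives

variable {P E : ℂ → ℂ}

theorem norm_sub_le_of_horizontal (hP : ∀ v, HasDerivAt P (E v) v) {c p q B : ℝ} (hcp : c ≤ p)
    (hB : ∀ x ∈ Icc c p, ‖E (x + q * I)‖ ≤ B) :
    ‖P (p + q * I) - P (c + q * I)‖ ≤ B * (p - c) := by
  refine norm_image_sub_le_of_norm_deriv_le_segment' (f := fun x : ℝ => P (x + q * I))
    (f' := fun x : ℝ => E (x + q * I)) (a := c) (b := p) (fun x _ => ?_)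
    (fun x hx => hB x ⟨hx.1, hx.2.le⟩) p (right_mem_Icc.2 hcp)
  have hl : HasDerivAt (fun x : ℝ => (x + q * I : ℂ)) 1 x := by
    simpa using (ofRealCLM.hasDerivAt (x := x)).add_const (q * I : ℂ)
  exact (((hP _).comp x hl).congr_deriv (mul_one _)).hasDerivWithinAt

theorem tendsto_exp_neg_mul_mul_sub (K c : ℝ) {d : ℝ} (hd : 0 < d) :
    Tendsto (fun x : ℝ => K * Real.exp (-d * x) * (x - c)) atTop (𝓝 0) := by
  have hmul : Tendsto (fun x : ℝ => x * Real.exp (-d * x)) atTop (𝓝 0) := by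
    simpa using Real.tendsto_pow_mul_exp_neg_atTop_nhds_zero 1 |>.comp
      (tendsto_id.const_mul_atTop hd) |>.const_mul (1 / d) |>.congr (fun x => by
        simp only [Function.comp_apply, pow_one, id]; field_simp)
  have hexp : Tendsto (fun x : ℝ => Real.exp (-d * x)) atTop (𝓝 0) :=
    Real.tendsto_exp_atBot.comp (tendsto_id.const_mul_atTop_of_neg (by linarith))
  have h := (hmul.sub (hexp.mul_const c)).const_mul K
  simp only [zero_mul, sub_zero, mul_zero] at h
  exact h.congr fun x => by ring

theorem tendsto_sub_of_horizontal (hP : ∀ v, HasDerivAt P (E v) v) {ι : Type*} {l : Filter ι}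
    {z : ι → ℂ} {c d K : ℝ} (hd : 0 < d) (hz : Tendsto (fun i => (z i).re) l atTop)
    (hE : ∀ᶠ i in l, ∀ x ∈ Icc c (z i).re,
      ‖E (x + (z i).im * I)‖ ≤ K * Real.exp (-d * (z i).re)) :
    Tendsto (fun i => P (z i) - P (c + (z i).im * I)) l (𝓝 0) := by
  refine squeeze_zero_norm' ?_ ((tendsto_exp_neg_mul_mul_sub K c hd).comp hz)
  filter_upwards [hE, hz.eventually_ge_atTop c] with i hi hci
  have h := norm_sub_le_of_horizontal hP hci hi
  rwa [re_add_im] at h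

theorem tendsto_sub_vertical (hP : ∀ v, HasDerivAt P (E v) v) {ι : Type*} {l : Filter ι}
    [l.IsCountablyGenerated] {c : ℝ} {q : ι → ℝ} (hE : Integrable fun w : ℝ => E (c + w * I))
    (hq : Tendsto q l atTop) :
    Tendsto (fun i => P (c + q i * I) - P (c + (-q i : ℝ) * I)) l
      (𝓝 (I * ∫ w : ℝ, E (c + w * I))) := by
  refine ((intervalIntegral_tendsto_integral hE (tendsto_neg_atTop_atBot.comp hq) hq).const_mul
    I).congr fun i => ?_
  rw [← intervalIntegral.integral_const_mul]
  exact intervalIntegral.integral_eq_sub_of_hasDerivAt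
    (fun w _ => ((hP _).comp w (hasDerivAt_add_ofReal_mul_I c w)).congr_deriv (mul_comm _ _))
    (hE.const_mul I).intervalIntegrable

end Primitives

section RootContour

variable {n : ℕ}

/-- The image of the Bromwich line `Re s = 1` under the substitution `v = s ^ (1 / n)`. -/
def rootContour (n : ℕ) (R : ℝ) : ℂ := (1 + R * I : ℂ) ^ ((1 / n : ℝ) : ℂ)

theorem rootContour_pow (hn : n ≠ 0) (R : ℝ) : rootContour n R ^ n = 1 + R * I := by
  rw [rootContour, show ((1 / n : ℝ) : ℂ) = (n : ℂ)⁻¹ by push_cast; ring, cpow_nat_inv_pow _ hn]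

theorem rootContour_neg (n : ℕ) (R : ℝ) :
    rootContour n (-R) = (starRingEnd ℂ) (rootContour n R) := by
  have h := cpow_conj (1 + R * I : ℂ) ((1 / n : ℝ) : ℂ)
    (mem_slitPlane_iff_arg.1 (Or.inl (by simp))).1
  rw [conj_ofReal, show (starRingEnd ℂ) (1 + R * I : ℂ) = 1 + (-R : ℝ) * I by simp] at h
  rw [rootContour, rootContour, h, conj_conj]

theorem hasDerivAt_rootContour (n : ℕ) (R : ℝ) : HasDerivAt (rootContour n)
    ((1 / n : ℝ) * (1 + R * I : ℂ) ^ (((1 / n : ℝ) : ℂ) - 1) * I) R := by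
  have hpow : HasDerivAt (fun s : ℂ => s ^ ((1 / n : ℝ) : ℂ)) _ (1 + R * I : ℂ) :=
    (hasDerivAt_id (1 + R * I : ℂ)).cpow_const (Or.inl (by simp))
  rw [id, mul_one] at hpow
  exact hpow.comp R (hasDerivAt_add_ofReal_mul_I 1 R)

theorem arg_one_add_ofReal_mul_I (R : ℝ) : arg (1 + R * I) = Real.arctan R := by
  have hnorm : ‖(1 + R * I : ℂ)‖ = √(1 + R ^ 2) := by simpa using norm_add_mul_I 1 R
  rw [arg_of_re_nonneg (by simp), Real.arctan_eq_arcsin, hnorm]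
  simp

theorem tendsto_norm_one_add_ofReal_mul_I_rpow {p : ℝ} (hp : 0 < p) :
    Tendsto (fun R : ℝ => ‖(1 + R * I : ℂ)‖ ^ p) atTop atTop := by
  refine (tendsto_rpow_atTop hp).comp (tendsto_atTop_mono (fun R => ?_) tendsto_id)
  calc R ≤ |(1 + R * I : ℂ).im| := by simpa using le_abs_self R
    _ ≤ ‖(1 + R * I : ℂ)‖ := abs_im_le_norm _

theorem tendsto_arctan_mul_one_div (n : ℕ) :
    Tendsto (fun R => Real.arctan R * (1 / n : ℝ)) atTop (𝓝 (Real.pi / 2 * (1 / n : ℝ))) :=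
  (Real.tendsto_arctan_atTop.mono_right nhdsWithin_le_nhds).mul_const _

theorem tendsto_re_rootContour (hn : 2 ≤ n) :
    Tendsto (fun R => (rootContour n R).re) atTop atTop := by
  have hn' : (2 : ℝ) ≤ n := by exact_mod_cast hn
  have hpos : 0 < Real.cos (Real.pi / 2 * (1 / n : ℝ)) :=
    sectorConst_pos (by positivity) (by rw [div_lt_one] <;> linarith)
  simp_rw [rootContour, cpow_ofReal_re, arg_one_add_ofReal_mul_I]
  exact (tendsto_norm_one_add_ofReal_mul_I_rpow (by positivity)).atTop_mul_pos hpos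
    ((Real.continuous_cos.tendsto _).comp (tendsto_arctan_mul_one_div n))

theorem tendsto_im_rootContour (hn : n ≠ 0) :
    Tendsto (fun R => (rootContour n R).im) atTop atTop := by
  have hn' : (1 : ℝ) ≤ n := by exact_mod_cast Nat.one_le_iff_ne_zero.2 hn
  have hpos : 0 < Real.sin (Real.pi / 2 * (1 / n : ℝ)) := by
    refine Real.sin_pos_of_pos_of_lt_pi (by positivity) ?_
    rw [mul_one_div, div_lt_iff₀ (by positivity)]
    nlinarith [Real.pi_pos]
  simp_rw [rootContour, cpow_ofReal_im, arg_one_add_ofReal_mul_I]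
  exact (tendsto_norm_one_add_ofReal_mul_I_rpow (by positivity)).atTop_mul_pos hpos
    ((Real.continuous_sin.tendsto _).comp (tendsto_arctan_mul_one_div n))

end RootContour

section KernelOneDivNat

variable {n : ℕ} {y t : ℝ}

theorem norm_exp_mul_pow_sub (t y : ℝ) (n : ℕ) (z : ℂ) :
    ‖exp (t * z ^ n - y * z)‖ = Real.exp (t * (z ^ n).re - y * z.re) := by
  rw [norm_exp, sub_re, re_ofReal_mul, re_ofReal_mul]

theorem hasDerivAt_comp_rootContour (hn : n ≠ 0) (y t : ℝ) {P : ℂ → ℂ}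
    (hP : ∀ v, HasDerivAt P (exp (t * v ^ n - y * v)) v) (w : ℝ) :
    HasDerivAt (fun w : ℝ => y * I * P (rootContour n w))
      (exp ((((1 : ℝ) : ℂ) + w * I) * t) * deriv (symbol (1 / n) y) ((1 : ℝ) + w * I)) w := by
  refine (((hP _).comp w (hasDerivAt_rootContour n w)).const_mul (y * I)).congr_deriv ?_
  rw [(hasDerivAt_symbol (1 / n) y (s := ((1 : ℝ) : ℂ) + w * I) (Or.inl (by simp))).deriv,
    rootContour_pow hn, sub_eq_add_neg, exp_add, symbol, rootContour]
  simp only [ofReal_one, neg_mul, mul_comm (t : ℂ)]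
  generalize exp ((1 + w * I) * (t : ℂ)) = A
  generalize exp (-(y * (1 + w * I : ℂ) ^ ((1 / n : ℝ) : ℂ))) = B
  linear_combination (y : ℂ) * A * B * ((1 / n : ℝ) *
    (1 + w * I : ℂ) ^ (((1 / n : ℝ) : ℂ) - 1)) * I_mul_I

theorem tendsto_sub_rootContour (hn : 2 ≤ n) (hy : 0 < y) {P : ℂ → ℂ}
    (hP : ∀ v, HasDerivAt P (exp (t * v ^ n - y * v)) v) :
    Tendsto (fun R : ℝ => -((1 / (2 * Real.pi) : ℝ) *
      (y * I * (P (rootContour n R) - P (rootContour n (-R)))))) atTop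
      (𝓝 ((t * kernel (1 / n) y t : ℝ) : ℂ)) := by
  have hn' : (2 : ℝ) ≤ n := by exact_mod_cast hn
  have h0 : (0 : ℝ) < 1 / n := by positivity
  have h1 : (1 : ℝ) / n < 1 := by rw [div_lt_one] <;> linarith
  have hint := integrable_exp_mul_vertical
    (integrable_deriv_symbol_vertical h0 h1 hy zero_le_one) t
  rw [mul_kernel_eq_neg_bromwich_deriv h0 h1 hy one_pos]
  refine (((intervalIntegral_tendsto_integral hint tendsto_neg_atTop_atBot
    tendsto_id).const_mul _).neg).congr fun R => ?_
  rw [id, mul_sub, intervalIntegral.integral_eq_sub_of_hasDerivAt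
    (fun w _ => hasDerivAt_comp_rootContour (by lia) y t hP w) hint.intervalIntegrable]

theorem kernel_one_div_nat_eq_integral {c K d : ℝ} (hn : 2 ≤ n) (hy : 0 < y) (ht : t ≠ 0)
    (hd : 0 < d)
    (hE : ∀ p q x : ℝ, 4 ≤ p → ((p + q * I : ℂ) ^ n).re = 1 → x ∈ Icc c p →
      ‖exp (t * (x + q * I : ℂ) ^ n - y * (x + q * I : ℂ))‖ ≤ K * Real.exp (-d * p))
    (hint : Integrable fun w : ℝ => exp (t * (c + w * I : ℂ) ^ n - y * (c + w * I : ℂ))) :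
    (kernel (1 / n) y t : ℂ) = (y / t : ℝ) * ((1 / (2 * Real.pi) : ℝ) *
      ∫ w : ℝ, exp (t * (c + w * I : ℂ) ^ n - y * (c + w * I : ℂ))) := by
  obtain ⟨P, hP⟩ := (by fun_prop : Differentiable ℂ fun v : ℂ =>
    exp (t * v ^ n - y * v)).isExactOn_univ
  replace hP : ∀ v, HasDerivAt P (exp (t * v ^ n - y * v)) v := fun v => hP v (mem_univ v)
  have hre := tendsto_re_rootContour hn
  have hpow : ∀ R, (rootContour n R ^ n).re = 1 := fun R => by
    simp [rootContour_pow (by lia : n ≠ 0)]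
  have htop : Tendsto (fun R => P (rootContour n R) - P (c + (rootContour n R).im * I)) atTop
      (𝓝 0) := by
    refine tendsto_sub_of_horizontal (K := K) hP hd hre ?_
    filter_upwards [hre.eventually_ge_atTop 4] with R hR x hx
    exact hE _ _ x hR (by rw [re_add_im, hpow]) hx
  have hbot : Tendsto (fun R => P (rootContour n (-R)) -
      P (c + (rootContour n (-R)).im * I)) atTop (𝓝 0) := by
    have hre' : ∀ R, (rootContour n (-R)).re = (rootContour n R).re := by simp [rootContour_neg]
    refine tendsto_sub_of_horizontal (K := K) hP hd (by simpa only [hre'] using hre) ?_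
    filter_upwards [hre.eventually_ge_atTop 4] with R hR x hx
    exact hE _ _ x (by rwa [hre']) (by rw [re_add_im, hpow]) hx
  have him : ∀ R, (rootContour n (-R)).im = -(rootContour n R).im := by simp [rootContour_neg]
  simp_rw [him] at hbot
  have hcontour := (htop.add (tendsto_sub_vertical hP hint
    (tendsto_im_rootContour (n := n) (by lia)))).sub hbot
  simp only [zero_add, sub_zero] at hcontour
  have hkernel := tendsto_nhds_unique (tendsto_sub_rootContour hn hy hP)
    ((((hcontour.congr fun R => by ring).const_mul (y * I : ℂ)).const_mul _).neg)
  have htc : (t : ℂ) ≠ 0 := by exact_mod_cast ht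
  rw [ofReal_mul] at hkernel
  rw [ofReal_div, div_mul_eq_mul_div, eq_div_iff htc, mul_comm, hkernel]
  linear_combination -(((1 / (2 * Real.pi) : ℝ) : ℂ) * y *
    ∫ w : ℝ, exp (t * (c + w * I : ℂ) ^ n - y * (c + w * I : ℂ))) * I_mul_I

end KernelOneDivNat

section KernelOneHalf

variable {y t : ℝ}

theorem exponent_one_half_le (hy : 0 ≤ y) (ht : 0 ≤ t) {p q x : ℝ} (hp : 4 ≤ p)
    (hpq : p ^ 2 - q ^ 2 = 1) (hx : x ∈ Icc 0 p) :
    t * (x ^ 2 - q ^ 2) - y * x ≤ t + -min t (y / 2) * p := by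
  obtain ⟨hx0, hxp⟩ := hx
  have hmint := min_le_left t (y / 2)
  have hminy := min_le_right t (y / 2)
  rcases le_total x (p / 2) with hx2 | hx2
  · have : x ^ 2 - q ^ 2 ≤ 1 - p := by nlinarith
    nlinarith [mul_le_mul_of_nonneg_left this ht, mul_nonneg hy hx0]
  · have : x ^ 2 - q ^ 2 ≤ 1 := by nlinarith
    nlinarith [mul_le_mul_of_nonneg_left this ht]

theorem exp_mul_sq_sub_vertical (y t w : ℝ) :
    exp (t * ((0 : ℝ) + w * I : ℂ) ^ 2 - y * ((0 : ℝ) + w * I : ℂ))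
      = exp (I * (-y : ℝ) * w) * exp (-(t : ℂ) * w ^ 2) := by
  rw [← exp_add]
  congr 1
  push_cast
  linear_combination (t : ℂ) * w ^ 2 * I_sq

theorem integrable_exp_mul_sq_sub_vertical (y : ℝ) (ht : 0 < t) :
    Integrable fun w : ℝ => exp (t * ((0 : ℝ) + w * I : ℂ) ^ 2 - y * ((0 : ℝ) + w * I : ℂ)) := by
  simp_rw [exp_mul_sq_sub_vertical]
  refine (integrable_cexp_neg_mul_sq (b := t) (by simpa using ht)).bdd_mul (c := 1)
    (Continuous.aestronglyMeasurable (by fun_prop)) (ae_of_all _ fun w => ?_)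
  rw [norm_exp]
  simp

theorem integral_exp_mul_sq_sub_vertical (y : ℝ) (ht : 0 < t) :
    ∫ w : ℝ, exp (t * ((0 : ℝ) + w * I : ℂ) ^ 2 - y * ((0 : ℝ) + w * I : ℂ))
      = (√Real.pi / √t * Real.exp (-(y ^ 2) / (4 * t)) : ℝ) := by
  have hsqrt : ((Real.pi : ℂ) / t) ^ (1 / 2 : ℂ) = ((√Real.pi / √t : ℝ) : ℂ) := by
    rw [← Real.sqrt_div Real.pi_pos.le, Real.sqrt_eq_rpow, ofReal_cpow (by positivity)]
    push_cast
    rfl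
  simp_rw [exp_mul_sq_sub_vertical]
  rw [fourierIntegral_gaussian (by simpa using ht), hsqrt]
  push_cast
  ring_nf

theorem kernel_one_half (hy : 0 < y) (ht : 0 < t) :
    kernel (1 / 2) y t
      = y / (2 * √Real.pi * t ^ (3 / 2 : ℝ)) * Real.exp (-(y ^ 2) / (4 * t)) := by
  have hre : ∀ p q : ℝ, ((p + q * I : ℂ) ^ 2).re = p ^ 2 - q ^ 2 := by intro p q; simp [pow_two]
  have h := kernel_one_div_nat_eq_integral le_rfl hy ht.ne' (lt_min ht (half_pos hy))
    (K := Real.exp t) (fun p q x hp hpq hx => ?_) (integrable_exp_mul_sq_sub_vertical y ht)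
  · rw [integral_exp_mul_sq_sub_vertical y ht] at h
    have hkernel : kernel (1 / 2) y t = y / t * (1 / (2 * Real.pi) * (√Real.pi / √t *
        Real.exp (-(y ^ 2) / (4 * t)))) := by exact_mod_cast h
    have hpow : t ^ (3 / 2 : ℝ) = t * √t := by
      rw [Real.sqrt_eq_rpow, ← Real.rpow_one_add' ht.le (by norm_num)]
      norm_num
    have hpi := Real.sq_sqrt Real.pi_pos.le
    have := Real.sqrt_pos.2 ht
    rw [hkernel, hpow]
    nth_rewrite 1 [← hpi]
    field_simp
  · rw [hre] at hpq
    rw [norm_exp_mul_pow_sub, hre, ← Real.exp_add, Real.exp_le_exp]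
    simpa using exponent_one_half_le hy.le ht.le hp hpq hx

end KernelOneHalf

section KernelOneThird

variable {y t : ℝ}

theorem re_add_mul_I_pow_three (p q : ℝ) : ((p + q * I : ℂ) ^ 3).re = p ^ 3 - 3 * p * q ^ 2 := by
  simp [pow_succ]
  ring

theorem exponent_one_third_le {c : ℝ} (hc : 0 ≤ c) (hy : 0 ≤ y) (ht : 0 ≤ t) {p q x : ℝ}
    (hp : 4 ≤ p) (hpq : p ^ 3 - 3 * p * q ^ 2 = 1) (hx : x ∈ Icc c p) :
    t * (x ^ 3 - 3 * x * q ^ 2) - y * x ≤ t + -min (t * c) (y / 2) * p := by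
  obtain ⟨hxc, hxp⟩ := hx
  have hx0 : 0 ≤ x := hc.trans hxc
  have hp0 : 0 < p := by linarith
  have hmint := mul_le_mul_of_nonneg_right (min_le_left (t * c) (y / 2)) hp0.le
  have hminy := mul_le_mul_of_nonneg_right (min_le_right (t * c) (y / 2)) hp0.le
  have hxp0 := mul_nonneg (mul_nonneg hx0 hp0.le) (sub_nonneg.2 hxp)
  have hcubic : x ^ 3 - 3 * x * q ^ 2 ≤ 1 - x * p * (p - x) := by
    have hmul : p * (x ^ 3 - 3 * x * q ^ 2) = x - x * p * (p - x) * (p + x) := by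
      linear_combination x * hpq
    refine le_of_mul_le_mul_left ?_ hp0
    rw [hmul]
    nlinarith [mul_nonneg hxp0 hx0]
  have htcubic := mul_le_mul_of_nonneg_left hcubic ht
  rcases le_total x (p / 2) with hx2 | hx2
  · have hcp : c * p ≤ x * p * (p - x) := by
      have : 1 ≤ p - x := by linarith
      nlinarith [mul_le_mul_of_nonneg_right hxc hp0.le, mul_nonneg hx0 hp0.le]
    nlinarith [mul_le_mul_of_nonneg_left hcp ht, mul_nonneg hy hx0]
  · nlinarith [mul_nonneg ht hxp0]

theorem integrable_exp_mul_cube_sub_vertical {c : ℝ} (hc : 0 < c) (y : ℝ) (ht : 0 < t) :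
    Integrable fun w : ℝ => exp (t * (c + w * I : ℂ) ^ 3 - y * (c + w * I : ℂ)) := by
  refine ((integrable_exp_neg_mul_sq (b := 3 * t * c) (by positivity)).const_mul
    (Real.exp (t * c ^ 3 - y * c))).mono' (Continuous.aestronglyMeasurable (by fun_prop))
    (ae_of_all _ fun w => ?_)
  rw [norm_exp_mul_pow_sub, re_add_mul_I_pow_three, ← Real.exp_add]
  apply le_of_eq
  simp only [add_re, ofReal_re, re_ofReal_mul, I_re, mul_zero, add_zero]
  ring_nf

theorem integral_exp_mul_cube_sub_vertical {b : ℝ} (hb : 0 < b) (hbt : b ^ 3 = 3 * t) (y : ℝ) :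
    ∫ w : ℝ, exp (t * (((b⁻¹ : ℝ) : ℂ) + w * I) ^ 3 - y * (((b⁻¹ : ℝ) : ℂ) + w * I))
      = b⁻¹ * ∫ w : ℝ, exp ((1 + w * I : ℂ) ^ 3 / 3 - ((y / b : ℝ) : ℂ) * (1 + w * I)) := by
  have hscale := Measure.integral_comp_mul_left (fun w : ℝ =>
    exp (t * (((b⁻¹ : ℝ) : ℂ) + w * I) ^ 3 - y * (((b⁻¹ : ℝ) : ℂ) + w * I))) b⁻¹
  have hexp : ∀ w : ℝ, exp (t * (((b⁻¹ : ℝ) : ℂ) + (b⁻¹ * w : ℝ) * I) ^ 3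
      - y * (((b⁻¹ : ℝ) : ℂ) + (b⁻¹ * w : ℝ) * I))
      = exp ((1 + w * I : ℂ) ^ 3 / 3 - ((y / b : ℝ) : ℂ) * (1 + w * I)) := by
    intro w
    have hbc : (b : ℂ) ≠ 0 := by exact_mod_cast hb.ne'
    have hbt' : (t : ℂ) * ((b : ℂ)⁻¹) ^ 3 = 1 / 3 := by
      have : (b : ℂ) ^ 3 = 3 * t := by exact_mod_cast hbt
      field_simp
      linear_combination -this
    congr 1
    push_cast
    rw [div_eq_mul_inv (y : ℂ)]
    linear_combination (1 + w * I : ℂ) ^ 3 * hbt'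
  rw [inv_inv, abs_of_pos hb, real_smul] at hscale
  simp_rw [hexp] at hscale
  rw [hscale, ← mul_assoc, ← ofReal_mul, inv_mul_cancel₀ hb.ne', ofReal_one, one_mul]

theorem kernel_one_third_eq_airyAi {b : ℝ} (hb : 0 < b) (hbt : b ^ 3 = 3 * t) (hy : 0 < y)
    (ht : 0 < t) : kernel (1 / 3) y t = y / (t * b) * airyAi (y / b) := by
  have hc : 0 < b⁻¹ := inv_pos.2 hb
  have h := kernel_one_div_nat_eq_integral (n := 3) (by norm_num) hy ht.ne'
    (lt_min (mul_pos ht hc) (half_pos hy)) (K := Real.exp t) (fun p q x hp hpq hx => ?_)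
    (integrable_exp_mul_cube_sub_vertical hc y ht)
  · rw [integral_exp_mul_cube_sub_vertical hb hbt] at h
    have hre := congrArg re h
    rw [ofReal_re, Nat.cast_ofNat] at hre
    rw [hre, airyAi, ← re_ofReal_mul]
    congr 1
    push_cast
    ring
  · rw [re_add_mul_I_pow_three] at hpq
    rw [norm_exp_mul_pow_sub, re_add_mul_I_pow_three, ← Real.exp_add, Real.exp_le_exp]
    simpa using exponent_one_third_le hc.le hy.le ht.le hp hpq hx

theorem kernel_one_third (hy : 0 < y) (ht : 0 < t) :
    kernel (1 / 3) y t
      = y / ((3 : ℝ) ^ (1 / 3 : ℝ) * t ^ (4 / 3 : ℝ))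
          * airyAi (y / ((3 : ℝ) ^ (1 / 3 : ℝ) * t ^ (1 / 3 : ℝ))) := by
  have hcube : ((3 : ℝ) ^ (1 / 3 : ℝ) * t ^ (1 / 3 : ℝ)) ^ 3 = 3 * t := by
    rw [mul_pow, ← Real.rpow_natCast, ← Real.rpow_natCast, ← Real.rpow_mul (by norm_num),
      ← Real.rpow_mul ht.le]
    norm_num
  have hpow : t ^ (4 / 3 : ℝ) = t * t ^ (1 / 3 : ℝ) := by
    rw [← Real.rpow_one_add' ht.le (by norm_num)]
    norm_num
  rw [kernel_one_third_eq_airyAi (by positivity) hcube hy ht, hpow, mul_left_comm]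

end KernelOneThird

section TestFunctions

variable {φ : ℝ × ℝ → ℝ}

/-- Test functions of `(x, t)`: the functions in `C_c^∞(ℝ²)`. -/
structure IsTestFunction (φ : ℝ × ℝ → ℝ) : Prop where
  contDiff : ContDiff ℝ ∞ φ
  hasCompactSupport : HasCompactSupport φ

theorem exists_forall_le_abs_eq_zero {E : Type*} [Zero E] {φ : ℝ × ℝ → E}
    (hs : HasCompactSupport φ) :
    ∃ T : ℝ, 0 < T ∧ (∀ p, T ≤ |p.1| → φ p = 0) ∧ ∀ p, T ≤ |p.2| → φ p = 0 := by
  obtain ⟨T, hT0, hT⟩ := hs.exists_pos_le_norm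
  exact ⟨T, hT0, fun p hp => hT p (hp.trans (norm_fst_le p)),
    fun p hp => hT p (hp.trans (norm_snd_le p))⟩

/-- The partial derivative `∂φ/∂t` of a function of `(x, t)`. -/
def timeDeriv (φ : ℝ × ℝ → ℝ) (p : ℝ × ℝ) : ℝ := fderiv ℝ φ p (0, 1)

/-- The partial derivative `∂φ/∂x` of a function of `(x, t)`. -/
def spaceDeriv (φ : ℝ × ℝ → ℝ) (p : ℝ × ℝ) : ℝ := fderiv ℝ φ p (1, 0)

theorem hasDerivAt_timeDeriv (hφ : Differentiable ℝ φ) (x t : ℝ) :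
    HasDerivAt (fun t => φ (x, t)) (timeDeriv φ (x, t)) t :=
  (hφ (x, t)).hasFDerivAt.comp_hasDerivAt t ((hasDerivAt_const t x).prodMk (hasDerivAt_id t))

theorem hasDerivAt_spaceDeriv (hφ : Differentiable ℝ φ) (x t : ℝ) :
    HasDerivAt (fun x => φ (x, t)) (spaceDeriv φ (x, t)) x :=
  (hφ (x, t)).hasFDerivAt.comp_hasDerivAt x ((hasDerivAt_id x).prodMk (hasDerivAt_const x t))

theorem timeDeriv_comp_add (φ : ℝ × ℝ → ℝ) (v p : ℝ × ℝ) :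
    timeDeriv (fun p => φ (p + v)) p = timeDeriv φ (p + v) := by
  simp only [timeDeriv, fderiv_comp_add_right]

theorem spaceDeriv_comp_add (φ : ℝ × ℝ → ℝ) (v p : ℝ × ℝ) :
    spaceDeriv (fun p => φ (p + v)) p = spaceDeriv φ (p + v) := by
  simp only [spaceDeriv, fderiv_comp_add_right]

namespace IsTestFunction

theorem differentiable (hφ : IsTestFunction φ) : Differentiable ℝ φ :=
  hφ.contDiff.differentiable (by simp)

theorem continuous (hφ : IsTestFunction φ) : Continuous φ := hφ.contDiff.continuous

theorem timeDeriv (hφ : IsTestFunction φ) : IsTestFunction (timeDeriv φ) :=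
  ⟨(hφ.contDiff.fderiv_right (by simp)).clm_apply contDiff_const,
    hφ.hasCompactSupport.fderiv_apply ℝ _⟩

theorem spaceDeriv (hφ : IsTestFunction φ) : IsTestFunction (spaceDeriv φ) :=
  ⟨(hφ.contDiff.fderiv_right (by simp)).clm_apply contDiff_const,
    hφ.hasCompactSupport.fderiv_apply ℝ _⟩

theorem comp_add (hφ : IsTestFunction φ) (v : ℝ × ℝ) : IsTestFunction fun p => φ (p + v) :=
  ⟨hφ.contDiff.comp (contDiff_id.add contDiff_const),
    hφ.hasCompactSupport.comp_homeomorph (Homeomorph.addRight v)⟩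

end IsTestFunction

end TestFunctions

section FracIntegral

variable {α : ℝ}

theorem integrable_indicator_rpow_neg (h1 : α < 1) :
    Integrable ((Ioc (0 : ℝ) 1).indicator fun r : ℝ => r ^ (-α)) := by
  rw [integrable_indicator_iff measurableSet_Ioc,
    ← intervalIntegrable_iff_integrableOn_Ioc_of_le zero_le_one]
  exact intervalIntegral.intervalIntegrable_rpow' (by linarith)

theorem integral_indicator_rpow_neg (h1 : α < 1) :
    ∫ r, (Ioc (0 : ℝ) 1).indicator (fun r : ℝ => r ^ (-α)) r = (1 - α)⁻¹ := by
  rw [integral_indicator measurableSet_Ioc, ← intervalIntegral.integral_of_le zero_le_one,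
    integral_rpow (Or.inl (by linarith)), Real.one_rpow, Real.zero_rpow (by linarith), sub_zero,
    one_div, neg_add_eq_sub]

variable {f : ℝ → ℝ} {N u v : ℝ}

theorem rpow_neg_mul_le_indicator (h0 : 0 ≤ α) (hf : ∀ r, |f r| ≤ N)
    (hsupp : ∀ r, f r ≠ 0 → r ∈ Icc u v) {r : ℝ} (hr : 0 < r) :
    |r ^ (-α) * f r| ≤ N * ((Ioc (0 : ℝ) 1).indicator (fun r => r ^ (-α)) r +
      (Icc u v).indicator (fun _ => 1) r) := by
  have hr0 : 0 ≤ r ^ (-α) := Real.rpow_nonneg hr.le _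
  have hN0 : 0 ≤ N := (abs_nonneg _).trans (hf 0)
  have hnear : 0 ≤ (Ioc (0 : ℝ) 1).indicator (fun r : ℝ => r ^ (-α)) r :=
    indicator_nonneg (fun x hx => Real.rpow_nonneg hx.1.le _) _
  by_cases hz : f r = 0
  · have : 0 ≤ (Icc u v).indicator (fun _ => (1 : ℝ)) r :=
      indicator_nonneg (fun _ _ => zero_le_one) _
    rw [hz, mul_zero, abs_zero]
    positivity
  rw [abs_mul, mul_comm, abs_of_nonneg hr0, indicator_of_mem (hsupp r hz)]
  refine mul_le_mul (hf _) ?_ hr0 hN0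
  rcases le_or_gt r 1 with h | h
  · rw [indicator_of_mem (mem_Ioc.2 ⟨hr, h⟩)]
    linarith
  · linarith [Real.rpow_le_one_of_one_le_of_nonpos h.le (neg_nonpos.2 h0)]

theorem integrable_rpow_neg_indicator_add (h1 : α < 1) (N u v : ℝ) :
    Integrable fun r => N * ((Ioc (0 : ℝ) 1).indicator (fun r => r ^ (-α)) r +
      (Icc u v).indicator (fun _ => 1) r) := by
  refine ((integrable_indicator_rpow_neg h1).add ?_).const_mul N
  rw [integrable_indicator_iff measurableSet_Icc]
  simp

theorem integrableOn_rpow_neg_mul (h0 : 0 ≤ α) (h1 : α < 1) (hm : Measurable f)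
    (hf : ∀ r, |f r| ≤ N) (hsupp : ∀ r, f r ≠ 0 → r ∈ Icc u v) :
    IntegrableOn (fun r => r ^ (-α) * f r) (Ioi 0) :=
  (integrable_rpow_neg_indicator_add h1 N u v).integrableOn.mono'
    (Measurable.aestronglyMeasurable (by fun_prop)) ((ae_restrict_iff' measurableSet_Ioi).2
      (ae_of_all _ fun _ => rpow_neg_mul_le_indicator h0 hf hsupp))

theorem integral_abs_rpow_neg_mul_le (h0 : 0 ≤ α) (h1 : α < 1) (hm : Measurable f)
    (hf : ∀ r, |f r| ≤ N) (huv : u ≤ v) (hsupp : ∀ r, f r ≠ 0 → r ∈ Icc u v) :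
    ∫ r in Ioi (0 : ℝ), |r ^ (-α) * f r| ≤ N * ((1 - α)⁻¹ + (v - u)) := by
  have hmaj := integrable_rpow_neg_indicator_add h1 N u v
  have hN0 : 0 ≤ N := (abs_nonneg _).trans (hf 0)
  calc ∫ r in Ioi (0 : ℝ), |r ^ (-α) * f r|
      ≤ ∫ r in Ioi (0 : ℝ), N * ((Ioc (0 : ℝ) 1).indicator (fun r => r ^ (-α)) r +
          (Icc u v).indicator (fun _ => 1) r) :=
        setIntegral_mono_on (integrableOn_rpow_neg_mul h0 h1 hm hf hsupp).abs hmaj.integrableOn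
          measurableSet_Ioi fun _ => rpow_neg_mul_le_indicator h0 hf hsupp
    _ ≤ ∫ r, N * ((Ioc (0 : ℝ) 1).indicator (fun r => r ^ (-α)) r +
          (Icc u v).indicator (fun _ => 1) r) :=
        setIntegral_le_integral hmaj (ae_of_all _ fun r => mul_nonneg hN0 (add_nonneg
          (indicator_nonneg (fun x hx => Real.rpow_nonneg hx.1.le _) _)
          (indicator_nonneg (fun _ _ => zero_le_one) _)))
    _ = N * ((1 - α)⁻¹ + (v - u)) := by
        rw [integral_const_mul, integral_add (integrable_indicator_rpow_neg h1)
          (by rw [integrable_indicator_iff measurableSet_Icc]; simp),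
          integral_indicator_rpow_neg h1, integral_indicator_const _ measurableSet_Icc,
          smul_eq_mul, mul_one, Real.volume_real_Icc_of_le huv]

/-- The fractional integral in time `∫_0^∞ r^(-α) q(x, t + r) dr`, up to the factor `Γ(1-α)` the
one of order `1 - α`. -/
def fracIntegral (α : ℝ) (q : ℝ × ℝ → ℝ) (p : ℝ × ℝ) : ℝ :=
  ∫ r in Ioi (0 : ℝ), r ^ (-α) * q (p + (0, r))

variable {q : ℝ × ℝ → ℝ}

theorem exists_integral_abs_rpow_neg_mul_le (h0 : 0 ≤ α) (h1 : α < 1) (hq : Continuous q)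
    (hs : HasCompactSupport q) :
    ∃ m : ℝ, (∀ p, IntegrableOn (fun r : ℝ => r ^ (-α) * q (p + (0, r))) (Ioi 0)) ∧
      ∀ p, ∫ r in Ioi (0 : ℝ), |r ^ (-α) * q (p + (0, r))| ≤ m := by
  obtain ⟨N, hN⟩ := hs.exists_bound_of_continuous hq
  obtain ⟨T, hT0, -, hT⟩ := exists_forall_le_abs_eq_zero hs
  have hsupp : ∀ p r, q (p + (0, r)) ≠ 0 → r ∈ Icc (-T - p.2) (T - p.2) := fun p r hr => by
    have h := not_le.1 (mt (hT _) hr)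
    rw [Prod.snd_add, abs_lt] at h
    exact ⟨by linarith, by linarith⟩
  have hm : ∀ p : ℝ × ℝ, Measurable fun r => q (p + (0, r)) := fun p =>
    Continuous.measurable (by fun_prop)
  refine ⟨N * ((1 - α)⁻¹ + 2 * T),
    fun p => integrableOn_rpow_neg_mul h0 h1 (hm p) (fun _ => hN _) (hsupp p), fun p => ?_⟩
  convert integral_abs_rpow_neg_mul_le h0 h1 (hm p) (fun _ => hN _) (by linarith) (hsupp p)
    using 3
  ring

theorem exists_abs_fracIntegral_le (h0 : 0 ≤ α) (h1 : α < 1) (hq : Continuous q)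
    (hs : HasCompactSupport q) : ∃ m, ∀ p, |fracIntegral α q p| ≤ m := by
  obtain ⟨m, -, hm⟩ := exists_integral_abs_rpow_neg_mul_le h0 h1 hq hs
  exact ⟨m, fun p => abs_integral_le_integral_abs.trans (hm p)⟩

theorem measurable_fracIntegral (α : ℝ) (hq : Continuous q) : Measurable (fracIntegral α q) := by
  have h : Measurable fun z : (ℝ × ℝ) × ℝ => z.2 ^ (-α) * q (z.1 + (0, z.2)) := by
    have := hq.measurable
    fun_prop
  exact (h.stronglyMeasurable.integral_prod_right (ν := volume.restrict (Ioi 0))).measurable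

theorem fracIntegral_eq_zero {T : ℝ} (hT : ∀ p, T ≤ |p.2| → q p = 0) {p : ℝ × ℝ} (hp : T ≤ p.2) :
    fracIntegral α q p = 0 := by
  refine setIntegral_eq_zero_of_forall_eq_zero fun r hr => ?_
  have hr0 : 0 < r := hr
  rw [hT _ (le_abs.2 (Or.inl (by rw [Prod.snd_add]; linarith))), mul_zero]

end FracIntegral

section AdjointOp

variable {α a ε : ℝ} {φ ψ : ℝ × ℝ → ℝ}

/-- The formal adjoint `-∂_t - a ∂_x + ε D^α_-` of the fractional advection operator. -/
def adjointOp (α a ε : ℝ) (φ : ℝ × ℝ → ℝ) (p : ℝ × ℝ) : ℝ :=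
  -(deriv (fun t => φ (p.1, t)) p.2) - a * deriv (fun x => φ (x, p.2)) p.1
    + ε * caputoAdjoint α (fun t => φ (p.1, t)) p.2

theorem adjointOp_eq (α a ε : ℝ) (hφ : Differentiable ℝ φ) (p : ℝ × ℝ) :
    adjointOp α a ε φ p = -timeDeriv φ p - a * spaceDeriv φ p
      - ε / Real.Gamma (1 - α) * fracIntegral α (timeDeriv φ) p := by
  obtain ⟨x, t⟩ := p
  have htime : ∀ t, deriv (fun t => φ (x, t)) t = timeDeriv φ (x, t) :=
    fun t => (hasDerivAt_timeDeriv hφ x t).deriv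
  have hshift := integral_Ioi_shift (fun s => (s - t) ^ (-α) * timeDeriv φ (x, s)) 0 t
  simp only [add_sub_cancel_right, zero_add] at hshift
  simp only [adjointOp, caputoAdjoint, fracIntegral, htime,
    (hasDerivAt_spaceDeriv hφ x t).deriv, ← hshift, Prod.mk_add_mk, add_zero, add_comm t]
  ring

theorem adjointOp_comp_add (α a ε : ℝ) (hφ : Differentiable ℝ φ) (v p : ℝ × ℝ) :
    adjointOp α a ε (fun p => φ (p + v)) p = adjointOp α a ε φ (p + v) := by
  have hφ' : Differentiable ℝ fun p => φ (p + v) := hφ.comp (differentiable_id.add_const v)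
  rw [adjointOp_eq _ _ _ hφ, adjointOp_eq _ _ _ hφ', timeDeriv_comp_add, spaceDeriv_comp_add,
    fracIntegral, fracIntegral]
  simp_rw [timeDeriv_comp_add, add_right_comm]

theorem adjointOp_congr (α a ε : ℝ) {τ : ℝ} (h : ∀ p : ℝ × ℝ, τ < p.2 → φ p = ψ p) {p : ℝ × ℝ}
    (hp : τ < p.2) : adjointOp α a ε φ p = adjointOp α a ε ψ p := by
  have htime : ∀ t, τ < t → deriv (fun t => φ (p.1, t)) t = deriv (fun t => ψ (p.1, t)) t := by
    intro t ht
    refine Filter.EventuallyEq.deriv_eq ?_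
    filter_upwards [lt_mem_nhds ht] with s hs using h (p.1, s) hs
  have hspace : (fun x => φ (x, p.2)) = fun x => ψ (x, p.2) := funext fun x => h (x, p.2) hp
  simp only [adjointOp, caputoAdjoint]
  rw [htime _ hp, hspace]
  congr 4
  refine setIntegral_congr_fun measurableSet_Ioi fun s hs => ?_
  simp only [htime s (hp.trans hs)]

theorem adjointOp_eq_zero (α a ε : ℝ) {T : ℝ} (hT : ∀ p : ℝ × ℝ, T ≤ |p.2| → φ p = 0)
    {p : ℝ × ℝ} (hp : T < p.2) : adjointOp α a ε φ p = 0 := by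
  rw [adjointOp_congr α a ε (ψ := 0) (fun q hq => hT q (le_abs.2 (Or.inl hq.le))) hp]
  simp [adjointOp, caputoAdjoint]

theorem IsTestFunction.measurable_adjointOp (hφ : IsTestFunction φ) (α a ε : ℝ) :
    Measurable (adjointOp α a ε φ) := by
  rw [funext (adjointOp_eq α a ε hφ.differentiable)]
  have htime := hφ.timeDeriv.continuous.measurable
  have hspace := hφ.spaceDeriv.continuous.measurable
  have hfrac := measurable_fracIntegral α hφ.timeDeriv.continuous
  fun_prop

theorem IsTestFunction.exists_abs_adjointOp_le (hφ : IsTestFunction φ) (h0 : 0 ≤ α) (h1 : α < 1)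
    (a ε : ℝ) : ∃ m, ∀ p, |adjointOp α a ε φ p| ≤ m := by
  obtain ⟨m₁, hm₁⟩ := hφ.timeDeriv.hasCompactSupport.exists_bound_of_continuous
    hφ.timeDeriv.continuous
  obtain ⟨m₂, hm₂⟩ := hφ.spaceDeriv.hasCompactSupport.exists_bound_of_continuous
    hφ.spaceDeriv.continuous
  obtain ⟨m₃, hm₃⟩ := exists_abs_fracIntegral_le h0 h1 hφ.timeDeriv.continuous
    hφ.timeDeriv.hasCompactSupport
  refine ⟨m₁ + |a| * m₂ + |ε / Real.Gamma (1 - α)| * m₃, fun p => ?_⟩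
  rw [adjointOp_eq _ _ _ hφ.differentiable]
  refine (abs_sub _ _).trans (add_le_add ((abs_sub _ _).trans (add_le_add ?_ ?_)) ?_)
  · rw [abs_neg]
    exact hm₁ p
  · rw [abs_mul]
    exact mul_le_mul_of_nonneg_left (hm₂ p) (abs_nonneg a)
  · rw [abs_mul]
    exact mul_le_mul_of_nonneg_left (hm₃ p) (abs_nonneg _)

end AdjointOp

section GammaIntegral

variable {a s : ℂ}

theorem norm_cpow_mul_cexp {r : ℝ} (hr : 0 < r) (a s : ℂ) :
    ‖(r : ℂ) ^ a * exp (-(s * r))‖ = r ^ a.re * Real.exp (-s.re * r) := by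
  rw [norm_mul, norm_cpow_eq_rpow_re_of_pos hr, norm_exp, neg_re, re_mul_ofReal, neg_mul]

theorem integrableOn_rpow_mul_exp {β b : ℝ} (hβ : -1 < β) (hb : 0 < b) :
    IntegrableOn (fun r : ℝ => r ^ β * Real.exp (-b * r)) (Ioi 0) := by
  simpa using integrableOn_rpow_mul_exp_neg_mul_rpow hβ one_pos hb

theorem integrableOn_cpow_mul_cexp (ha : -1 < a.re) (hs : 0 < s.re) :
    IntegrableOn (fun r : ℝ => (r : ℂ) ^ a * exp (-(s * r))) (Ioi 0) :=
  (integrableOn_rpow_mul_exp ha hs).mono' (Measurable.aestronglyMeasurable (by fun_prop))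
    ((ae_restrict_iff' measurableSet_Ioi).2
      (ae_of_all _ fun _ hr => (norm_cpow_mul_cexp hr a s).le))

theorem differentiableOn_integral_cpow_mul_cexp (ha : 0 < a.re) :
    DifferentiableOn ℂ (fun s : ℂ => ∫ r in Ioi (0 : ℝ), (r : ℂ) ^ (a - 1) * exp (-(s * r)))
      {s | 0 < s.re} := by
  intro s hs
  have hs0 : 0 < s.re := hs
  have hnear : ∀ᶠ w in 𝓝 s, s.re / 2 < w.re :=
    continuous_re.continuousAt.eventually (lt_mem_nhds (half_lt_self hs0))
  have hre : -1 < (a - 1).re := by simpa using ha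
  refine (hasDerivAt_integral_of_dominated_loc_of_deriv_le (μ := volume.restrict (Ioi (0 : ℝ)))
    (F := fun w r => (r : ℂ) ^ (a - 1) * exp (-(w * r)))
    (F' := fun w r => -((r : ℂ) ^ a * exp (-(w * r))))
    (bound := fun r : ℝ => r ^ a.re * Real.exp (-(s.re / 2) * r)) hnear
    (Eventually.of_forall fun w => Measurable.aestronglyMeasurable (by fun_prop))
    (integrableOn_cpow_mul_cexp hre hs0) (Measurable.aestronglyMeasurable (by fun_prop)) ?_
    (integrableOn_rpow_mul_exp (by linarith) (half_pos hs0))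
    ?_).2.differentiableAt.differentiableWithinAt
  all_goals refine (ae_restrict_iff' measurableSet_Ioi).2 (ae_of_all _ fun r hr w hw => ?_)
  all_goals have hr0 : 0 < r := hr
  · rw [norm_neg, norm_cpow_mul_cexp hr0]
    have : s.re / 2 ≤ w.re := le_of_lt hw
    gcongr
  · have hlin : HasDerivAt (fun w : ℂ => -(w * r)) (-r : ℂ) w := by
      simpa using ((hasDerivAt_id w).mul_const (r : ℂ)).fun_neg
    refine (hlin.cexp.const_mul _).congr_deriv ?_
    rw [cpow_sub _ _ (ofReal_ne_zero.2 hr0.ne'), cpow_one]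
    field_simp [ofReal_ne_zero.2 hr0.ne']

/-- Both sides are holomorphic in `s` on the half plane, and they agree for real `s`. -/
theorem integral_cpow_mul_cexp (ha : 0 < a.re) (hs : 0 < s.re) :
    ∫ r in Ioi (0 : ℝ), (r : ℂ) ^ (a - 1) * exp (-(s * r)) = Complex.Gamma a * s ^ (-a) := by
  have hopen : IsOpen {s : ℂ | 0 < s.re} := isOpen_lt continuous_const continuous_re
  have hdiff : DifferentiableOn ℂ (fun s : ℂ => Complex.Gamma a * s ^ (-a)) {s | 0 < s.re} :=
    fun z hz => ((differentiableAt_id.cpow_const (Or.inl hz)).const_mul _).differentiableWithinAt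
  have hreal : ∀ x : ℝ, 0 < x → ∫ r in Ioi (0 : ℝ), (r : ℂ) ^ (a - 1) * exp (-(x * r))
      = Complex.Gamma a * (x : ℂ) ^ (-a) := fun x hx => by
    rw [integral_cpow_mul_exp_neg_mul_Ioi ha hx, one_div, mul_comm, cpow_neg,
      inv_cpow _ _ (by simp [arg_ofReal_of_nonneg hx.le, Real.pi_pos.ne])]
  have hofReal : Tendsto (fun x : ℝ => (x : ℂ)) (𝓝[≠] 1) (𝓝[≠] (1 : ℂ)) :=
    tendsto_nhdsWithin_iff.2 ⟨(continuous_ofReal.tendsto' 1 1 (by simp)).mono_left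
      nhdsWithin_le_nhds, by filter_upwards [self_mem_nhdsWithin] with x hx using by simpa using hx⟩
  have hpos : ∀ᶠ x : ℝ in 𝓝[≠] 1, 0 < x := nhdsWithin_le_nhds (lt_mem_nhds zero_lt_one)
  exact ((differentiableOn_integral_cpow_mul_cexp ha).analyticOnNhd
    hopen).eqOn_of_preconnected_of_frequently_eq (hdiff.analyticOnNhd hopen)
    (convex_halfSpace_re_gt 0).isPreconnected (z₀ := 1) (by simp)
    (hofReal.frequently (hpos.mono hreal).frequently) hs

theorem ofReal_rpow_mul_cexp {r : ℝ} (hr : 0 ≤ r) (β : ℝ) (s : ℂ) :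
    ((r ^ β : ℝ) : ℂ) * exp (-(s * r)) = (r : ℂ) ^ (β : ℂ) * exp (-(s * r)) := by
  rw [ofReal_cpow hr]

variable {α : ℝ}

theorem integrableOn_rpow_neg_mul_cexp (h1 : α < 1) (hs : 0 < s.re) :
    IntegrableOn (fun r : ℝ => ((r ^ (-α) : ℝ) : ℂ) * exp (-(s * r))) (Ioi 0) :=
  (integrableOn_cpow_mul_cexp (a := (-α : ℝ)) (by rw [ofReal_re]; linarith) hs).congr_fun
    (fun _ hr => (ofReal_rpow_mul_cexp (le_of_lt hr) _ s).symm) measurableSet_Ioi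

theorem integral_rpow_neg_mul_cexp (h1 : α < 1) (hs : 0 < s.re) :
    ∫ r in Ioi (0 : ℝ), ((r ^ (-α) : ℝ) : ℂ) * exp (-(s * r))
      = Real.Gamma (1 - α) * s ^ ((α : ℂ) - 1) := by
  have h := integral_cpow_mul_cexp (a := ((1 - α : ℝ) : ℂ)) (by rw [ofReal_re]; linarith) hs
  rw [Complex.Gamma_ofReal, ← ofReal_neg, neg_sub, ofReal_sub α, ofReal_one] at h
  rw [← h]
  refine setIntegral_congr_fun measurableSet_Ioi fun r hr => ?_
  have hexp : ((1 - α : ℝ) : ℂ) - 1 = (-α : ℝ) := by push_cast; ring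
  simp only [hexp, ofReal_rpow_mul_cexp (le_of_lt hr)]

end GammaIntegral

section TimeLaplace

/-- The bilateral Laplace transform in time `∫ exp (s τ) q(x, τ) dτ`. -/
def timeLaplace (q : ℝ × ℝ → ℝ) (x : ℝ) (s : ℂ) : ℂ := ∫ τ : ℝ, exp (s * τ) * (q (x, τ) : ℂ)

theorem integrable_indicator_exp (σ T N : ℝ) :
    Integrable ((Icc (-T) T).indicator fun τ => Real.exp (σ * τ) * N) := by
  rw [integrable_indicator_iff measurableSet_Icc]
  exact Continuous.integrableOn_Icc (by fun_prop)

theorem norm_exp_mul_le_indicator {f : ℝ → ℝ} {N T : ℝ} (hN : ∀ τ, |f τ| ≤ N)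
    (hT : ∀ τ, T ≤ |τ| → f τ = 0) (s : ℂ) (τ : ℝ) :
    ‖exp (s * τ) * (f τ : ℂ)‖ ≤ (Icc (-T) T).indicator (fun τ => Real.exp (s.re * τ) * N) τ := by
  have hN0 : 0 ≤ N := (abs_nonneg _).trans (hN 0)
  by_cases hf : f τ = 0
  · simp only [hf, ofReal_zero, mul_zero, norm_zero]
    exact indicator_nonneg (fun _ _ => by positivity) _
  · have hτ : τ ∈ Icc (-T) T := abs_le.1 (not_le.1 (mt (hT τ) hf)).le
    rw [indicator_of_mem hτ, norm_mul, norm_exp, norm_real, re_mul_ofReal]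
    exact mul_le_mul_of_nonneg_left (hN τ) (Real.exp_pos _).le

variable {q : ℝ × ℝ → ℝ}

theorem exists_norm_exp_mul_slice_le (hq : Continuous q) (hs : HasCompactSupport q) :
    ∃ N T : ℝ, ∀ (x : ℝ) (s : ℂ) (τ : ℝ), ‖exp (s * τ) * (q (x, τ) : ℂ)‖
      ≤ (Icc (-T) T).indicator (fun τ => Real.exp (s.re * τ) * N) τ := by
  obtain ⟨N, hN⟩ := hs.exists_bound_of_continuous hq
  obtain ⟨T, -, -, hT⟩ := exists_forall_le_abs_eq_zero hs
  exact ⟨N, T, fun x => norm_exp_mul_le_indicator (fun τ => hN (x, τ)) fun τ => hT (x, τ)⟩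

theorem integrable_exp_mul_slice (hq : Continuous q) (hs : HasCompactSupport q) (x : ℝ) (s : ℂ) :
    Integrable fun τ : ℝ => exp (s * τ) * (q (x, τ) : ℂ) := by
  obtain ⟨N, T, hle⟩ := exists_norm_exp_mul_slice_le hq hs
  exact (integrable_indicator_exp s.re T N).mono'
    (Continuous.aestronglyMeasurable (by fun_prop)) (ae_of_all _ (hle x s))

theorem timeLaplace_timeDeriv (hq : IsTestFunction q) (x : ℝ) (s : ℂ) :
    timeLaplace (timeDeriv q) x s = -s * timeLaplace q x s := by
  have hi := integrable_exp_mul_slice hq.continuous hq.hasCompactSupport x s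
  have hi' := integrable_exp_mul_slice hq.timeDeriv.continuous hq.timeDeriv.hasCompactSupport x s
  have hderiv : ∀ τ : ℝ, HasDerivAt (fun τ : ℝ => exp (s * τ) * (q (x, τ) : ℂ))
      (s * (exp (s * τ) * (q (x, τ) : ℂ)) + exp (s * τ) * (timeDeriv q (x, τ) : ℂ)) τ := by
    intro τ
    have hlin : HasDerivAt (fun τ : ℝ => s * (τ : ℂ)) s τ := by
      simpa using (ofRealCLM.hasDerivAt (x := τ)).const_mul s
    exact (hlin.cexp.mul (hasDerivAt_timeDeriv hq.differentiable x τ).ofReal_comp).congr_deriv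
      (by ring)
  have h := integral_eq_zero_of_hasDerivAt_of_integrable hderiv ((hi.const_mul s).add hi') hi
  rw [integral_add (hi.const_mul s) hi', integral_const_mul] at h
  rw [timeLaplace, timeLaplace]
  linear_combination h

theorem hasDerivAt_timeLaplace (hq : IsTestFunction q) (s : ℂ) (x : ℝ) :
    HasDerivAt (fun x => timeLaplace q x s) (timeLaplace (spaceDeriv q) x s) x := by
  obtain ⟨N, T, hle⟩ := exists_norm_exp_mul_slice_le hq.spaceDeriv.continuous
    hq.spaceDeriv.hasCompactSupport
  have hi := integrable_exp_mul_slice hq.continuous hq.hasCompactSupport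
  have hi' := integrable_exp_mul_slice hq.spaceDeriv.continuous hq.spaceDeriv.hasCompactSupport
  exact (hasDerivAt_integral_of_dominated_loc_of_deriv_le
    (F := fun x (τ : ℝ) => exp (s * τ) * (q (x, τ) : ℂ))
    (F' := fun x (τ : ℝ) => exp (s * τ) * (spaceDeriv q (x, τ) : ℂ)) univ_mem
    (Eventually.of_forall fun x => (hi x s).1) (hi x s) (hi' x s).1
    (ae_of_all _ fun τ x _ => hle x s τ) (integrable_indicator_exp s.re T N)
    (ae_of_all _ fun τ x _ =>
      (hasDerivAt_spaceDeriv hq.differentiable x τ).ofReal_comp.const_mul _)).2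

theorem timeLaplace_eq_zero {x : ℝ} (h : ∀ τ, q (x, τ) = 0) (s : ℂ) : timeLaplace q x s = 0 := by
  simp [timeLaplace, h]

theorem exists_norm_pow_mul_norm_timeLaplace_le (hq : IsTestFunction q) (σ : ℝ) (n : ℕ) :
    ∃ C, ∀ (x : ℝ) (s : ℂ), s.re = σ → ‖s‖ ^ n * ‖timeLaplace q x s‖ ≤ C := by
  induction n generalizing q with
  | zero =>
    obtain ⟨N, T, hle⟩ := exists_norm_exp_mul_slice_le hq.continuous hq.hasCompactSupport
    refine ⟨∫ τ, (Icc (-T) T).indicator (fun τ => Real.exp (σ * τ) * N) τ, fun x s hs => ?_⟩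
    rw [pow_zero, one_mul, ← hs]
    exact norm_integral_le_of_norm_le (integrable_indicator_exp s.re T N)
      (ae_of_all _ (hle x s))
  | succ n ih =>
    obtain ⟨C, hC⟩ := ih hq.timeDeriv
    refine ⟨C, fun x s hs => ?_⟩
    have h := hC x s hs
    rwa [timeLaplace_timeDeriv hq, norm_mul, norm_neg, ← mul_assoc, ← pow_succ] at h

theorem norm_one_add_mul_I_sq (w : ℝ) : ‖(1 + w * I : ℂ)‖ ^ 2 = 1 + w ^ 2 := by
  rw [← normSq_eq_norm_sq, normSq_apply]
  simp
  ring

theorem exists_norm_pow_mul_norm_timeLaplace_vertical_le (hq : IsTestFunction q) (n : ℕ) :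
    ∃ C, ∀ x w : ℝ,
      ‖(1 + w * I : ℂ)‖ ^ n * ‖timeLaplace q x (1 + w * I)‖ ≤ C * (1 + w ^ 2)⁻¹ := by
  obtain ⟨C, hC⟩ := exists_norm_pow_mul_norm_timeLaplace_le hq 1 (n + 2)
  refine ⟨C, fun x w => ?_⟩
  rw [← div_eq_mul_inv, le_div_iff₀ (by positivity), ← norm_one_add_mul_I_sq, mul_right_comm,
    ← pow_add]
  exact hC x _ (by simp)

theorem measurable_timeLaplace (hq : Continuous q) :
    Measurable fun z : ℝ × ℝ => timeLaplace q z.1 (1 + z.2 * I) := by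
  have h : Measurable fun z : (ℝ × ℝ) × ℝ =>
      exp ((1 + z.1.2 * I) * z.2) * (q (z.1.1, z.2) : ℂ) := by
    have := hq.measurable
    fun_prop
  exact h.stronglyMeasurable.integral_prod_right.measurable

theorem integrable_timeLaplace_vertical (hq : IsTestFunction q) (x : ℝ) :
    Integrable fun w : ℝ => timeLaplace q x (1 + w * I) := by
  obtain ⟨C, hC⟩ := exists_norm_pow_mul_norm_timeLaplace_vertical_le hq 0
  exact (integrable_inv_one_add_sq.const_mul C).mono'
    ((measurable_timeLaplace hq.continuous).comp measurable_prodMk_left).aestronglyMeasurable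
    (ae_of_all _ fun w => by simpa using hC x w)

theorem integral_timeLaplace_vertical (hq : IsTestFunction q) (x : ℝ) :
    (1 / (2 * Real.pi) : ℝ) * ∫ w : ℝ, timeLaplace q x (1 + w * I) = q (x, 0) := by
  have hqc := hq.continuous
  have h := eq_integral_exp_mul_of_integrable (f := fun τ : ℝ => exp (1 * τ) * (q (x, τ) : ℂ))
    (by fun_prop) (integrable_exp_mul_slice hqc hq.hasCompactSupport x 1)
    (integrable_timeLaplace_vertical hq x) (fun w => ?_) 0
  · simpa using h.symm
  · refine integral_congr_ae (ae_of_all _ fun τ => ?_)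
    simp only
    rw [← mul_assoc, ← exp_add]
    ring_nf

end TimeLaplace

section LaplaceFracIntegral

variable {α : ℝ} {q : ℝ × ℝ → ℝ} {s : ℂ}

theorem exp_mul_rpow_mul_slice (α : ℝ) (q : ℝ × ℝ → ℝ) (s : ℂ) (x τ r : ℝ) :
    exp (s * τ) * (((r ^ (-α) : ℝ) : ℂ) * (q (x, τ + r) : ℂ))
      = ((r ^ (-α) : ℝ) : ℂ) * exp (-(s * r)) *
        (exp (s * (τ + r : ℝ)) * (q (x, τ + r) : ℂ)) := by
  have : exp (s * τ) = exp (-(s * r)) * exp (s * (τ + r : ℝ)) := by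
    rw [← exp_add]
    push_cast
    ring_nf
  rw [this]
  ring

theorem integrable_exp_mul_rpow_mul_slice (h1 : α < 1) (hq : Continuous q)
    (hs : HasCompactSupport q) (x : ℝ) (hre : 0 < s.re) :
    Integrable (Function.uncurry fun τ r : ℝ =>
      exp (s * τ) * (((r ^ (-α) : ℝ) : ℂ) * (q (x, τ + r) : ℂ)))
      (volume.prod (volume.restrict (Ioi 0))) := by
  have hm : Measurable (Function.uncurry fun τ r : ℝ =>
      exp (s * τ) * (((r ^ (-α) : ℝ) : ℂ) * (q (x, τ + r) : ℂ))) := by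
    have := hq.measurable
    simp only [Function.uncurry_def]
    fun_prop
  have hshift : ∀ r : ℝ, ∫ τ : ℝ, ‖exp (s * (τ + r : ℝ)) * (q (x, τ + r) : ℂ)‖
      = ∫ τ : ℝ, ‖exp (s * τ) * (q (x, τ) : ℂ)‖ := fun r =>
    integral_add_right_eq_self (fun τ : ℝ => ‖exp (s * τ) * (q (x, τ) : ℂ)‖) r
  rw [integrable_prod_iff' hm.aestronglyMeasurable]
  simp only [Function.uncurry_apply_pair, exp_mul_rpow_mul_slice, norm_mul (_ * _) (_ * _),
    integral_const_mul, hshift]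
  exact ⟨ae_of_all _ fun r =>
      ((integrable_exp_mul_slice hq hs x s).comp_add_right r).const_mul _,
    (integrableOn_rpow_neg_mul_cexp h1 hre).norm.mul_const _⟩

theorem integral_exp_mul_fracIntegral (h1 : α < 1) (hq : Continuous q) (hs : HasCompactSupport q)
    (x : ℝ) (hre : 0 < s.re) :
    ∫ τ : ℝ, exp (s * τ) * (fracIntegral α q (x, τ) : ℂ)
      = Real.Gamma (1 - α) * s ^ ((α : ℂ) - 1) * timeLaplace q x s := by
  calc ∫ τ : ℝ, exp (s * τ) * (fracIntegral α q (x, τ) : ℂ)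
      = ∫ τ : ℝ, ∫ r in Ioi (0 : ℝ),
          exp (s * τ) * (((r ^ (-α) : ℝ) : ℂ) * (q (x, τ + r) : ℂ)) := by
        refine integral_congr_ae (ae_of_all _ fun τ => ?_)
        simp only [fracIntegral]
        rw [← integral_complex_ofReal, ← integral_const_mul]
        simp
    _ = ∫ r in Ioi (0 : ℝ), ∫ τ : ℝ,
          exp (s * τ) * (((r ^ (-α) : ℝ) : ℂ) * (q (x, τ + r) : ℂ)) :=
        integral_integral_swap (integrable_exp_mul_rpow_mul_slice h1 hq hs x hre)
    _ = ∫ r in Ioi (0 : ℝ), ((r ^ (-α) : ℝ) : ℂ) * exp (-(s * r)) * timeLaplace q x s := by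
        refine integral_congr_ae (ae_of_all _ fun r => ?_)
        simp only [exp_mul_rpow_mul_slice]
        rw [integral_const_mul]
        congr 1
        exact integral_add_right_eq_self (fun τ : ℝ => exp (s * τ) * (q (x, τ) : ℂ)) r
    _ = Real.Gamma (1 - α) * s ^ ((α : ℂ) - 1) * timeLaplace q x s := by
        rw [integral_mul_const, integral_rpow_neg_mul_cexp h1 hre]

end LaplaceFracIntegral

section Shear

variable {a : ℝ} {φ : ℝ × ℝ → ℝ}

/-- The map from characteristic coordinates `(x, τ)`, `τ = t - x / a`, to `(x, t)`. -/
def shear (a : ℝ) (p : ℝ × ℝ) : ℝ × ℝ := (p.1, p.1 / a + p.2)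

theorem contDiff_shear (a : ℝ) : ContDiff ℝ ∞ (shear a) := by
  unfold shear
  fun_prop

/-- `shear a` as a homeomorphism of the plane. -/
def shearHomeomorph (a : ℝ) : ℝ × ℝ ≃ₜ ℝ × ℝ where
  toFun := shear a
  invFun p := (p.1, p.2 - p.1 / a)
  left_inv p := by simp [shear]
  right_inv p := by simp [shear]
  continuous_toFun := (contDiff_shear a).continuous
  continuous_invFun := by fun_prop

theorem measurePreserving_shear (a : ℝ) : MeasurePreserving (shear a) := by
  refine (MeasurePreserving.id (volume : Measure ℝ)).skew_product
    (g := fun x τ => x / a + τ) ?_ (ae_of_all _ fun x => ?_)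
  · simp only [Function.uncurry_def]
    fun_prop
  · exact (measurePreserving_add_left volume (x / a)).map_eq

theorem measurableEmbedding_shear (a : ℝ) : MeasurableEmbedding (shear a) :=
  (shearHomeomorph a).measurableEmbedding

theorem integral_comp_shear (a : ℝ) (f : ℝ × ℝ → ℝ) : ∫ p, f (shear a p) = ∫ p, f p :=
  (measurePreserving_shear a).integral_comp (measurableEmbedding_shear a) f

theorem integrable_comp_shear (a : ℝ) (f : ℝ × ℝ → ℝ) :
    Integrable (fun p => f (shear a p)) ↔ Integrable f :=
  (measurePreserving_shear a).integrable_comp_emb (measurableEmbedding_shear a)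

theorem IsTestFunction.comp_shear (hφ : IsTestFunction φ) (a : ℝ) :
    IsTestFunction (φ ∘ shear a) :=
  ⟨hφ.contDiff.comp (contDiff_shear a),
    hφ.hasCompactSupport.comp_homeomorph (shearHomeomorph a)⟩

theorem timeDeriv_comp_shear (a : ℝ) (hφ : Differentiable ℝ φ) (p : ℝ × ℝ) :
    timeDeriv (φ ∘ shear a) p = timeDeriv φ (shear a p) := by
  have hcomp := hasDerivAt_timeDeriv
    (hφ.comp ((contDiff_shear a).differentiable (by simp))) p.1 p.2
  have hchain := (hasDerivAt_timeDeriv hφ p.1 (p.1 / a + p.2)).comp p.2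
    ((hasDerivAt_id p.2).const_add (p.1 / a))
  rw [mul_one] at hchain
  exact hcomp.unique hchain

theorem spaceDeriv_comp_shear (a : ℝ) (hφ : Differentiable ℝ φ) (p : ℝ × ℝ) :
    spaceDeriv (φ ∘ shear a) p = spaceDeriv φ (shear a p) + a⁻¹ * timeDeriv φ (shear a p) := by
  have hcomp := hasDerivAt_spaceDeriv
    (hφ.comp ((contDiff_shear a).differentiable (by simp))) p.1 p.2
  have hline : HasDerivAt (fun x : ℝ => (x, x / a + p.2)) ((1 : ℝ), a⁻¹) p.1 := by
    refine (hasDerivAt_id p.1).prodMk ?_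
    simpa using ((hasDerivAt_id p.1).div_const a).add_const p.2
  have hchain := (hφ (shear a p)).hasFDerivAt.comp_hasDerivAt p.1 hline
  rw [hcomp.unique hchain, spaceDeriv, timeDeriv, ← smul_eq_mul, ← map_smul, ← map_add]
  simp

theorem adjointOp_shear (α ε : ℝ) (ha : a ≠ 0) (hφ : Differentiable ℝ φ) (p : ℝ × ℝ) :
    adjointOp α a ε φ (shear a p) = -a * spaceDeriv (φ ∘ shear a) p
      - ε / Real.Gamma (1 - α) * fracIntegral α (timeDeriv (φ ∘ shear a)) p := by
  have hfrac : fracIntegral α (timeDeriv (φ ∘ shear a)) p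
      = fracIntegral α (timeDeriv φ) (shear a p) := by
    simp only [fracIntegral, timeDeriv_comp_shear a hφ]
    simp [shear, add_assoc]
  rw [adjointOp_eq _ _ _ hφ, hfrac, spaceDeriv_comp_shear a hφ]
  field_simp
  ring

end Shear

section Parseval

variable {F : ℂ → ℂ} {f : ℝ → ℂ} {σ : ℝ}

theorem integrable_exp_mul_vertical_mul (hF : Integrable fun w : ℝ => F (σ + w * I))
    (hf : Integrable fun t : ℝ => exp (σ * t) * f t) :
    Integrable (Function.uncurry fun t w : ℝ =>
      exp ((σ + w * I) * t) * F (σ + w * I) * f t) (volume.prod volume) := by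
  have hphase : Continuous fun z : ℝ × ℝ => exp (z.2 * z.1 * I) := by fun_prop
  refine ((hf.mul_prod hF).bdd_mul (c := 1) hphase.aestronglyMeasurable
    (ae_of_all _ fun z => ?_)).congr (ae_of_all _ fun z => ?_)
  · rw [← ofReal_mul, norm_exp_ofReal_mul_I]
  · simp only [Function.uncurry]
    rw [show (σ + z.2 * I) * z.1 = z.2 * z.1 * I + σ * z.1 by ring, exp_add]
    ring

theorem integral_bromwich_mul (hF : Integrable fun w : ℝ => F (σ + w * I))
    (hf : Integrable fun t : ℝ => exp (σ * t) * f t) :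
    ∫ t : ℝ, bromwich F σ t * f t = (1 / (2 * Real.pi) : ℝ) *
      ∫ w : ℝ, F (σ + w * I) * ∫ t : ℝ, exp ((σ + w * I) * t) * f t := by
  calc ∫ t : ℝ, bromwich F σ t * f t
      = ∫ t : ℝ, ((1 / (2 * Real.pi) : ℝ) : ℂ) *
          ∫ w : ℝ, exp ((σ + w * I) * t) * F (σ + w * I) * f t := by
        simp only [bromwich, mul_assoc, ← integral_mul_const]
    _ = (1 / (2 * Real.pi) : ℝ) *
          ∫ w : ℝ, ∫ t : ℝ, exp ((σ + w * I) * t) * F (σ + w * I) * f t := by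
        rw [integral_const_mul, integral_integral_swap (integrable_exp_mul_vertical_mul hF hf)]
    _ = (1 / (2 * Real.pi) : ℝ) *
          ∫ w : ℝ, F (σ + w * I) * ∫ t : ℝ, exp ((σ + w * I) * t) * f t := by
        simp only [← integral_const_mul, mul_assoc, mul_left_comm]

end Parseval

section AdjointSymbol

variable {α a ε : ℝ} {φ Φ : ℝ × ℝ → ℝ} {s : ℂ}

theorem integrable_exp_mul_of_abs_le {f : ℝ → ℝ} (hf : Measurable f) {m T : ℝ}
    (hm : ∀ τ, |f τ| ≤ m) (hT : ∀ τ, T < τ → f τ = 0) (hs : 0 < s.re) :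
    Integrable fun τ : ℝ => exp (s * τ) * (f τ : ℂ) := by
  have hi : Integrable ((Iic T).indicator fun τ => Real.exp (s.re * τ) * m) := by
    rw [integrable_indicator_iff measurableSet_Iic]
    exact (integrableOn_exp_mul_Iic hs T).mul_const m
  refine hi.mono' (Measurable.aestronglyMeasurable (by fun_prop)) (ae_of_all _ fun τ => ?_)
  have hm0 : 0 ≤ m := (abs_nonneg _).trans (hm 0)
  rcases le_or_gt τ T with h | h
  · rw [indicator_of_mem (mem_Iic.2 h), norm_mul, norm_exp, norm_real, re_mul_ofReal]
    exact mul_le_mul_of_nonneg_left (hm τ) (Real.exp_pos _).le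
  · simp only [hT τ h, ofReal_zero, mul_zero, norm_zero]
    exact indicator_nonneg (fun _ _ => by positivity) _

/-- The bilateral Laplace transform in time of the adjoint operator in characteristic coordinates,
as a first order differential expression in `x`. -/
def adjointSymbol (α a ε : ℝ) (Φ : ℝ × ℝ → ℝ) (x : ℝ) (s : ℂ) : ℂ :=
  -a * timeLaplace (spaceDeriv Φ) x s + ε * s ^ (α : ℂ) * timeLaplace Φ x s

theorem integrable_exp_mul_fracIntegral (h0 : 0 ≤ α) (h1 : α < 1) (hΦ : IsTestFunction Φ)
    (x : ℝ) (hs : 0 < s.re) :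
    Integrable fun τ : ℝ => exp (s * τ) * (fracIntegral α Φ (x, τ) : ℂ) := by
  obtain ⟨m, hm⟩ := exists_abs_fracIntegral_le h0 h1 hΦ.continuous hΦ.hasCompactSupport
  obtain ⟨T, -, -, hT⟩ := exists_forall_le_abs_eq_zero hΦ.hasCompactSupport
  exact integrable_exp_mul_of_abs_le
    ((measurable_fracIntegral α hΦ.continuous).comp measurable_prodMk_left)
    (fun τ => hm (x, τ)) (fun τ hτ => fracIntegral_eq_zero hT hτ.le) hs

theorem integral_exp_mul_adjointOp (ε : ℝ) (h0 : 0 ≤ α) (h1 : α < 1) (ha : a ≠ 0)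
    (hφ : IsTestFunction φ) (x : ℝ) (hs : 0 < s.re) :
    ∫ τ : ℝ, exp (s * τ) * (adjointOp α a ε φ (shear a (x, τ)) : ℂ)
      = adjointSymbol α a ε (φ ∘ shear a) x s := by
  have hΦ := hφ.comp_shear a
  set Φ := φ ∘ shear a
  have hspace := integrable_exp_mul_slice hΦ.spaceDeriv.continuous
    hΦ.spaceDeriv.hasCompactSupport x s
  have hfrac := integrable_exp_mul_fracIntegral h0 h1 hΦ.timeDeriv x hs
  have hΓ : (Real.Gamma (1 - α) : ℂ) ≠ 0 :=
    ofReal_ne_zero.2 (Real.Gamma_pos_of_pos (by linarith)).ne'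
  have hs0 : s ≠ 0 := fun h => by simp [h] at hs
  have hpow : s ^ ((α : ℂ) - 1) * s = s ^ (α : ℂ) := by
    rw [cpow_sub _ _ hs0, cpow_one, div_mul_cancel₀ _ hs0]
  calc ∫ τ : ℝ, exp (s * τ) * (adjointOp α a ε φ (shear a (x, τ)) : ℂ)
      = ∫ τ : ℝ, (-a * (exp (s * τ) * (spaceDeriv Φ (x, τ) : ℂ)) - ε / Real.Gamma (1 - α) *
          (exp (s * τ) * (fracIntegral α (timeDeriv Φ) (x, τ) : ℂ))) := by
        refine integral_congr_ae (ae_of_all _ fun τ => ?_)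
        simp only [adjointOp_shear α ε ha hφ.differentiable]
        push_cast
        ring
    _ = -a * timeLaplace (spaceDeriv Φ) x s - ε / Real.Gamma (1 - α) *
          (Real.Gamma (1 - α) * s ^ ((α : ℂ) - 1) * (-s * timeLaplace Φ x s)) := by
        rw [integral_sub (hspace.const_mul _) (hfrac.const_mul _), integral_const_mul,
          integral_const_mul, integral_exp_mul_fracIntegral h1 hΦ.timeDeriv.continuous
          hΦ.timeDeriv.hasCompactSupport x hs, timeLaplace_timeDeriv hΦ]
        rfl
    _ = adjointSymbol α a ε Φ x s := by
        rw [adjointSymbol, ← hpow]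
        field_simp
        ring

theorem integral_kernel_mul_adjointOp {y : ℝ} (ε : ℝ) (h0 : 0 < α) (h1 : α < 1) (ha : a ≠ 0)
    (hy : 0 < y) (hφ : IsTestFunction φ) (x : ℝ) :
    ((∫ τ : ℝ, kernel α y τ * adjointOp α a ε φ (shear a (x, τ)) : ℝ) : ℂ)
      = (1 / (2 * Real.pi) : ℝ) *
        ∫ w : ℝ, symbol α y (1 + w * I) * adjointSymbol α a ε (φ ∘ shear a) x (1 + w * I) := by
  obtain ⟨m, hm⟩ := hφ.exists_abs_adjointOp_le h0.le h1 a ε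
  obtain ⟨T, -, -, hT⟩ := exists_forall_le_abs_eq_zero hφ.hasCompactSupport
  have hshear : Measurable fun τ : ℝ => shear a (x, τ) :=
    (contDiff_shear a).continuous.measurable.comp measurable_prodMk_left
  have hi : Integrable fun τ : ℝ =>
      exp ((1 : ℝ) * τ) * (adjointOp α a ε φ (shear a (x, τ)) : ℂ) :=
    integrable_exp_mul_of_abs_le ((hφ.measurable_adjointOp α a ε).comp hshear)
      (T := T - x / a) (fun τ => hm _)
      (fun τ hτ => adjointOp_eq_zero α a ε hT (by simp only [shear]; linarith)) (by simp)
  have h := integral_bromwich_mul ((isBromwichMajorant_symbol h0 h1 hy).integrable_vertical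
    one_pos) hi
  have hsymbol : ∀ w : ℝ, ∫ τ : ℝ, exp ((1 + w * I) * τ) *
      (adjointOp α a ε φ (shear a (x, τ)) : ℂ) = adjointSymbol α a ε (φ ∘ shear a) x (1 + w * I) :=
    fun w => integral_exp_mul_adjointOp ε h0.le h1 ha hφ x (by simp)
  rw [← integral_complex_ofReal]
  simpa only [ofReal_mul, ofReal_kernel, ofReal_one, hsymbol] using h

theorem norm_symbol_le_one {y : ℝ} (h0 : 0 < α) (h1 : α < 1) (hy : 0 ≤ y) (hs : 0 ≤ s.re) :
    ‖symbol α y s‖ ≤ 1 := by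
  refine (norm_symbol_le h0 h1 hy hs).trans (Real.exp_le_one_iff.2 ?_)
  have := (sectorConst_pos h0 h1).le
  rw [neg_mul, neg_nonpos]
  positivity

theorem exists_norm_adjointSymbol_vertical_le (a ε : ℝ) (h1 : α ≤ 1) (hΦ : IsTestFunction Φ) :
    ∃ C, ∀ x w : ℝ, ‖adjointSymbol α a ε Φ x (1 + w * I)‖ ≤ C * (1 + w ^ 2)⁻¹ := by
  obtain ⟨C₁, hC₁⟩ := exists_norm_pow_mul_norm_timeLaplace_vertical_le hΦ 1
  obtain ⟨C₂, hC₂⟩ := exists_norm_pow_mul_norm_timeLaplace_vertical_le hΦ.spaceDeriv 0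
  refine ⟨|a| * C₂ + |ε| * C₁, fun x w => ?_⟩
  have hnorm : 1 ≤ ‖(1 + w * I : ℂ)‖ := by simpa using abs_re_le_norm (1 + w * I : ℂ)
  have hpow : ‖(1 + w * I : ℂ) ^ (α : ℂ)‖ ≤ ‖(1 + w * I : ℂ)‖ ^ 1 := by
    rw [norm_cpow_real, ← Real.rpow_natCast]
    exact Real.rpow_le_rpow_of_exponent_le hnorm (by simpa using h1)
  rw [adjointSymbol]
  refine (norm_add_le _ _).trans ?_
  rw [norm_mul, norm_mul, norm_mul, norm_neg, norm_real, norm_real, Real.norm_eq_abs,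
    Real.norm_eq_abs, add_mul, mul_assoc, mul_assoc, mul_assoc]
  refine add_le_add (mul_le_mul_of_nonneg_left ?_ (abs_nonneg _))
    (mul_le_mul_of_nonneg_left ?_ (abs_nonneg _))
  · simpa using hC₂ x w
  · exact (mul_le_mul_of_nonneg_right hpow (norm_nonneg _)).trans (hC₁ x w)

theorem exists_forall_lt_adjointSymbol_eq_zero (α a ε : ℝ) (hΦ : IsTestFunction Φ) :
    ∃ T, ∀ x, T < x → ∀ s, adjointSymbol α a ε Φ x s = 0 := by
  obtain ⟨T₁, -, hT₁, -⟩ := exists_forall_le_abs_eq_zero hΦ.hasCompactSupport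
  obtain ⟨T₂, -, hT₂, -⟩ := exists_forall_le_abs_eq_zero hΦ.spaceDeriv.hasCompactSupport
  refine ⟨max T₁ T₂, fun x hx s => ?_⟩
  have hx' := max_lt_iff.1 (hx.trans_le (le_abs_self x))
  rw [adjointSymbol, timeLaplace_eq_zero fun τ => hT₁ (x, τ) hx'.1.le,
    timeLaplace_eq_zero fun τ => hT₂ (x, τ) hx'.2.le]
  simp

theorem measurable_adjointSymbol_vertical (α a ε : ℝ) (hΦ : IsTestFunction Φ) :
    Measurable fun z : ℝ × ℝ => adjointSymbol α a ε Φ z.1 (1 + z.2 * I) := by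
  have hspace := measurable_timeLaplace hΦ.spaceDeriv.continuous
  have hself := measurable_timeLaplace hΦ.continuous
  unfold adjointSymbol
  fun_prop

theorem integrable_symbol_mul_adjointSymbol {κ : ℝ} (a ε : ℝ) (h0 : 0 < α) (h1 : α < 1)
    (hκ : 0 ≤ κ) (hΦ : IsTestFunction Φ) :
    Integrable (Function.uncurry fun x w : ℝ =>
      symbol α (κ * x) (1 + w * I) * adjointSymbol α a ε Φ x (1 + w * I))
      ((volume.restrict (Ioi 0)).prod volume) := by
  obtain ⟨C, hC⟩ := exists_norm_adjointSymbol_vertical_le a ε h1.le hΦ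
  obtain ⟨T, hT⟩ := exists_forall_lt_adjointSymbol_eq_zero α a ε hΦ
  have hi : Integrable ((Iic T).indicator fun _ => C) (volume.restrict (Ioi 0)) := by
    rw [integrable_indicator_iff measurableSet_Iic, IntegrableOn, Measure.restrict_restrict
      measurableSet_Iic, Iic_inter_Ioi]
    exact integrableOn_const measure_Ioc_lt_top.ne
  refine (hi.mul_prod integrable_inv_one_add_sq).mono' ?_ ?_
  · refine Measurable.aestronglyMeasurable ?_
    have := measurable_adjointSymbol_vertical α a ε hΦ
    simp only [Function.uncurry_def, symbol]
    fun_prop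
  · have hpos : ∀ᵐ z ∂((volume.restrict (Ioi (0 : ℝ))).prod (volume : Measure ℝ)), 0 < z.1 :=
      Measure.quasiMeasurePreserving_fst.ae (ae_restrict_mem measurableSet_Ioi)
    filter_upwards [hpos] with ⟨x, w⟩ hx
    rw [Function.uncurry_apply_pair, norm_mul]
    rcases le_or_gt x T with h | h
    · rw [indicator_of_mem (mem_Iic.2 h)]
      exact (mul_le_of_le_one_left (norm_nonneg _)
        (norm_symbol_le_one h0 h1 (mul_nonneg hκ hx.le) (by simp))).trans (hC x w)
    · rw [indicator_of_notMem (by simpa using h), hT x h, norm_zero, mul_zero, zero_mul]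

/-- The symbol `exp (-(ε / a) x s^α)` is the integrating factor of `adjointSymbol`, so the
integrand is the `x`-derivative of `-a exp (-(ε / a) x s^α) Φ̂(x, s)`. -/
theorem integral_symbol_mul_adjointSymbol (ha : a ≠ 0) (hΦ : IsTestFunction Φ)
    (hi : IntegrableOn (fun x : ℝ => symbol α (ε / a * x) s * adjointSymbol α a ε Φ x s) (Ioi 0)) :
    ∫ x in Ioi (0 : ℝ), symbol α (ε / a * x) s * adjointSymbol α a ε Φ x s
      = a * timeLaplace Φ 0 s := by
  have hac : (a : ℂ) ≠ 0 := ofReal_ne_zero.2 ha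
  obtain ⟨T, -, hT, -⟩ := exists_forall_le_abs_eq_zero hΦ.hasCompactSupport
  have hderiv : ∀ x : ℝ, HasDerivAt
      (fun x : ℝ => symbol α (ε / a * x) s * (-a * timeLaplace Φ x s))
      (symbol α (ε / a * x) s * adjointSymbol α a ε Φ x s) x := by
    intro x
    have hlin : HasDerivAt (fun x : ℝ => ε / a * x) (ε / a) x := by
      simpa using (hasDerivAt_id x).const_mul (ε / a)
    have hexponent : HasDerivAt (fun x : ℝ => -((ε / a * x : ℝ) : ℂ) * s ^ (α : ℂ))
        (-((ε / a : ℝ) : ℂ) * s ^ (α : ℂ)) x := hlin.ofReal_comp.neg.mul_const _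
    refine (hexponent.cexp.mul ((hasDerivAt_timeLaplace hΦ s x).const_mul (-a : ℂ))).congr_deriv ?_
    simp only [symbol, adjointSymbol]
    push_cast
    field_simp
    ring
  have htop : Tendsto (fun x : ℝ => symbol α (ε / a * x) s * (-a * timeLaplace Φ x s)) atTop
      (𝓝 0) := by
    refine tendsto_const_nhds.congr' ?_
    filter_upwards [eventually_ge_atTop T] with x hx
    rw [timeLaplace_eq_zero fun τ => hT (x, τ) (hx.trans (le_abs_self x))]
    simp
  rw [integral_Ioi_of_hasDerivAt_of_tendsto' (fun x _ => hderiv x) hi htop]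
  simp [symbol]

theorem integral_integral_kernel_mul_adjointOp (h0 : 0 < α) (h1 : α < 1) (ha : 0 < a)
    (hε : 0 < ε) (hφ : IsTestFunction φ) :
    ∫ x in Ioi (0 : ℝ), ∫ τ : ℝ, kernel α (ε * x / a) τ * adjointOp α a ε φ (shear a (x, τ))
      = a * φ 0 := by
  have hΦ := hφ.comp_shear a
  have hint := integrable_symbol_mul_adjointSymbol a ε h0 h1 (div_pos hε ha).le hΦ
  rw [← ofReal_inj, ← integral_complex_ofReal]
  calc ∫ x in Ioi (0 : ℝ), ((∫ τ : ℝ,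
          kernel α (ε * x / a) τ * adjointOp α a ε φ (shear a (x, τ)) : ℝ) : ℂ)
      = ∫ x in Ioi (0 : ℝ), ((1 / (2 * Real.pi) : ℝ) : ℂ) * ∫ w : ℝ,
          symbol α (ε / a * x) (1 + w * I) *
            adjointSymbol α a ε (φ ∘ shear a) x (1 + w * I) := by
        refine setIntegral_congr_fun measurableSet_Ioi fun x hx => ?_
        have hx0 : 0 < x := hx
        rw [integral_kernel_mul_adjointOp ε h0 h1 ha.ne' (by positivity) hφ, mul_div_right_comm]
    _ = ((1 / (2 * Real.pi) : ℝ) : ℂ) * ∫ w : ℝ, a * timeLaplace (φ ∘ shear a) 0 (1 + w * I) := by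
        rw [integral_const_mul, integral_integral_swap hint]
        congr 1
        refine integral_congr_ae ?_
        filter_upwards [hint.prod_left_ae] with w hw
        exact integral_symbol_mul_adjointSymbol ha.ne' hΦ hw
    _ = ((a * φ 0 : ℝ) : ℂ) := by
        rw [integral_const_mul, mul_left_comm, integral_timeLaplace_vertical hΦ]
        simp [shear, Prod.zero_eq_mk]

end AdjointSymbol

section Dual

variable {α : ℝ} {μ : Measure (ℝ × ℝ)} {f ψ : ℝ × ℝ → ℝ}

/-- The correlation of `ψ` with the measure `f μ`. For a fundamental solution `f μ` it solves the
adjoint equation with source `ψ`. -/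
def dual (μ : Measure (ℝ × ℝ)) (f ψ : ℝ × ℝ → ℝ) (p : ℝ × ℝ) : ℝ := ∫ q, f q * ψ (p + q) ∂μ

theorem dual_eq_convolution (μ : Measure (ℝ × ℝ)) (f ψ : ℝ × ℝ → ℝ) :
    dual μ f ψ = fun p => convolution f (ψ ∘ Neg.neg) (ContinuousLinearMap.mul ℝ ℝ) μ (-p) := by
  funext p
  simp only [dual, convolution, ContinuousLinearMap.mul_apply', Function.comp_apply, neg_sub,
    sub_neg_eq_add, add_comm p]

theorem IsTestFunction.comp_neg (hψ : IsTestFunction ψ) : IsTestFunction (ψ ∘ Neg.neg) :=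
  ⟨hψ.contDiff.comp contDiff_neg, hψ.hasCompactSupport.comp_homeomorph (Homeomorph.neg (ℝ × ℝ))⟩

theorem contDiff_dual (hf : LocallyIntegrable f μ) (hψ : IsTestFunction ψ) :
    ContDiff ℝ ∞ (dual μ f ψ) := by
  rw [dual_eq_convolution]
  exact (hψ.comp_neg.hasCompactSupport.contDiff_convolution_right _ hf
    hψ.comp_neg.contDiff).comp contDiff_neg

theorem fderiv_dual (hf : LocallyIntegrable f μ) (hψ : IsTestFunction ψ) (p v : ℝ × ℝ) :
    fderiv ℝ (dual μ f ψ) p v = dual μ f (fun q => fderiv ℝ ψ q v) p := by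
  have hneg := hψ.comp_neg
  have hG : ContDiff ℝ 1 fun z : ℝ × (ℝ × ℝ) => ψ (-z.2) :=
    (hneg.contDiff.comp contDiff_snd).of_le (by simp)
  have hfderiv : ∀ q, fderiv ℝ (fun z : ℝ × (ℝ × ℝ) => ψ (-z.2)) (0, q)
      = -(fderiv ℝ ψ (-q)).comp (.snd ℝ ℝ (ℝ × ℝ)) := fun q => by
    have hsnd : HasFDerivAt (fun z : ℝ × (ℝ × ℝ) => -z.2) (-.snd ℝ ℝ (ℝ × ℝ)) (0, q) :=
      hasFDerivAt_snd.neg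
    refine ((hψ.differentiable (-q)).hasFDerivAt.comp (0, q) hsnd).fderiv.trans ?_
    ext <;> simp
  -- `HasCompactSupport.hasFDerivAt_convolution_right` would require `μ` to be translation
  -- invariant; the version with a (here trivial) parameter does not.
  have hconv := hasFDerivAt_convolution_right_with_param (P := ℝ) (g := fun _ => ψ ∘ Neg.neg)
    (ContinuousLinearMap.mul ℝ ℝ) isOpen_univ hneg.hasCompactSupport
    (fun _ _ _ hq => image_eq_zero_of_notMem_tsupport hq) hf hG.contDiffOn ((0 : ℝ), -p)
    (mem_univ _)
  have hline : HasFDerivAt (fun p : ℝ × ℝ => ((0 : ℝ), -p))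
      ((0 : ℝ × ℝ →L[ℝ] ℝ).prod (-.id ℝ (ℝ × ℝ))) p :=
    (hasFDerivAt_const (0 : ℝ) p).prodMk (hasFDerivAt_id p).neg
  have hcomp := HasFDerivAt.comp p hconv hline
  have hsupp : HasCompactSupport fun q =>
      fderiv ℝ (fun z : ℝ × (ℝ × ℝ) => ψ (-z.2)) (0, q) := by
    simp only [hfderiv]
    exact ((hψ.hasCompactSupport.fderiv ℝ).comp_homeomorph (Homeomorph.neg _)).comp_left
      (g := fun L : ℝ × ℝ →L[ℝ] ℝ => -L.comp (.snd ℝ ℝ (ℝ × ℝ))) (by simp)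
  rw [dual_eq_convolution]
  refine (congrArg (· v) hcomp.fderiv).trans ?_
  refine (convolution_precompR_apply _ hf hsupp
    (hG.continuous_fderiv (by simp) |>.comp (by fun_prop)) _ _).trans ?_
  simp [convolution, hfderiv, dual, add_comm]

theorem integrable_mul_comp_add (hf : LocallyIntegrable f μ) (hψ : Continuous ψ)
    (hs : HasCompactSupport ψ) (p : ℝ × ℝ) : Integrable (fun q => f q * ψ (p + q)) μ := by
  refine hf.integrable_smul_right_of_hasCompactSupport (by fun_prop)
    (hs.comp_homeomorph (Homeomorph.addLeft p))

theorem measurableSet_snd_le (T : ℝ) : MeasurableSet {q : ℝ × ℝ | q.2 ≤ T} :=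
  measurableSet_le measurable_snd measurable_const

theorem snd_le_mem_nhds (p : ℝ × ℝ) : {q : ℝ × ℝ | q.2 ≤ p.2 + 1} ∈ 𝓝 p :=
  mem_of_superset ((isOpen_lt continuous_snd continuous_const).mem_nhds (by simp))
    fun _ h => le_of_lt h

theorem locallyIntegrable_of_forall_integrableOn_snd_le
    (hf : ∀ T : ℝ, IntegrableOn f {q | q.2 ≤ T} μ) : LocallyIntegrable f μ :=
  fun p => ⟨_, snd_le_mem_nhds p, hf _⟩

theorem integrable_mul_of_snd_le {T m : ℝ} (hf : IntegrableOn f {q | q.2 ≤ T} μ)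
    (hψ : Measurable ψ) (hm : ∀ q, |ψ q| ≤ m) (hT : ∀ q : ℝ × ℝ, T < q.2 → ψ q = 0) :
    Integrable (fun q => f q * ψ q) μ := by
  rw [← integrableOn_iff_integrable_of_support_subset (s := {q | q.2 ≤ T})]
  · exact hf.mul_bdd hψ.aestronglyMeasurable (ae_of_all _ hm)
  · intro q hq
    by_contra h
    exact hq (by simp only [hT q (not_le.1 h), mul_zero])

theorem integrable_mul_rpow_neg_mul [SFinite μ] (h0 : 0 ≤ α) (h1 : α < 1)
    (hf : ∀ T : ℝ, IntegrableOn f {q | q.2 ≤ T} μ) (hψ : Continuous ψ) (hs : HasCompactSupport ψ)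
    (p : ℝ × ℝ) :
    Integrable (Function.uncurry fun (r : ℝ) (q : ℝ × ℝ) =>
      f q * (r ^ (-α) * ψ (p + q + (0, r)))) ((volume.restrict (Ioi 0)).prod μ) := by
  obtain ⟨m, hi, hm⟩ := exists_integral_abs_rpow_neg_mul_le h0 h1 hψ hs
  obtain ⟨T, -, -, hT⟩ := exists_forall_le_abs_eq_zero hs
  have hψm := hψ.measurable
  have hmeas : AEStronglyMeasurable (Function.uncurry fun (r : ℝ) (q : ℝ × ℝ) =>
      f q * (r ^ (-α) * ψ (p + q + (0, r)))) ((volume.restrict (Ioi 0)).prod μ) :=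
    (locallyIntegrable_of_forall_integrableOn_snd_le hf).aestronglyMeasurable.comp_snd.mul
      (Measurable.aestronglyMeasurable (by fun_prop))
  have habs : Measurable fun q => ∫ r in Ioi (0 : ℝ), |r ^ (-α) * ψ (p + q + (0, r))| := by
    have hz : Measurable fun z : (ℝ × ℝ) × ℝ => |z.2 ^ (-α) * ψ (p + z.1 + (0, z.2))| := by
      fun_prop
    exact (hz.stronglyMeasurable.integral_prod_right (ν := volume.restrict (Ioi 0))).measurable
  have hnonneg : ∀ q, 0 ≤ ∫ r in Ioi (0 : ℝ), |r ^ (-α) * ψ (p + q + (0, r))| :=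
    fun q => integral_nonneg fun r => abs_nonneg _
  have hzero : ∀ q : ℝ × ℝ, T - p.2 < q.2 →
      ∫ r in Ioi (0 : ℝ), |r ^ (-α) * ψ (p + q + (0, r))| = 0 := fun q hq =>
    setIntegral_eq_zero_of_forall_eq_zero fun r (hr : 0 < r) => by
      rw [hT _ (le_abs.2 (Or.inl (by simp only [Prod.snd_add]; linarith))), mul_zero, abs_zero]
  rw [integrable_prod_iff' hmeas]
  refine ⟨ae_of_all _ fun q => (hi (p + q)).const_mul (f q), ?_⟩
  refine (integrable_mul_of_snd_le (hf _) habs (fun q => by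
    rw [abs_of_nonneg (hnonneg q)]
    exact hm (p + q)) hzero).norm.congr (ae_of_all _ fun q => ?_)
  simp only [Function.uncurry_apply_pair, norm_mul (f q)]
  rw [integral_const_mul, Real.norm_of_nonneg (hnonneg q)]
  rfl

theorem integrable_mul_fracIntegral [SFinite μ] (h0 : 0 ≤ α) (h1 : α < 1)
    (hf : ∀ T : ℝ, IntegrableOn f {q | q.2 ≤ T} μ) (hψ : Continuous ψ) (hs : HasCompactSupport ψ)
    (p : ℝ × ℝ) : Integrable (fun q => f q * fracIntegral α ψ (p + q)) μ := by
  simpa only [Function.uncurry_apply_pair, integral_const_mul, fracIntegral] using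
    (integrable_mul_rpow_neg_mul h0 h1 hf hψ hs p).integral_prod_right

theorem fracIntegral_dual [SFinite μ] (h0 : 0 ≤ α) (h1 : α < 1)
    (hf : ∀ T : ℝ, IntegrableOn f {q | q.2 ≤ T} μ) (hψ : Continuous ψ) (hs : HasCompactSupport ψ)
    (p : ℝ × ℝ) : fracIntegral α (dual μ f ψ) p = dual μ f (fracIntegral α ψ) p := by
  calc fracIntegral α (dual μ f ψ) p
      = ∫ r in Ioi (0 : ℝ), ∫ q, f q * (r ^ (-α) * ψ (p + q + (0, r))) ∂μ := by
        simp only [fracIntegral, dual, ← integral_const_mul, add_right_comm p, mul_left_comm]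
    _ = ∫ q, (∫ r in Ioi (0 : ℝ), f q * (r ^ (-α) * ψ (p + q + (0, r)))) ∂μ :=
        integral_integral_swap (integrable_mul_rpow_neg_mul h0 h1 hf hψ hs p)
    _ = dual μ f (fracIntegral α ψ) p := by
        simp only [fracIntegral, dual, integral_const_mul]

end Dual

/-- The measure `f μ` is a fundamental solution: it is carried by the cone `0 ≤ x ≤ a t`, and it
solves the equation with right hand side the Dirac mass at the origin. -/
structure IsFundamentalSolution (α a ε : ℝ) (μ : Measure (ℝ × ℝ)) (f : ℝ × ℝ → ℝ) : Prop where
  integrableOn : ∀ T : ℝ, IntegrableOn f {q | q.2 ≤ T} μ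
  support : ∀ q, f q ≠ 0 → 0 ≤ q.1 ∧ q.1 ≤ a * q.2
  integral_adjointOp : ∀ φ, IsTestFunction φ → ∫ q, f q * adjointOp α a ε φ q ∂μ = φ 0

namespace IsFundamentalSolution

variable {α a ε : ℝ} {μ : Measure (ℝ × ℝ)} {f ψ : ℝ × ℝ → ℝ}

theorem locallyIntegrable (h : IsFundamentalSolution α a ε μ f) : LocallyIntegrable f μ :=
  locallyIntegrable_of_forall_integrableOn_snd_le h.integrableOn

theorem adjointOp_dual [SFinite μ] (h : IsFundamentalSolution α a ε μ f) (h0 : 0 ≤ α) (h1 : α < 1)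
    (hψ : IsTestFunction ψ) (p : ℝ × ℝ) : adjointOp α a ε (dual μ f ψ) p = ψ p := by
  have hf := h.locallyIntegrable
  have htime := hψ.timeDeriv
  have hspace := hψ.spaceDeriv
  have hitime := integrable_mul_comp_add hf htime.continuous htime.hasCompactSupport p
  have hispace := integrable_mul_comp_add hf hspace.continuous hspace.hasCompactSupport p
  have hifrac := integrable_mul_fracIntegral h0 h1 h.integrableOn htime.continuous
    htime.hasCompactSupport p
  have htime_dual : timeDeriv (dual μ f ψ) = dual μ f (timeDeriv ψ) :=
    funext fun q => fderiv_dual hf hψ q _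
  have hspace_dual : spaceDeriv (dual μ f ψ) = dual μ f (spaceDeriv ψ) :=
    funext fun q => fderiv_dual hf hψ q _
  calc adjointOp α a ε (dual μ f ψ) p
      = -dual μ f (timeDeriv ψ) p - a * dual μ f (spaceDeriv ψ) p
          - ε / Real.Gamma (1 - α) * dual μ f (fracIntegral α (timeDeriv ψ)) p := by
        rw [adjointOp_eq _ _ _ ((contDiff_dual hf hψ).differentiable (by simp)), htime_dual,
          hspace_dual, fracIntegral_dual h0 h1 h.integrableOn htime.continuous
          htime.hasCompactSupport]
    _ = ∫ q, -(f q * timeDeriv ψ (p + q)) - a * (f q * spaceDeriv ψ (p + q))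
          - ε / Real.Gamma (1 - α) * (f q * fracIntegral α (timeDeriv ψ) (p + q)) ∂μ := by
        have hitime_neg : Integrable (fun q => -(f q * timeDeriv ψ (p + q))) μ := hitime.neg
        have hifirst : Integrable (fun q => -(f q * timeDeriv ψ (p + q))
            - a * (f q * spaceDeriv ψ (p + q))) μ := hitime_neg.sub (hispace.const_mul a)
        rw [integral_sub hifirst (hifrac.const_mul _), integral_sub hitime_neg
          (hispace.const_mul a), integral_neg, integral_const_mul, integral_const_mul]
        rfl
    _ = ∫ q, f q * adjointOp α a ε (fun q => ψ (q + p)) q ∂μ := by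
        refine integral_congr_ae (ae_of_all _ fun q => ?_)
        simp only [adjointOp_comp_add _ _ _ hψ.differentiable,
          adjointOp_eq _ _ _ hψ.differentiable, add_comm p]
        ring
    _ = ψ p := by rw [h.integral_adjointOp _ (hψ.comp_add p), zero_add]

theorem mem_Icc_of_dual_ne_zero (h : IsFundamentalSolution α a ε μ f) (ha : 0 < a) {T τ : ℝ}
    (hT₁ : ∀ p, T ≤ |p.1| → ψ p = 0) (hT₂ : ∀ p, T ≤ |p.2| → ψ p = 0) {p : ℝ × ℝ} (hτ : τ ≤ p.2)
    (hp : dual μ f ψ p ≠ 0) : p ∈ Icc (-T - a * (T - τ)) T ×ˢ Icc τ T := by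
  obtain ⟨q, hq⟩ : ∃ q, f q * ψ (p + q) ≠ 0 := by
    by_contra! hzero
    exact hp (by simp only [dual, hzero, integral_zero])
  obtain ⟨hq₁, hqa⟩ := h.support q (left_ne_zero_of_mul hq)
  have hpq₁ := not_le.1 (mt (hT₁ _) (right_ne_zero_of_mul hq))
  have hpq₂ := not_le.1 (mt (hT₂ _) (right_ne_zero_of_mul hq))
  rw [Prod.fst_add, abs_lt] at hpq₁
  rw [Prod.snd_add, abs_lt] at hpq₂
  have hq₂ : 0 ≤ q.2 := nonneg_of_mul_nonneg_right (hq₁.trans hqa) ha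
  have haq : a * q.2 ≤ a * (T - τ) := mul_le_mul_of_nonneg_left (by linarith) ha.le
  exact ⟨⟨by linarith, by linarith⟩, hτ, by linarith⟩

/-- The dual solution is compactly supported in every half-plane `τ ≤ t`, hence it only needs to be
cut off at negative times. -/
theorem exists_adjointOp_eq [SFinite μ] (h : IsFundamentalSolution α a ε μ f) (ha : 0 < a)
    (h0 : 0 ≤ α) (h1 : α < 1) (hψ : IsTestFunction ψ) :
    ∃ φ, IsTestFunction φ ∧ ∀ p : ℝ × ℝ, 0 < p.2 → adjointOp α a ε φ p = ψ p := by
  obtain ⟨T, -, hT₁, hT₂⟩ := exists_forall_le_abs_eq_zero hψ.hasCompactSupport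
  refine ⟨fun p => Real.smoothTransition (p.2 + 1) * dual μ f ψ p, ⟨?_, ?_⟩, fun p hp => ?_⟩
  · exact (Real.smoothTransition.contDiff.comp (contDiff_snd.add contDiff_const)).mul
      (contDiff_dual h.locallyIntegrable hψ)
  · refine HasCompactSupport.of_support_subset_isCompact
      (isCompact_Icc.prod isCompact_Icc) fun p hp =>
        h.mem_Icc_of_dual_ne_zero ha hT₁ hT₂ (τ := -1) ?_ (right_ne_zero_of_mul hp)
    by_contra! hlt
    exact left_ne_zero_of_mul hp (Real.smoothTransition.zero_of_nonpos (by linarith))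
  · rw [adjointOp_congr α a ε (ψ := dual μ f ψ) (τ := 0) (fun q hq => ?_) hp,
      h.adjointOp_dual h0 h1 hψ]
    rw [Real.smoothTransition.one_of_one_le (by linarith), one_mul]

end IsFundamentalSolution

section WeakSolutions

variable {α a ε : ℝ} {μ : Measure (ℝ × ℝ)} {f u v ψ : ℝ × ℝ → ℝ} {g : ℝ → ℝ}

theorem restrict_nonneg_eq_restrict_pos :
    (volume : Measure (ℝ × ℝ)).restrict {p | 0 ≤ p.2} = volume.restrict {p | 0 < p.2} := by
  refine Measure.restrict_congr_set ?_
  filter_upwards [Measure.quasiMeasurePreserving_snd.ae (Measure.ae_ne volume (0 : ℝ))] with p hp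
  exact propext ⟨fun h => lt_of_le_of_ne h hp.symm, fun h => le_of_lt h⟩

theorem isWeakSolution_iff :
    IsWeakSolution α a ε g u ↔ LocallyIntegrableOn u {p : ℝ × ℝ | 0 ≤ p.2} ∧
      ∀ φ, IsTestFunction φ → ∫ p in {p : ℝ × ℝ | 0 < p.2}, u p * adjointOp α a ε φ p
        = ∫ t in Ioi (0 : ℝ), g t * φ (0, t) :=
  and_congr_right' <| forall_congr' fun _ =>
    ⟨fun h hφ => h hφ.contDiff hφ.hasCompactSupport, fun h hφ hs => h ⟨hφ, hs⟩⟩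

/-- `u` is the superposition of the time translates of the measure `f μ` with weight `g`, as seen
by bounded functions that vanish at large times. -/
def IsSuperposition (μ : Measure (ℝ × ℝ)) (f : ℝ × ℝ → ℝ) (g : ℝ → ℝ) (u : ℝ × ℝ → ℝ) : Prop :=
  ∀ (T m : ℝ) (ψ : ℝ × ℝ → ℝ), Measurable ψ → (∀ p, |ψ p| ≤ m) →
    (∀ p : ℝ × ℝ, T < p.2 → ψ p = 0) →
    IntegrableOn (fun p => u p * ψ p) {p | 0 < p.2} ∧
    ∫ p in {p : ℝ × ℝ | 0 < p.2}, u p * ψ p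
      = ∫ r in Ioi (0 : ℝ), g r * ∫ q, f q * ψ (q + (0, r)) ∂μ

theorem IsSuperposition.locallyIntegrableOn (hu : IsSuperposition μ f g u) :
    LocallyIntegrableOn u {p : ℝ × ℝ | 0 ≤ p.2} := by
  intro p _
  refine ⟨_, inter_mem (mem_nhdsWithin_of_mem_nhds (snd_le_mem_nhds p)) self_mem_nhdsWithin, ?_⟩
  have hmeas := measurableSet_snd_le (p.2 + 1)
  have hi := (hu (p.2 + 1) 1 ({q : ℝ × ℝ | q.2 ≤ p.2 + 1}.indicator 1)
    (measurable_const.indicator hmeas)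
    (fun q => (norm_indicator_le_norm_self (1 : ℝ × ℝ → ℝ) q).trans_eq norm_one)
    (fun q hq => indicator_of_notMem (s := {q : ℝ × ℝ | q.2 ≤ p.2 + 1}) (not_le.2 hq) _)).1
  rw [IntegrableOn, ← Measure.restrict_restrict hmeas, restrict_nonneg_eq_restrict_pos,
    ← IntegrableOn, ← integrable_indicator_iff hmeas]
  refine hi.congr (ae_of_all _ fun q => ?_)
  simp only [indicator_apply, Pi.one_apply, mul_ite, mul_one, mul_zero]

theorem IsFundamentalSolution.isWeakSolution (h : IsFundamentalSolution α a ε μ f) (h0 : 0 ≤ α)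
    (h1 : α < 1) (hu : IsSuperposition μ f g u) : IsWeakSolution α a ε g u := by
  refine isWeakSolution_iff.2 ⟨hu.locallyIntegrableOn, fun φ hφ => ?_⟩
  obtain ⟨m, hm⟩ := hφ.exists_abs_adjointOp_le h0 h1 a ε
  obtain ⟨T, -, -, hT⟩ := exists_forall_le_abs_eq_zero hφ.hasCompactSupport
  have htranslate : ∀ r, ∫ q, f q * adjointOp α a ε φ (q + (0, r)) ∂μ = φ (0, r) := fun r => by
    simpa only [adjointOp_comp_add α a ε hφ.differentiable, zero_add] using
      h.integral_adjointOp _ (hφ.comp_add (0, r))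
  rw [(hu T m _ (hφ.measurable_adjointOp α a ε) hm
    (fun p hp => adjointOp_eq_zero α a ε hT hp)).2]
  simp only [htranslate]

theorem integrableOn_mul_of_hasCompactSupport (hu : LocallyIntegrableOn u {p : ℝ × ℝ | 0 ≤ p.2})
    (hψ : Continuous ψ) (hs : HasCompactSupport ψ) :
    IntegrableOn (fun p => u p * ψ p) {p | 0 < p.2} := by
  have hmeas : MeasurableSet (tsupport ψ) := (isClosed_tsupport ψ).measurableSet
  have hi : IntegrableOn u (tsupport ψ ∩ {p : ℝ × ℝ | 0 ≤ p.2}) :=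
    hu.integrableOn_compact_subset inter_subset_right
      (hs.isCompact.inter_right (isClosed_le continuous_const continuous_snd))
  obtain ⟨m, hm⟩ := hs.exists_bound_of_continuous hψ
  rw [IntegrableOn, ← Measure.restrict_restrict hmeas, restrict_nonneg_eq_restrict_pos] at hi
  rw [IntegrableOn, ← integrableOn_iff_integrable_of_support_subset (s := tsupport ψ)]
  · exact Integrable.mul_bdd hi hψ.aestronglyMeasurable (ae_of_all _ hm)
  · exact (Function.support_mul_subset_right u ψ).trans (subset_tsupport ψ)

/-- Two weak solutions have the same pairing with every `adjointOp φ`, and at positive times these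
exhaust the test functions supported there. -/
theorem IsFundamentalSolution.ae_eq [SFinite μ] (h : IsFundamentalSolution α a ε μ f) (ha : 0 < a)
    (h0 : 0 ≤ α) (h1 : α < 1) (hu : IsWeakSolution α a ε g u) (hv : IsWeakSolution α a ε g v) :
    ∀ᵐ p ∂(volume.restrict {p : ℝ × ℝ | 0 < p.2}), u p = v p := by
  rw [isWeakSolution_iff] at hu hv
  have hopen : IsOpen {p : ℝ × ℝ | 0 < p.2} := isOpen_lt continuous_const continuous_snd
  have hzero := hopen.ae_eq_zero_of_integral_contDiff_smul_eq_zero (f := u - v) (μ := volume)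
    ((hu.1.sub hv.1).mono_set fun p (hp : 0 < p.2) => hp.le) fun ψ hψ hs hsupp => ?_
  · rw [ae_restrict_iff' hopen.measurableSet]
    filter_upwards [hzero] with p hp hp' using sub_eq_zero.1 (hp hp')
  obtain ⟨φ, hφ, hadj⟩ := h.exists_adjointOp_eq ha h0 h1 ⟨hψ, hs⟩
  have hpair : ∀ w : ℝ × ℝ → ℝ, ∫ p in {p : ℝ × ℝ | 0 < p.2}, w p * ψ p
      = ∫ p in {p : ℝ × ℝ | 0 < p.2}, w p * adjointOp α a ε φ p := fun w =>
    setIntegral_congr_fun hopen.measurableSet fun p hp => by simp only [hadj p hp]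
  calc ∫ p, ψ p • (u - v) p
      = ∫ p in {p : ℝ × ℝ | 0 < p.2}, (u p * ψ p - v p * ψ p) := by
        rw [← setIntegral_eq_integral_of_forall_compl_eq_zero fun p hp => by
          rw [image_eq_zero_of_notMem_tsupport (fun hmem => hp (hsupp hmem)), zero_smul]]
        simp only [Pi.sub_apply, smul_eq_mul, mul_comm (ψ _), sub_mul]
    _ = 0 := by
        rw [integral_sub (integrableOn_mul_of_hasCompactSupport hu.1 hψ.continuous hs)
          (integrableOn_mul_of_hasCompactSupport hv.1 hψ.continuous hs), hpair, hpair,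
          hu.2 φ hφ, hv.2 φ hφ, sub_self]

end WeakSolutions

section TimeTranslates

variable {f u ψ : ℝ × ℝ → ℝ} {g : ℝ → ℝ} {T m : ℝ}

theorem setIntegral_snd_pos_eq_integral (hu : ∀ p : ℝ × ℝ, p.2 ≤ 0 → u p = 0) :
    ∫ p in {p : ℝ × ℝ | 0 < p.2}, u p * ψ p = ∫ p, u p * ψ p :=
  setIntegral_eq_integral_of_forall_compl_eq_zero fun p hp => by rw [hu p (not_lt.1 hp), zero_mul]

theorem measurePreserving_timeShift :
    MeasurePreserving (fun z : ℝ × (ℝ × ℝ) => (z.1, z.2 - ((0 : ℝ), z.1)))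
      ((volume.restrict (Ioi 0)).prod volume) ((volume.restrict (Ioi 0)).prod volume) := by
  refine (MeasurePreserving.id (volume.restrict (Ioi (0 : ℝ)))).skew_product
    (g := fun r p => p - ((0 : ℝ), r)) ?_ (ae_of_all _ fun r => ?_)
  · simp only [Function.uncurry_def]
    fun_prop
  · exact (measurePreserving_sub_right volume ((0 : ℝ), r)).map_eq

theorem integrable_mul_translate_mul (hg : IntegrableOn g (Icc 0 T))
    (hf : IntegrableOn f {q | q.2 ≤ T}) (hsupp : ∀ q, f q ≠ 0 → 0 ≤ q.2) (hψ : Measurable ψ)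
    (hm : ∀ p, |ψ p| ≤ m) (hT : ∀ p : ℝ × ℝ, T < p.2 → ψ p = 0) :
    Integrable (Function.uncurry fun (r : ℝ) (p : ℝ × ℝ) => g r * f (p - (0, r)) * ψ p)
      ((volume.restrict (Ioi 0)).prod volume) := by
  have hcut := measurePreserving_timeShift.integrable_comp_of_integrable
    (((integrable_indicator_iff measurableSet_Icc).2 hg).restrict.mul_prod
      ((integrable_indicator_iff (measurableSet_snd_le T)).2 hf))
  refine (hcut.mul_bdd (g := fun z => ψ z.2) (c := m)
    (hψ.comp measurable_snd).aestronglyMeasurable (ae_of_all _ fun z => hm _)).congr ?_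
  have hpos : ∀ᵐ z ∂((volume.restrict (Ioi (0 : ℝ))).prod (volume : Measure (ℝ × ℝ))), 0 < z.1 :=
    Measure.quasiMeasurePreserving_fst.ae (ae_restrict_mem measurableSet_Ioi)
  filter_upwards [hpos] with ⟨r, p⟩ (hr : 0 < r)
  simp only [Function.comp_apply, Function.uncurry_apply_pair]
  rcases eq_or_ne (f (p - (0, r))) 0 with hzero | hne
  · rw [hzero, mul_zero, zero_mul, indicator_apply_eq_zero.2 fun _ => hzero, mul_zero, zero_mul]
  rcases lt_or_ge T p.2 with hp | hp
  · rw [hT p hp, mul_zero, mul_zero]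
  have hrp : 0 ≤ p.2 - r := hsupp _ hne
  rw [indicator_of_mem (mem_Icc.2 ⟨hr.le, by linarith⟩), indicator_of_mem]
  exact (sub_le_self p.2 hr.le).trans hp

theorem isSuperposition_of_eq_integral (hg : LocallyIntegrableOn g (Ici 0))
    (hf : ∀ T : ℝ, IntegrableOn f {q | q.2 ≤ T}) (hsupp : ∀ q, f q ≠ 0 → 0 ≤ q.2)
    (hu : ∀ p, u p = ∫ r in Ioi (0 : ℝ), g r * f (p - (0, r))) :
    IsSuperposition volume f g u := by
  intro T m ψ hψ hm hT
  have hint := integrable_mul_translate_mul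
    (hg.integrableOn_compact_subset Icc_subset_Ici_self isCompact_Icc) (hf T) hsupp hψ hm hT
  have huψ : ∀ p, ∫ r in Ioi (0 : ℝ), g r * f (p - (0, r)) * ψ p = u p * ψ p := fun p => by
    rw [integral_mul_const, hu]
  have hnonpos : ∀ p : ℝ × ℝ, p.2 ≤ 0 → u p = 0 := fun p hp => by
    rw [hu]
    refine setIntegral_eq_zero_of_forall_eq_zero fun r (hr : 0 < r) => ?_
    rw [not_ne_iff.1 (mt (hsupp (p - (0, r))) (not_le.2 (by simpa using hp.trans_lt hr))),
      mul_zero]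
  have hslice := hint.integral_prod_right
  have hswap := integral_integral_swap hint
  simp only [Function.uncurry_apply_pair, huψ] at hslice hswap
  refine ⟨hslice.integrableOn, ?_⟩
  rw [setIntegral_snd_pos_eq_integral hnonpos, ← hswap]
  refine integral_congr_ae (ae_of_all _ fun r => ?_)
  simp only [mul_assoc]
  rw [integral_const_mul, ← integral_sub_right_eq_self (fun q => f q * ψ (q + (0, r))) ((0 : ℝ), r)]
  simp only [sub_add_cancel]

end TimeTranslates

section PositiveEpsilon

variable {α a ε : ℝ}

/-- The density of the fundamental solution for `ε > 0`: the closed form with `g` replaced by the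
Dirac mass at `0`. -/
def fundamentalDensity (α a ε : ℝ) (p : ℝ × ℝ) : ℝ :=
  if 0 < p.1 ∧ p.1 / a < p.2 then (1 / a) * kernel α (ε * p.1 / a) (p.2 - p.1 / a) else 0

theorem measurable_fundamentalDensity (α a ε : ℝ) : Measurable (fundamentalDensity α a ε) := by
  refine Measurable.ite ?_ ?_ measurable_const
  · exact (measurableSet_lt measurable_const measurable_fst).inter
      (measurableSet_lt (by fun_prop) measurable_snd)
  · have hcoord : Measurable fun p : ℝ × ℝ => (ε * p.1 / a, p.2 - p.1 / a) := by fun_prop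
    exact ((measurable_kernel α).comp hcoord).const_mul _

theorem fundamentalDensity_shear (α a ε x τ : ℝ) :
    fundamentalDensity α a ε (shear a (x, τ))
      = if 0 < x ∧ 0 < τ then (1 / a) * kernel α (ε * x / a) τ else 0 := by
  simp only [fundamentalDensity, shear, add_sub_cancel_left, lt_add_iff_pos_right]

theorem fundamentalDensity_support (ha : 0 < a) {q : ℝ × ℝ} (hq : fundamentalDensity α a ε q ≠ 0) :
    0 < q.1 ∧ q.1 < a * q.2 :=
  (ite_ne_right_iff.1 hq).1.imp_right (div_lt_iff₀' ha).1

theorem integrable_indicator_Ioc_rpow {β : ℝ} (hβ : -1 < β) (R : ℝ) :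
    Integrable ((Ioc (0 : ℝ) R).indicator fun x => x ^ β) := by
  rw [integrable_indicator_iff measurableSet_Ioc]
  exact (intervalIntegral.intervalIntegrable_rpow' hβ (a := 0) (b := R)).1

theorem abs_fundamentalDensity_shear_le {C : ℝ} (hC0 : 0 ≤ C)
    (hC : ∀ y t : ℝ, 0 < y → 0 < t →
      |kernel α y t| ≤ C * (y ^ (-1 / 2 : ℝ) * t ^ (α / 2 - 1)))
    (ha : 0 < a) (hε : 0 < ε) {T x τ : ℝ} (hT : x / a + τ ≤ T) :
    |fundamentalDensity α a ε (shear a (x, τ))| ≤ 1 / a * C * (ε / a) ^ (-1 / 2 : ℝ) *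
      ((Ioc (0 : ℝ) (a * T)).indicator (fun x => x ^ (-1 / 2 : ℝ)) x *
        (Ioc (0 : ℝ) T).indicator (fun x => x ^ (α / 2 - 1)) τ) := by
  rw [fundamentalDensity_shear]
  split_ifs with hpos
  · obtain ⟨hx, hτ⟩ := hpos
    have hxa : 0 < x / a := div_pos hx ha
    have hxT : x ≤ a * T := (div_le_iff₀' ha).1 (by linarith)
    rw [indicator_of_mem (mem_Ioc.2 ⟨hx, hxT⟩), indicator_of_mem (mem_Ioc.2 ⟨hτ, by linarith⟩),
      abs_mul, abs_of_pos (one_div_pos.2 ha)]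
    calc 1 / a * |kernel α (ε * x / a) τ|
        ≤ 1 / a * (C * ((ε * x / a) ^ (-1 / 2 : ℝ) * τ ^ (α / 2 - 1))) := by
          gcongr
          exact hC _ _ (by positivity) hτ
      _ = 1 / a * C * (ε / a) ^ (-1 / 2 : ℝ) * (x ^ (-1 / 2 : ℝ) * τ ^ (α / 2 - 1)) := by
          rw [mul_div_right_comm, Real.mul_rpow (by positivity) hx.le]
          ring
  · rw [abs_zero]
    refine mul_nonneg (by positivity) (mul_nonneg ?_ ?_) <;>
    exact indicator_nonneg (fun x hx => Real.rpow_nonneg hx.1.le _) _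

theorem integrableOn_fundamentalDensity (h0 : 0 < α) (h1 : α < 1) (ha : 0 < a) (hε : 0 < ε)
    (T : ℝ) : IntegrableOn (fundamentalDensity α a ε) {q | q.2 ≤ T} := by
  obtain ⟨C, hC0, hC⟩ := abs_kernel_le_mul_rpow h0 h1
  have hmeas := measurableSet_snd_le T
  rw [← integrable_indicator_iff hmeas, ← integrable_comp_shear a]
  have hprod := ((integrable_indicator_Ioc_rpow (β := -1 / 2) (by norm_num) (a * T)).mul_prod
    (integrable_indicator_Ioc_rpow (β := α / 2 - 1) (by linarith) T)).const_mul
      (1 / a * C * (ε / a) ^ (-1 / 2 : ℝ))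
  refine (hprod.indicator (measurableSet_preimage
    (contDiff_shear a).continuous.measurable hmeas)).mono' ?_ (ae_of_all _ fun z => ?_)
  · exact (((measurable_fundamentalDensity α a ε).indicator hmeas).comp
      (contDiff_shear a).continuous.measurable).aestronglyMeasurable
  · by_cases hz : shear a z ∈ {q : ℝ × ℝ | q.2 ≤ T}
    · rw [indicator_of_mem hz, indicator_of_mem (mem_preimage.2 hz)]
      exact abs_fundamentalDensity_shear_le hC0 hC ha hε hz
    · rw [indicator_of_notMem hz, indicator_of_notMem (mt mem_preimage.1 hz), norm_zero]

theorem mul_integral_fundamentalDensity_shear_mul (h0 : 0 < α) (h1 : α < 1) (ha : 0 < a)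
    (hε : 0 < ε) (ψ : ℝ → ℝ) {x : ℝ} (hx : 0 < x) :
    a * ∫ τ, fundamentalDensity α a ε (shear a (x, τ)) * ψ τ
      = ∫ τ, kernel α (ε * x / a) τ * ψ τ := by
  rw [← integral_const_mul]
  refine integral_congr_ae ?_
  filter_upwards [Measure.ae_ne volume 0] with τ hτ
  rw [fundamentalDensity_shear]
  rcases lt_or_gt_of_ne hτ with hneg | hpos
  · rw [kernel_eq_zero_of_neg h0 h1 (by positivity) hneg, if_neg fun h => hneg.not_gt h.2,
      zero_mul, mul_zero]
  · rw [if_pos ⟨hx, hpos⟩]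
    field_simp

theorem integral_fundamentalDensity_mul_adjointOp (h0 : 0 < α) (h1 : α < 1) (ha : 0 < a)
    (hε : 0 < ε) {φ : ℝ × ℝ → ℝ} (hφ : IsTestFunction φ) :
    ∫ q, fundamentalDensity α a ε q * adjointOp α a ε φ q = φ 0 := by
  obtain ⟨m, hm⟩ := hφ.exists_abs_adjointOp_le h0.le h1 a ε
  obtain ⟨T, -, -, hT⟩ := exists_forall_le_abs_eq_zero hφ.hasCompactSupport
  have hint : Integrable fun q => fundamentalDensity α a ε q * adjointOp α a ε φ q :=
    integrable_mul_of_snd_le (integrableOn_fundamentalDensity h0 h1 ha hε T)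
      (hφ.measurable_adjointOp α a ε) hm (fun q hq => adjointOp_eq_zero α a ε hT hq)
  rw [← integral_comp_shear a (fun q => fundamentalDensity α a ε q * adjointOp α a ε φ q)]
  rw [← integrable_comp_shear a] at hint
  rw [Measure.volume_eq_prod] at hint ⊢
  rw [integral_prod _ hint, ← mul_right_inj' ha.ne',
    ← integral_integral_kernel_mul_adjointOp h0 h1 ha hε hφ, ← integral_const_mul,
    ← setIntegral_eq_integral_of_forall_compl_eq_zero (s := Ioi (0 : ℝ))]
  · exact setIntegral_congr_fun measurableSet_Ioi fun x hx =>
      mul_integral_fundamentalDensity_shear_mul h0 h1 ha hε _ hx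
  · intro x hx
    simp only [fundamentalDensity_shear, if_neg fun h : 0 < x ∧ _ => hx h.1, zero_mul,
      integral_zero, mul_zero]

theorem isFundamentalSolution_fundamentalDensity (h0 : 0 < α) (h1 : α < 1) (ha : 0 < a)
    (hε : 0 < ε) : IsFundamentalSolution α a ε volume (fundamentalDensity α a ε) where
  integrableOn := integrableOn_fundamentalDensity h0 h1 ha hε
  support _ hq := (fundamentalDensity_support ha hq).imp le_of_lt le_of_lt
  integral_adjointOp _ hφ := integral_fundamentalDensity_mul_adjointOp h0 h1 ha hε hφ

theorem closedForm_eq_integral (ha : 0 < a) (hε : 0 < ε) (g : ℝ → ℝ) (p : ℝ × ℝ) :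
    closedForm α a ε g p = ∫ r in Ioi (0 : ℝ), g r * fundamentalDensity α a ε (p - (0, r)) := by
  rw [closedForm]
  split_ifs with hx
  · have hy : ε * p.1 / a ≠ 0 := by positivity
    set b := p.2 - p.1 / a with hb
    rw [kernelConv, if_neg hy, ← integral_const_mul, ← integral_indicator measurableSet_Ioc,
      ← integral_indicator measurableSet_Ioi, ← integral_sub_left_eq_self _ volume b]
    refine integral_congr_ae ?_
    filter_upwards [Measure.ae_ne volume 0] with r hr
    have hshift : p.2 - r - p.1 / a = b - r := by rw [hb, sub_right_comm]
    have hlt : p.1 / a < p.2 - r ↔ r < b := by rw [← sub_pos, hshift, sub_pos]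
    simp only [indicator_apply, mem_Ioc, mem_Ioi, fundamentalDensity, Prod.fst_sub, Prod.snd_sub,
      sub_zero, sub_pos, sub_le_self_iff, sub_sub_cancel, hx, true_and, hlt, hshift,
      hr.symm.le_iff_lt]
    split_ifs <;> first | tauto | ring
  · simp only [fundamentalDensity, Prod.fst_sub, sub_zero, hx, false_and, if_false, mul_zero,
      integral_zero]

theorem isSuperposition_fundamentalDensity (h0 : 0 < α) (h1 : α < 1) (ha : 0 < a) (hε : 0 < ε)
    {g : ℝ → ℝ} (hg : LocallyIntegrableOn g (Ici 0)) :
    IsSuperposition volume (fundamentalDensity α a ε) g (closedForm α a ε g) :=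
  isSuperposition_of_eq_integral hg (integrableOn_fundamentalDensity h0 h1 ha hε)
    (fun _ hq => have h := fundamentalDensity_support ha hq
      (pos_of_mul_pos_right (h.1.trans h.2) ha.le).le)
    (closedForm_eq_integral ha hε g)

end PositiveEpsilon

section ZeroEpsilon

variable {a : ℝ} {g : ℝ → ℝ} {φ ψ : ℝ × ℝ → ℝ}

/-- The measure carried by the characteristic ray from the origin, parametrised by `x > 0`. For
`ε = 0` the fundamental solution is singular with respect to Lebesgue measure, and has a density
with respect to this one. -/
def rayMeasure (a : ℝ) : Measure (ℝ × ℝ) :=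
  (volume.restrict (Ioi 0)).map fun x => shear a (x, 0)

instance (a : ℝ) : SFinite (rayMeasure a) := by
  unfold rayMeasure
  infer_instance

/-- The density of the fundamental solution for `ε = 0` with respect to `rayMeasure a`, extended by
`1 / a` to the cone `0 ≤ x ≤ a t` and by `0` to the rest of the plane. -/
def rayDensity (a : ℝ) (q : ℝ × ℝ) : ℝ := if 0 ≤ q.1 ∧ q.1 ≤ a * q.2 then 1 / a else 0

theorem measurable_rayDensity (a : ℝ) : Measurable (rayDensity a) :=
  Measurable.ite ((measurableSet_le measurable_const measurable_fst).inter
    (measurableSet_le measurable_fst (by fun_prop))) measurable_const measurable_const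

theorem abs_rayDensity_le (ha : 0 < a) (q : ℝ × ℝ) : |rayDensity a q| ≤ 1 / a := by
  rw [rayDensity]
  split_ifs
  · exact (abs_of_pos (one_div_pos.2 ha)).le
  · simpa using ha.le

theorem measurable_shear_zero (a : ℝ) : Measurable fun x : ℝ => shear a (x, 0) := by
  unfold shear
  fun_prop

theorem integral_rayMeasure (ha : 0 < a) (hψ : Measurable ψ) :
    ∫ q, rayDensity a q * ψ q ∂(rayMeasure a) = ∫ x in Ioi (0 : ℝ), 1 / a * ψ (shear a (x, 0)) := by
  have hmeas : Measurable fun q => rayDensity a q * ψ q := (measurable_rayDensity a).mul hψ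
  rw [rayMeasure, integral_map (measurable_shear_zero a).aemeasurable hmeas.aestronglyMeasurable]
  refine setIntegral_congr_fun measurableSet_Ioi fun x (hx : 0 < x) => ?_
  have hcone : 0 ≤ (shear a (x, 0)).1 ∧ (shear a (x, 0)).1 ≤ a * (shear a (x, 0)).2 := by
    simp only [shear, add_zero]
    exact ⟨hx.le, (mul_div_cancel₀ x ha.ne').ge⟩
  simp only [rayDensity, if_pos hcone]

theorem integrableOn_rayDensity (ha : 0 < a) (T : ℝ) :
    IntegrableOn (rayDensity a) {q | q.2 ≤ T} (rayMeasure a) := by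
  have hmeas := measurable_shear_zero a (measurableSet_snd_le T)
  refine Measure.integrableOn_of_bounded (M := 1 / a) ?_
    (measurable_rayDensity a).aestronglyMeasurable (ae_of_all _ (abs_rayDensity_le ha))
  rw [rayMeasure, Measure.map_apply (measurable_shear_zero a) (measurableSet_snd_le T),
    Measure.restrict_apply hmeas]
  refine ((measure_mono (t := Icc 0 (a * T)) ?_).trans_lt measure_Icc_lt_top).ne
  rintro x ⟨hxT, hx⟩
  have hxT' : x / a + 0 ≤ T := hxT
  exact ⟨le_of_lt hx, (div_le_iff₀' ha).1 (by linarith)⟩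

theorem integral_spaceDeriv_Ioi (hφ : IsTestFunction φ) :
    ∫ x in Ioi (0 : ℝ), spaceDeriv φ (x, 0) = -φ 0 := by
  have hsmooth : ContDiff ℝ 1 fun x => φ (x, 0) :=
    (hφ.contDiff.comp (contDiff_id.prodMk contDiff_const)).of_le (by simp)
  have hsupp : HasCompactSupport fun x => φ (x, 0) := by
    obtain ⟨T, -, hT, -⟩ := exists_forall_le_abs_eq_zero hφ.hasCompactSupport
    refine HasCompactSupport.of_support_subset_isCompact (isCompact_Icc (a := -T) (b := T)) ?_
    exact fun x hx => abs_le.1 (not_le.1 (mt (hT (x, 0)) hx)).le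
  have hderiv : ∀ x, spaceDeriv φ (x, 0) = deriv (fun x => φ (x, 0)) x := fun x =>
    (hasDerivAt_spaceDeriv hφ.differentiable x 0).deriv.symm
  simp only [hderiv]
  exact HasCompactSupport.integral_Ioi_deriv_eq hsmooth hsupp 0

theorem isFundamentalSolution_rayDensity (α : ℝ) (ha : 0 < a) :
    IsFundamentalSolution α a 0 (rayMeasure a) (rayDensity a) where
  integrableOn := integrableOn_rayDensity ha
  support _ hq := (ite_ne_right_iff.1 hq).1
  integral_adjointOp φ hφ := by
    have hadj : ∀ x : ℝ, 1 / a * adjointOp α a 0 φ (shear a (x, 0))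
        = -spaceDeriv (φ ∘ shear a) (x, 0) := fun x => by
      rw [adjointOp_shear α 0 ha.ne' hφ.differentiable]
      field_simp
      ring
    rw [integral_rayMeasure ha (hφ.measurable_adjointOp α a 0)]
    simp only [hadj]
    rw [integral_neg, integral_spaceDeriv_Ioi (hφ.comp_shear a), neg_neg]
    simp [shear, Prod.zero_eq_mk]

theorem closedForm_zero_shear (α a : ℝ) (g : ℝ → ℝ) (x τ : ℝ) :
    closedForm α a 0 g (shear a (x, τ))
      = (Ioi (0 : ℝ)).indicator (fun _ => 1 / a) x * (Ici (0 : ℝ)).indicator g τ := by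
  simp only [closedForm, kernelConv, shear, zero_mul, zero_div, if_true, add_sub_cancel_left,
    indicator_apply, mem_Ioi, mem_Ici]
  split_ifs <;> simp

theorem closedForm_zero_eq_zero_of_nonpos (α : ℝ) (ha : 0 < a) (g : ℝ → ℝ) {p : ℝ × ℝ}
    (hp : p.2 ≤ 0) : closedForm α a 0 g p = 0 := by
  simp only [closedForm, kernelConv, zero_mul, zero_div, if_true]
  split_ifs with hx ht
  · linarith [div_pos hx ha]
  · exact mul_zero _
  · rfl

theorem integrable_closedForm_zero_mul (α : ℝ) (ha : 0 < a) {T m : ℝ}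
    (hg : IntegrableOn g (Icc 0 T)) (hψ : Measurable ψ) (hm : ∀ p, |ψ p| ≤ m)
    (hT : ∀ p : ℝ × ℝ, T < p.2 → ψ p = 0) :
    Integrable fun z => closedForm α a 0 g (shear a z) * ψ (shear a z) := by
  have hspace : Integrable ((Ioc 0 (a * T)).indicator fun _ => 1 / a) := by
    rw [integrable_indicator_iff measurableSet_Ioc]
    exact (continuousOn_const.integrableOn_Icc).mono_set Ioc_subset_Icc_self
  have htime := (integrable_indicator_iff measurableSet_Icc).2 hg
  have hshear : Measurable (shear a) := (contDiff_shear a).continuous.measurable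
  refine ((hspace.mul_prod htime).mul_bdd (g := fun z => ψ (shear a z)) (c := m)
    (hψ.comp hshear).aestronglyMeasurable (ae_of_all _ fun z => hm _)).congr (ae_of_all _ ?_)
  rintro ⟨x, τ⟩
  rcases lt_or_ge T (x / a + τ) with hz | hz
  · simp only [hT (shear a (x, τ)) hz, mul_zero]
  simp only [closedForm_zero_shear]
  by_cases hxτ : 0 < x ∧ 0 ≤ τ
  · obtain ⟨hx, hτ⟩ := hxτ
    have hxa : 0 < x / a := div_pos hx ha
    have hxT : x ≤ a * T := (div_le_iff₀' ha).1 (by linarith)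
    simp [hx, hxT, hτ, show τ ≤ T by linarith]
  · simp only [indicator_apply, mem_Ioc, mem_Icc, mem_Ioi, mem_Ici]
    grind

theorem isSuperposition_rayDensity (α : ℝ) (ha : 0 < a) (hg : LocallyIntegrableOn g (Ici 0)) :
    IsSuperposition (rayMeasure a) (rayDensity a) g (closedForm α a 0 g) := by
  intro T m ψ hψ hm hT
  have hint := integrable_closedForm_zero_mul α ha
    (hg.integrableOn_compact_subset Icc_subset_Ici_self isCompact_Icc) hψ hm hT
  refine ⟨((integrable_comp_shear a fun p => closedForm α a 0 g p * ψ p).1 hint).integrableOn, ?_⟩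
  rw [setIntegral_snd_pos_eq_integral fun p => closedForm_zero_eq_zero_of_nonpos α ha g,
    ← integral_comp_shear a (fun p => closedForm α a 0 g p * ψ p)]
  rw [Measure.volume_eq_prod] at hint ⊢
  rw [integral_prod_symm _ hint, ← integral_Ici_eq_integral_Ioi,
    ← integral_indicator measurableSet_Ici]
  refine integral_congr_ae (ae_of_all _ fun τ => ?_)
  simp only [closedForm_zero_shear]
  by_cases hτ : τ ∈ Ici (0 : ℝ)
  · have hψτ : Measurable fun q : ℝ × ℝ => ψ (q + (0, τ)) := by fun_prop
    rw [indicator_of_mem hτ, indicator_of_mem hτ, integral_rayMeasure ha hψτ,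
      ← integral_const_mul, ← integral_indicator measurableSet_Ioi]
    refine integral_congr_ae (ae_of_all _ fun x => ?_)
    simp only [indicator_apply, shear, Prod.mk_add_mk, add_zero]
    split_ifs <;> ring
  · simp only [indicator_of_notMem hτ, mul_zero, zero_mul, integral_zero]

end ZeroEpsilon

theorem exists_isFundamentalSolution {α a ε : ℝ} (h0 : 0 < α) (h1 : α < 1) (ha : 0 < a)
    (hε : 0 ≤ ε) : ∃ (μ : Measure (ℝ × ℝ)) (f : ℝ × ℝ → ℝ), SFinite μ ∧
      IsFundamentalSolution α a ε μ f ∧ ∀ g : ℝ → ℝ, LocallyIntegrableOn g (Ici 0) →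
        IsSuperposition μ f g (closedForm α a ε g) := by
  rcases hε.eq_or_lt with rfl | hε
  · exact ⟨rayMeasure a, rayDensity a, inferInstance, isFundamentalSolution_rayDensity α ha,
      fun g hg => isSuperposition_rayDensity α ha hg⟩
  · exact ⟨volume, fundamentalDensity α a ε, inferInstance,
      isFundamentalSolution_fundamentalDensity h0 h1 ha hε,
      fun g hg => isSuperposition_fundamentalDensity h0 h1 ha hε hg⟩

end FracAdvection

end

theorem mainTheorem4 :
    -- the solution: existence, and uniqueness among all weak solutions
    (∀ α a ε : ℝ, 0 < α → α < 1 → 0 < a → 0 ≤ ε →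
      ∀ g : ℝ → ℝ, LocallyIntegrableOn g (Ici 0) →
        FracAdvection.IsWeakSolution α a ε g (FracAdvection.closedForm α a ε g) ∧
        ∀ u : ℝ × ℝ → ℝ, FracAdvection.IsWeakSolution α a ε g u →
          ∀ᵐ p ∂(volume.restrict {p : ℝ × ℝ | 0 < p.2}),
            u p = FracAdvection.closedForm α a ε g p) ∧
    -- the Laplace transform of the kernel
    (∀ α y : ℝ, 0 < α → α < 1 → 0 < y → ∀ s : ℂ, 0 < s.re →
      IntegrableOn (fun t : ℝ => Complex.exp (-s * t) * (FracAdvection.kernel α y t : ℂ))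
        (Ioi 0) ∧
      ∫ t in Ioi (0 : ℝ), Complex.exp (-s * t) * (FracAdvection.kernel α y t : ℂ)
        = Complex.exp (-(y : ℂ) * s ^ (α : ℂ))) ∧
    -- `α = 1/3`
    (∀ y t : ℝ, 0 < y → 0 < t →
      FracAdvection.kernel (1 / 3) y t
        = y / ((3 : ℝ) ^ (1 / 3 : ℝ) * t ^ (4 / 3 : ℝ))
          * FracAdvection.airyAi (y / ((3 : ℝ) ^ (1 / 3 : ℝ) * t ^ (1 / 3 : ℝ)))) ∧
    -- `α = 1/2`
    (∀ y t : ℝ, 0 < y → 0 < t →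
      FracAdvection.kernel (1 / 2) y t
        = y / (2 * √Real.pi * t ^ (3 / 2 : ℝ)) * Real.exp (-(y ^ 2) / (4 * t))) := by
  refine ⟨fun α a ε h0 h1 ha hε g hg => ?_, fun α y h0 h1 hy s hs =>
    ⟨FracAdvection.integrable_exp_neg_mul_kernel h0 h1 hy hs |>.integrableOn,
      FracAdvection.integral_exp_neg_mul_kernel h0 h1 hy hs⟩,
    fun y t hy ht => FracAdvection.kernel_one_third hy ht,
    fun y t hy ht => FracAdvection.kernel_one_half hy ht⟩
  obtain ⟨μ, f, hμ, hf, hsup⟩ := FracAdvection.exists_isFundamentalSolution h0 h1 ha hε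
  have hsol := hf.isWeakSolution h0.le h1 (hsup g hg)
  exact ⟨hsol, fun u hu => hf.ae_eq ha h0.le h1 hu hsol⟩
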